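/- Let $\Bbbk$ be a commutative ring and $k,n\ge 0$ integers. All algebras are $\mathbb Z$-graded superalgebras over $\Bbbk$; tensor products of superalgebras carry the multiplication $(a\otimes b)(a'\otimes b')=(-1)^{|b||a'|}aa'\otimes bb'$. Notation. Let $OPol_k=\Bbbk\langle x_1,\dots,x_k\rangle/(x_ix_j+x_jx_i,\ i\ne j)$ with $x_i$ odd of degree $2$. Let $s_i$ be the algebra automorphism $x_j\mapsto -x_{s_i(j)}$, and let $\partial_i$ be the odd divided difference: $\partial_i(x_j)=1$ for $j=i,i+1$ and $0$ otherwise, $\partial_i(fg)=\partial_i(f)g+s_i(f)\partial_i(g)$. Put $O\Lambda_k=\bigcap_i\ker\partial_i$, $\tilde x_i=(-1)^{i-1}x_i$ and $h_m=\sum_{i_1\le\dots\le i_m}\tilde x_{i_1}\cdots\tilde x_{i_m}\in O\Lambda_k$. Let $ONH_k$ be the odd nilHecke algebra, with generators $x_1,\dots,x_k$ (odd, degree $2$) and $\tau_1,\dots,\tau_{k-1}$ (odd, degree $-2$) and relations $\tau_i^2=0$, $\tau_i\tau_{i+1}\tau_i=\tau_{i+1}\tau_i\tau_{i+1}$, $x_i\tau_i+\tau_ix_{i+1}=1=\tau_ix_i+x_{i+1}\tau_i$,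 $x_ix_j+x_jx_i=0$ $(i\ne j)$, $\tau_i\tau_j+\tau_j\tau_i=0$ $(|i-j|>1)$, $x_i\tau_j+\tau_jx_i=0$ $(i\ne j,j+1)$. Let $\phi$ be its representation on $OPol_k$ in which $x_i$ acts by left multiplication and $\tau_i$ by $\partial_i$. Let $A_n$ be the supercommutative superalgebra generated by even $\chi_i$ of degree $4i$ ($1\le i\le\lfloor n/2\rfloor$) and an odd $d$ of degree $2$, with relations $d^2=0$ and, if $n$ is even, $d\chi_{n/2}=0$ (where $\chi_0=1$); put $c_{2i}=\chi_i$, $c_{2i+1}=d\chi_i$. Define $$ONH_k^n=(ONH_k\otimes A_n)/\langle a^n(x_1)\rangle,\qquad a^n(x_1)=\sum_{\ell=0}^n(-1)^\ell x_1^\ell c_{n-\ell}$$ (no relation is imposed if $k=0$), and $$M_k^n=(O\Lambda_k\otimes A_n)/\langle h'_m:\ n-k+1\le m\le n,\ m\ge 0\rangle,\qquad h'_m=\sum_{r=0}^m(-1)^r h_{m-r}\otimes c_r .$$ Let $\theta$ be the automorphism of $OPol_k$ with $\theta(x_i)=(-1)^{k-1}x_{k+1-i}$; it restricts to an automorphism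 of $O\Lambda_k$. Let $OPol_k\otimes_{O\Lambda_k}M_k^n$ be the quotient of $OPol_k\otimes M_k^n$ by the relations $f\,\theta(g)\otimes m=f\otimes \overline{(g\otimes 1)}\,m$ for $g\in O\Lambda_k$; it is a graded right $M_k^n$-module. Theorem. There are isomorphisms of graded superalgebras $$\Phi: ONH_k^n\to \mathrm{End}_{M_k^n}(OPol_k\otimes_{O\Lambda_k}M_k^n),\qquad \Psi: ONH_k^n\to \mathrm{Mat}_{k!}(M_k^n)$$ such that $\Phi$ is induced by the odd polynomial representation: $\Phi(\overline{u\otimes a})(f\otimes m)=(-1)^{|a||f|}\,\phi(u)(f)\otimes \overline{(1\otimes a)}\,m$ for $u\in ONH_k$, homogeneous $a\in A_n$ and $f\in OPol_k$, and $m\in M_k^n$; and $\Psi(z)$ is the matrix of $\Phi(z)$ with respect to the $k!$ elements $x_1^{a_1}\cdots x_k^{a_k}\otimes 1$, $0\le a_i\le k-i$: $\Phi(z)(b_j)=\sum_i b_i\,\Psi(z)_{ij}$. Here a matrix is homogeneous of bidegree $g\in\mathbb Z\times\mathbb Z/2$ if its $(i,j)$ entry is homogeneous of bidegree $g+\deg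 b_j-\deg b_i$. -/

import Mathlib

open scoped TensorProduct Nat

noncomputable section

namespace OddGrassmannian

/-! ### Graded superalgebras given by generators and relations -/

/-- Degrees of graded superspaces: a `ℤ`-degree together with a parity. -/
abbrev Bideg : Type := ℤ × ZMod 2

/-- `(-1) ^ g` is the sign given by the parity of `g`; in particular the Koszul sign of
homogeneous elements of bidegrees `p` and `q` is `(-1) ^ (p * q)`. -/
instance : Module Bideg (Additive ℤˣ) :=
  Module.compHom (Additive ℤˣ) (RingHom.snd ℤ (ZMod 2))

/-- The quotient of an algebra by the two-sided ideal generated by the elements satisfying `S`. -/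
abbrev QuotBy {A : Type*} [Ring A] (S : A → Prop) : Type _ :=
  RingQuot (fun a b : A => S a ∧ b = 0)

/-- The quotient map. -/
abbrev QuotBy.mk (𝕜 : Type*) [CommRing 𝕜] {A : Type*} [Ring A] [Algebra 𝕜 A] (S : A → Prop) :
    A →ₐ[𝕜] QuotBy S :=
  RingQuot.mkAlgHom 𝕜 (fun a b : A => S a ∧ b = 0)

/-- The universal property of the quotient. -/
def QuotBy.lift {𝕜 : Type*} [CommRing 𝕜] {A B : Type*} [Ring A] [Algebra 𝕜 A] [Semiring B]
    [Algebra 𝕜 B] (S : A → Prop) (f : A →ₐ[𝕜] B) (h : ∀ a, S a → f a = 0) : QuotBy S →ₐ[𝕜] B :=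
  RingQuot.liftAlgHom 𝕜 ⟨f, by rintro a b ⟨ha, rfl⟩; rw [h a ha, map_zero]⟩

theorem QuotBy.lift_mk {𝕜 : Type*} [CommRing 𝕜] {A B : Type*} [Ring A] [Algebra 𝕜 A] [Semiring B]
    [Algebra 𝕜 B] (S : A → Prop) (f : A →ₐ[𝕜] B) (h : ∀ a, S a → f a = 0) (a : A) :
    QuotBy.lift S f h (QuotBy.mk 𝕜 S a) = f a := by
  simp [QuotBy.lift, QuotBy.mk]

theorem QuotBy.mk_eq_zero {𝕜 : Type*} [CommRing 𝕜] {A : Type*} [Ring A] [Algebra 𝕜 A]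
    (S : A → Prop) {a : A} (h : S a) : QuotBy.mk 𝕜 S a = 0 := by
  rw [← map_zero (QuotBy.mk 𝕜 S)]
  exact RingQuot.mkAlgHom_rel 𝕜 ⟨h, rfl⟩

theorem QuotBy.mk_surj {𝕜 : Type*} [CommRing 𝕜] {A : Type*} [Ring A] [Algebra 𝕜 A]
    (S : A → Prop) : Function.Surjective (QuotBy.mk 𝕜 S) :=
  RingQuot.mkAlgHom_surjective 𝕜 _

/-- The span of the words of bidegree `g` in the free algebra, for generators of given
bidegrees. -/
def wordComp (𝕜 : Type*) [CommRing 𝕜] {X : Type*} (deg : X → Bideg) (g : Bideg) :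
    Submodule 𝕜 (FreeAlgebra 𝕜 X) :=
  Submodule.span 𝕜 {w | ∃ l : List X, (l.map (FreeAlgebra.ι 𝕜)).prod = w ∧ (l.map deg).sum = g}

/-- The component of bidegree `g` of an algebra given by generators and relations. -/
def presComp {𝕜 : Type*} [CommRing 𝕜] {X : Type*} (deg : X → Bideg)
    (S : FreeAlgebra 𝕜 X → Prop) (g : Bideg) : Submodule 𝕜 (QuotBy S) :=
  (wordComp 𝕜 deg g).map (QuotBy.mk 𝕜 S).toLinearMap

section Grading

variable {𝕜 : Type*} [CommRing 𝕜] {X : Type*} (deg : X → Bideg)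

theorem wordComp_one : (1 : FreeAlgebra 𝕜 X) ∈ wordComp 𝕜 deg 0 :=
  Submodule.subset_span ⟨[], by simp, by simp⟩

theorem wordComp_gen (x : X) : FreeAlgebra.ι 𝕜 x ∈ wordComp 𝕜 deg (deg x) :=
  Submodule.subset_span ⟨[x], by simp, by simp⟩

theorem wordComp_mul {a b : FreeAlgebra 𝕜 X} {p q r : Bideg} (ha : a ∈ wordComp 𝕜 deg p)
    (hb : b ∈ wordComp 𝕜 deg q) (hr : p + q = r) : a * b ∈ wordComp 𝕜 deg r := by
  subst hr
  have := Submodule.mul_mem_mul ha hb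
  rw [wordComp, wordComp, Submodule.span_mul_span] at this
  refine Submodule.span_mono ?_ this
  rintro _ ⟨_, ⟨l, rfl, hl⟩, _, ⟨l', rfl, hl'⟩, rfl⟩
  exact ⟨l ++ l', by simp, by simp [hl, hl']⟩

theorem presComp_mul {S : FreeAlgebra 𝕜 X → Prop} {a b : QuotBy S} {p q : Bideg}
    (ha : a ∈ presComp deg S p) (hb : b ∈ presComp deg S q) : a * b ∈ presComp deg S (p + q) := by
  obtain ⟨a, ha, rfl⟩ := ha
  obtain ⟨b, hb, rfl⟩ := hb
  exact ⟨a * b, wordComp_mul deg ha hb rfl, by simp⟩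

theorem presComp_one {S : FreeAlgebra 𝕜 X → Prop} : (1 : QuotBy S) ∈ presComp deg S 0 :=
  ⟨1, wordComp_one deg, by simp⟩

theorem presComp_gen {S : FreeAlgebra 𝕜 X → Prop} (x : X) :
    QuotBy.mk 𝕜 S (FreeAlgebra.ι 𝕜 x) ∈ presComp deg S (deg x) :=
  ⟨_, wordComp_gen deg x, rfl⟩

instance presComp_gradedMonoid (S : FreeAlgebra 𝕜 X → Prop) :
    SetLike.GradedMonoid (presComp deg S) where
  one_mem := presComp_one deg
  mul_mem _ _ _ _ ha hb := presComp_mul deg ha hb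

/-- The map from the free algebra to the direct sum of the components. -/
def presDecompFree (S : FreeAlgebra 𝕜 X → Prop) :
    FreeAlgebra 𝕜 X →ₐ[𝕜] DirectSum Bideg (fun g => presComp deg S g) :=
  FreeAlgebra.lift 𝕜 fun x =>
    DirectSum.of (fun g => presComp deg S g) (deg x)
      ⟨QuotBy.mk 𝕜 S (FreeAlgebra.ι 𝕜 x), presComp_gen deg x⟩

theorem presDecompFree_word (S : FreeAlgebra 𝕜 X → Prop) (l : List X) (g : Bideg)
    (hl : (l.map deg).sum = g)
    (hm : QuotBy.mk 𝕜 S (l.map (FreeAlgebra.ι 𝕜)).prod ∈ presComp deg S g) :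
    presDecompFree deg S (l.map (FreeAlgebra.ι 𝕜)).prod
      = DirectSum.of (fun g => presComp deg S g) g ⟨_, hm⟩ := by
  subst hl
  induction l with
  | nil =>
    simp only [List.map_nil, List.prod_nil, map_one]
    rfl
  | cons x l ih =>
    have hm' : QuotBy.mk 𝕜 S (l.map (FreeAlgebra.ι 𝕜)).prod ∈ presComp deg S (l.map deg).sum :=
      ⟨_, Submodule.subset_span ⟨l, rfl, rfl⟩, rfl⟩
    simp only [List.map_cons, List.prod_cons, map_mul]
    rw [ih hm']
    simp only [presDecompFree, FreeAlgebra.lift_ι_apply]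
    rw [DirectSum.of_mul_of]
    rfl

theorem presDecompFree_mem (S : FreeAlgebra 𝕜 X → Prop) (g : Bideg) (w : FreeAlgebra 𝕜 X)
    (hw : w ∈ wordComp 𝕜 deg g) :
    presDecompFree deg S w
      = DirectSum.of (fun g => presComp deg S g) g ⟨QuotBy.mk 𝕜 S w, ⟨w, hw, rfl⟩⟩ := by
  induction hw using Submodule.span_induction with
  | mem x h =>
    obtain ⟨l, rfl, hl⟩ := h
    exact presDecompFree_word deg S l g hl _
  | zero =>
    rw [map_zero]
    have h0 : (⟨QuotBy.mk 𝕜 S 0, ⟨0, Submodule.zero_mem _, rfl⟩⟩ : presComp deg S g) = 0 :=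
      Subtype.ext (map_zero _)
    rw [h0, map_zero]
  | add x y hx hy h1 h2 =>
    rw [map_add, h1, h2, ← map_add]
    congr 1
    exact Subtype.ext (map_add (QuotBy.mk 𝕜 S) x y).symm
  | smul c x hx h1 =>
    rw [map_smul, h1, ← DirectSum.lof_eq_of 𝕜, ← DirectSum.lof_eq_of 𝕜, ← map_smul]
    congr 1
    exact Subtype.ext (map_smul (QuotBy.mk 𝕜 S) c x).symm

theorem presDecompFree_rel (S : FreeAlgebra 𝕜 X → Prop)
    (hS : ∀ r, S r → ∃ g, r ∈ wordComp 𝕜 deg g) (r : FreeAlgebra 𝕜 X) (hr : S r) :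
    presDecompFree deg S r = 0 := by
  obtain ⟨g, hg⟩ := hS r hr
  rw [presDecompFree_mem deg S g r hg]
  have h0 : (⟨QuotBy.mk 𝕜 S r, ⟨r, hg, rfl⟩⟩ : presComp deg S g) = 0 :=
    Subtype.ext (QuotBy.mk_eq_zero S hr)
  rw [h0, map_zero]

/-- The decomposition map of an algebra with homogeneous relations. -/
def presDecomp (S : FreeAlgebra 𝕜 X → Prop) (hS : ∀ r, S r → ∃ g, r ∈ wordComp 𝕜 deg g) :
    QuotBy S →ₐ[𝕜] DirectSum Bideg (fun g => presComp deg S g) :=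
  QuotBy.lift S (presDecompFree deg S) (presDecompFree_rel deg S hS)

/-- An algebra presented by generators of given bidegrees and homogeneous relations is graded. -/
abbrev presGraded (S : FreeAlgebra 𝕜 X → Prop) (hS : ∀ r, S r → ∃ g, r ∈ wordComp 𝕜 deg g) :
    GradedAlgebra (presComp deg S) :=
  GradedAlgebra.ofAlgHom (presComp deg S) (presDecomp deg S hS)
    (by
      apply RingQuot.ringQuot_ext'
      apply FreeAlgebra.hom_ext
      funext x
      have h := QuotBy.lift_mk S (presDecompFree deg S)
        (presDecompFree_rel deg S hS) (FreeAlgebra.ι 𝕜 x)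
      change DirectSum.coeAlgHom (presComp deg S)
        (presDecomp deg S hS (QuotBy.mk 𝕜 S (FreeAlgebra.ι 𝕜 x))) = _
      rw [presDecomp, h]
      simp [presDecompFree])
    (by
      rintro g ⟨_, w, hw, rfl⟩
      simp only [AlgHom.toLinearMap_apply]
      rw [presDecomp, QuotBy.lift_mk, presDecompFree_mem deg S g w hw])

end Grading

/-- The component of bidegree `g` of a tensor product of two graded superalgebras. -/
def tensComp {𝕜 A B : Type*} [CommRing 𝕜] [Ring A] [Ring B] [Algebra 𝕜 A] [Algebra 𝕜 B]
    (𝒜 : Bideg → Submodule 𝕜 A) (ℬ : Bideg → Submodule 𝕜 B) [GradedAlgebra 𝒜] [GradedAlgebra ℬ]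
    (g : Bideg) : Submodule 𝕜 (𝒜 ᵍ⊗[𝕜] ℬ) :=
  Submodule.span 𝕜 {z | ∃ p q : Bideg, p + q = g ∧ ∃ a ∈ 𝒜 p, ∃ b ∈ ℬ q, z = a ᵍ⊗ₜ[𝕜] b}

/-! ### Skew polynomials and odd divided differences -/

/-- The relations of skew polynomials. -/
inductive OPolRel (𝕜 : Type*) [CommRing 𝕜] (k : ℕ) : FreeAlgebra 𝕜 (Fin k) → Prop
  | xx (i j : Fin k) (h : i ≠ j) :
      OPolRel 𝕜 k (FreeAlgebra.ι 𝕜 i * FreeAlgebra.ι 𝕜 j + FreeAlgebra.ι 𝕜 j * FreeAlgebra.ι 𝕜 i)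

/-- The algebra of skew polynomials in `k` variables. -/
abbrev OPol (𝕜 : Type*) [CommRing 𝕜] (k : ℕ) : Type _ := QuotBy (OPolRel 𝕜 k)

/-- The component of bidegree `g` of the skew polynomials; each variable has degree `2` and is
odd. -/
abbrev OPolComp (𝕜 : Type*) [CommRing 𝕜] (k : ℕ) (g : Bideg) : Submodule 𝕜 (OPol 𝕜 k) :=
  presComp (fun _ : Fin k => ((2, 1) : Bideg)) (OPolRel 𝕜 k) g

section OPol

variable {𝕜 : Type*} [CommRing 𝕜] {k : ℕ}

instance : GradedAlgebra (OPolComp 𝕜 k) :=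
  presGraded _ _ (by
    rintro _ ⟨i, j, h⟩
    exact ⟨(2, 1) + (2, 1), Submodule.add_mem _
      (wordComp_mul _ (wordComp_gen _ i) (wordComp_gen _ j) rfl)
      (wordComp_mul _ (wordComp_gen _ j) (wordComp_gen _ i) rfl)⟩)

/-- The variables. -/
def OPol.x (𝕜 : Type*) [CommRing 𝕜] {k : ℕ} (i : Fin k) : OPol 𝕜 k :=
  QuotBy.mk 𝕜 (OPolRel 𝕜 k) (FreeAlgebra.ι 𝕜 i)

theorem OPol.x_anti {i j : Fin k} (h : i ≠ j) :
    OPol.x 𝕜 i * OPol.x 𝕜 j + OPol.x 𝕜 j * OPol.x 𝕜 i = 0 := by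
  have := QuotBy.mk_eq_zero (𝕜 := 𝕜) (OPolRel 𝕜 k) (OPolRel.xx i j h)
  rw [map_add, map_mul, map_mul] at this
  exact this

/-- The algebra map with given values on the variables. -/
def OPol.lift {B : Type*} [Ring B] [Algebra 𝕜 B] (f : Fin k → B)
    (h : ∀ i j, i ≠ j → f i * f j + f j * f i = 0) : OPol 𝕜 k →ₐ[𝕜] B :=
  QuotBy.lift (OPolRel 𝕜 k) (FreeAlgebra.lift 𝕜 f) (by
    rintro _ ⟨i, j, hij⟩
    simpa using h i j hij)

theorem OPol.lift_x {B : Type*} [Ring B] [Algebra 𝕜 B] (f : Fin k → B)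
    (h : ∀ i j, i ≠ j → f i * f j + f j * f i = 0) (i : Fin k) :
    OPol.lift f h (OPol.x 𝕜 i) = f i := by
  rw [OPol.lift, OPol.x, QuotBy.lift_mk, FreeAlgebra.lift_ι_apply]

theorem OPol.mem_of_mul {N : Submodule 𝕜 (OPol 𝕜 k)} (h1 : 1 ∈ N)
    (hx : ∀ i, ∀ f ∈ N, OPol.x 𝕜 i * f ∈ N) (f : OPol 𝕜 k) : f ∈ N := by
  obtain ⟨a, rfl⟩ := QuotBy.mk_surj (𝕜 := 𝕜) (OPolRel 𝕜 k) f
  suffices h : ∀ b ∈ N, QuotBy.mk 𝕜 (OPolRel 𝕜 k) a * b ∈ N by simpa using h 1 h1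
  induction a using FreeAlgebra.induction with
  | grade0 r =>
    intro b hb
    rw [AlgHom.commutes, ← Algebra.smul_def]
    exact N.smul_mem _ hb
  | grade1 i => exact hx i
  | mul a b ha hb =>
    intro c hc
    rw [map_mul, mul_assoc]
    exact ha _ (hb _ hc)
  | add a b ha hb =>
    intro c hc
    rw [map_add, add_mul]
    exact N.add_mem (ha _ hc) (hb _ hc)

/-- The index `i` of the pair `i, i + 1`. -/
def lo {k : ℕ} (i : Fin (k - 1)) : Fin k := ⟨i, by omega⟩

/-- The index `i + 1` of the pair `i, i + 1`. -/
def hi {k : ℕ} (i : Fin (k - 1)) : Fin k := ⟨i + 1, by omega⟩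

theorem lo_ne_hi (i : Fin (k - 1)) : lo i ≠ hi i := by
  simp [lo, hi, Fin.ext_iff]

/-- The signed action of the simple transposition `(i, i + 1)`: `x_j ↦ - x_{s_i(j)}`. -/
def OPol.s (i : Fin (k - 1)) : OPol 𝕜 k →ₐ[𝕜] OPol 𝕜 k :=
  OPol.lift (fun j => - OPol.x 𝕜 (Equiv.swap (lo i) (hi i) j)) (by
    intro a b h
    simpa using OPol.x_anti (𝕜 := 𝕜) (fun e => h ((Equiv.swap (lo i) (hi i)).injective e)))

/-- The value of the odd divided difference on a variable. -/
def OPol.dVar (𝕜 : Type*) [CommRing 𝕜] {k : ℕ} (i : Fin (k - 1)) (j : Fin k) : OPol 𝕜 k :=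
  if j = lo i ∨ j = hi i then 1 else 0

/-- The algebra map `f ↦ !![s_i f, ∂_i f; 0, f]`; its multiplicativity is the twisted Leibniz
rule for `∂_i`. -/
def OPol.sdMat (i : Fin (k - 1)) : OPol 𝕜 k →ₐ[𝕜] Matrix (Fin 2) (Fin 2) (OPol 𝕜 k) :=
  OPol.lift (fun j => !![- OPol.x 𝕜 (Equiv.swap (lo i) (hi i) j), OPol.dVar 𝕜 i j; 0, OPol.x 𝕜 j])
    (by
      intro a b h
      have h1 : OPol.x 𝕜 (Equiv.swap (lo i) (hi i) a) * OPol.x 𝕜 (Equiv.swap (lo i) (hi i) b)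
          + OPol.x 𝕜 (Equiv.swap (lo i) (hi i) b) * OPol.x 𝕜 (Equiv.swap (lo i) (hi i) a) = 0 :=
        OPol.x_anti (fun e => h ((Equiv.swap (lo i) (hi i)).injective e))
      have h2 := OPol.x_anti (𝕜 := 𝕜) h
      have hlh := lo_ne_hi i
      have h3 : - OPol.x 𝕜 (Equiv.swap (lo i) (hi i) a) * OPol.dVar 𝕜 i b
          + OPol.dVar 𝕜 i a * OPol.x 𝕜 b + (- OPol.x 𝕜 (Equiv.swap (lo i) (hi i) b)
          * OPol.dVar 𝕜 i a + OPol.dVar 𝕜 i b * OPol.x 𝕜 a) = 0 := by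
        unfold OPol.dVar
        by_cases ha : a = lo i
        · subst ha
          by_cases hb : b = hi i
          · subst hb; simp
          · simp [Ne.symm h, hb, Equiv.swap_apply_of_ne_of_ne (Ne.symm h) hb]
        · by_cases ha' : a = hi i
          · subst ha'
            by_cases hb : b = lo i
            · subst hb; simp
            · simp [Ne.symm h, hb, Equiv.swap_apply_of_ne_of_ne hb (Ne.symm h)]
          · rw [Equiv.swap_apply_of_ne_of_ne ha ha']
            by_cases hb : b = lo i
            · subst hb; simp [ha, ha']
            · by_cases hb' : b = hi i
              · subst hb'; simp [ha, ha']
              · simp [ha, ha', hb, hb']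
      ext p q
      fin_cases p <;> fin_cases q
      · simpa [Matrix.mul_apply, Fin.sum_univ_two] using h1
      · simpa [Matrix.mul_apply, Fin.sum_univ_two] using h3
      · simp
      · simpa [Matrix.mul_apply, Fin.sum_univ_two] using h2)

/-- The odd divided difference operator `∂_i`. -/
def OPol.d (i : Fin (k - 1)) : OPol 𝕜 k →ₗ[𝕜] OPol 𝕜 k :=
  (Matrix.entryLinearMap 𝕜 (OPol 𝕜 k) 0 1).comp (OPol.sdMat i).toLinearMap

theorem OPol.sdMat_eq (i : Fin (k - 1)) (f : OPol 𝕜 k) :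
    OPol.sdMat i f = !![OPol.s i f, OPol.d i f; 0, f] := by
  have h : OPol.sdMat i f 0 0 = OPol.s i f ∧ OPol.sdMat i f 1 0 = 0 ∧ OPol.sdMat i f 1 1 = f := by
    let N : Submodule 𝕜 (OPol 𝕜 k) :=
      { carrier := {f | OPol.sdMat i f 0 0 = OPol.s i f ∧ OPol.sdMat i f 1 0 = 0 ∧
          OPol.sdMat i f 1 1 = f}
        zero_mem' := by simp
        add_mem' := by
          rintro a b ⟨h1, h2, h3⟩ ⟨h4, h5, h6⟩
          simp [h1, h2, h3, h4, h5, h6]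
        smul_mem' := by
          rintro c a ⟨h1, h2, h3⟩
          simp [h1, h2, h3] }
    refine OPol.mem_of_mul (N := N) ?_ ?_ f
    · simp [N]
    · rintro j g ⟨h1, h2, h3⟩
      have hx : OPol.sdMat i (OPol.x 𝕜 j)
          = !![- OPol.x 𝕜 (Equiv.swap (lo i) (hi i) j), OPol.dVar 𝕜 i j; 0, OPol.x 𝕜 j] :=
        OPol.lift_x _ _ j
      have hs : OPol.s i (OPol.x 𝕜 j) = - OPol.x 𝕜 (Equiv.swap (lo i) (hi i) j) :=
        OPol.lift_x _ _ j
      refine ⟨?_, ?_, ?_⟩ <;> simp [hx, hs, Matrix.mul_apply, Fin.sum_univ_two, h1, h2, h3]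
  obtain ⟨h1, h2, h3⟩ := h
  ext p q
  fin_cases p <;> fin_cases q
  · exact h1
  · rfl
  · exact h2
  · exact h3

theorem OPol.s_x (i : Fin (k - 1)) (j : Fin k) :
    OPol.s i (OPol.x 𝕜 j) = - OPol.x 𝕜 (Equiv.swap (lo i) (hi i) j) :=
  OPol.lift_x _ _ j

theorem OPol.d_x (i : Fin (k - 1)) (j : Fin k) :
    OPol.d i (OPol.x 𝕜 j) = if j = lo i ∨ j = hi i then 1 else 0 := by
  change OPol.sdMat i (OPol.x 𝕜 j) 0 1 = _
  rw [OPol.sdMat, OPol.lift_x]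
  rfl

/-- The twisted Leibniz rule. -/
theorem OPol.d_mul (i : Fin (k - 1)) (f g : OPol 𝕜 k) :
    OPol.d i (f * g) = OPol.d i f * g + OPol.s i f * OPol.d i g := by
  change OPol.sdMat i (f * g) 0 1 = _
  rw [map_mul, OPol.sdMat_eq, OPol.sdMat_eq, Matrix.mul_apply, Fin.sum_univ_two]
  simp [add_comm]

theorem OPol.d_one (i : Fin (k - 1)) : OPol.d i (1 : OPol 𝕜 k) = 0 := by
  change OPol.sdMat i 1 0 1 = _
  simp

end OPol

/-! ### Odd symmetric polynomials -/

/-- The algebra of odd symmetric polynomials: the common kernel of the odd divided differences. -/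
def OSym (𝕜 : Type*) [CommRing 𝕜] (k : ℕ) : Subalgebra 𝕜 (OPol 𝕜 k) where
  carrier := {f | ∀ i : Fin (k - 1), OPol.d i f = 0}
  add_mem' := by
    intro a b ha hb i
    rw [map_add, ha i, hb i, add_zero]
  mul_mem' := by
    intro a b ha hb i
    rw [OPol.d_mul, ha i, hb i, zero_mul, mul_zero, add_zero]
  algebraMap_mem' := by
    intro r i
    rw [Algebra.algebraMap_eq_smul_one, map_smul, OPol.d_one, smul_zero]

/-- The component of bidegree `g` of the odd symmetric polynomials. -/
def OSymComp (𝕜 : Type*) [CommRing 𝕜] (k : ℕ) (g : Bideg) : Submodule 𝕜 (OSym 𝕜 k) :=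
  (OPolComp 𝕜 k g).comap (OSym 𝕜 k).val.toLinearMap

section OSym

variable {𝕜 : Type*} [CommRing 𝕜] {k : ℕ}

theorem OPol.mk_word (l : List (Fin k)) :
    QuotBy.mk 𝕜 (OPolRel 𝕜 k) (l.map (FreeAlgebra.ι 𝕜)).prod = (l.map (OPol.x 𝕜)).prod := by
  rw [map_list_prod, List.map_map]
  rfl

theorem OPol.x_mem (j : Fin k) : OPol.x 𝕜 j ∈ OPolComp 𝕜 k (2, 1) :=
  presComp_gen _ j

theorem OPol.d_word (i : Fin (k - 1)) (l : List (Fin k)) :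
    OPol.d i (l.map (OPol.x 𝕜)).prod
      ∈ OPolComp 𝕜 k ((l.map fun _ => ((2, 1) : Bideg)).sum + (-2, 1)) := by
  induction l with
  | nil => simp [OPol.d_one]
  | cons j l ih =>
    have hw : (l.map (OPol.x 𝕜)).prod
        ∈ OPolComp 𝕜 k (l.map fun _ => ((2, 1) : Bideg)).sum :=
      ⟨(l.map (FreeAlgebra.ι 𝕜)).prod, Submodule.subset_span ⟨l, rfl, rfl⟩,
        OPol.mk_word l⟩
    simp only [List.map_cons, List.prod_cons, List.sum_cons]
    rw [OPol.d_mul, OPol.d_x, OPol.s_x]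
    refine Submodule.add_mem _ ?_ ?_
    · have e : ((2, 1) : Bideg) + (l.map fun _ => ((2, 1) : Bideg)).sum + (-2, 1)
          = (l.map fun _ => ((2, 1) : Bideg)).sum := by
        rw [add_comm, ← add_assoc]
        have : ((-2, 1) : Bideg) + (2, 1) = 0 := by decide
        rw [this, zero_add]
      rw [e]
      split_ifs
      · rwa [one_mul]
      · rw [zero_mul]
        exact Submodule.zero_mem _
    · rw [neg_mul, add_assoc]
      exact Submodule.neg_mem _ (presComp_mul _ (OPol.x_mem _) ih)

/-- The operator `∂_i` is homogeneous of degree `-2` and odd. -/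
theorem OPol.d_mem (i : Fin (k - 1)) {g : Bideg} {f : OPol 𝕜 k} (hf : f ∈ OPolComp 𝕜 k g) :
    OPol.d i f ∈ OPolComp 𝕜 k (g + (-2, 1)) := by
  obtain ⟨w, hw, rfl⟩ := hf
  rw [AlgHom.toLinearMap_apply]
  induction hw using Submodule.span_induction with
  | mem x h =>
    obtain ⟨l, rfl, rfl⟩ := h
    rw [OPol.mk_word]
    exact OPol.d_word i l
  | zero => simp
  | add x y hx hy h1 h2 =>
    rw [map_add, map_add]
    exact Submodule.add_mem _ h1 h2
  | smul c x hx h1 =>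
    rw [map_smul, map_smul]
    exact Submodule.smul_mem _ _ h1

/-- The homogeneous components of an odd symmetric polynomial are odd symmetric. -/
theorem OSym.component_mem {f : OPol 𝕜 k} (hf : f ∈ OSym 𝕜 k) (g : Bideg) :
    (DirectSum.decompose (OPolComp 𝕜 k) f g : OPol 𝕜 k) ∈ OSym 𝕜 k := by
  classical
  intro i
  have key : ∀ f : OPol 𝕜 k, OPol.d i (DirectSum.decompose (OPolComp 𝕜 k) f g : OPol 𝕜 k)
      = (DirectSum.decompose (OPolComp 𝕜 k) (OPol.d i f) (g + (-2, 1)) : OPol 𝕜 k) := by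
    intro f
    induction f using DirectSum.Decomposition.inductionOn (OPolComp 𝕜 k) with
    | zero => simp
    | homogeneous m =>
      rename_i p
      by_cases h : p = g
      · subst h
        rw [DirectSum.decompose_of_mem_same _ m.2,
          DirectSum.decompose_of_mem_same _ (OPol.d_mem i m.2)]
      · rw [DirectSum.decompose_of_mem_ne _ m.2 h,
          DirectSum.decompose_of_mem_ne _ (OPol.d_mem i m.2) (fun e => h (add_right_cancel e)),
          map_zero]
    | add a b ha hb => simp [ha, hb]
  rw [key, hf i]
  simp

instance OSym_gradedMonoid : SetLike.GradedMonoid (OSymComp 𝕜 k) where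
  one_mem := presComp_one _
  mul_mem _ _ _ _ ha hb := presComp_mul _ ha hb

theorem OSym.decompose_coe (z : DirectSum Bideg (fun g => OSymComp 𝕜 k g)) (g : Bideg) :
    (DirectSum.decompose (OPolComp 𝕜 k)
      ((DirectSum.coeAddMonoidHom (OSymComp 𝕜 k) z : OSym 𝕜 k) : OPol 𝕜 k) g : OPol 𝕜 k)
      = ((z g : OSym 𝕜 k) : OPol 𝕜 k) := by
  classical
  induction z using DirectSum.induction_on with
  | zero => simp
  | of p x =>
    rw [DirectSum.coeAddMonoidHom_of]
    have hx : ((x : OSym 𝕜 k) : OPol 𝕜 k) ∈ OPolComp 𝕜 k p := x.2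
    by_cases h : p = g
    · subst h
      rw [DirectSum.decompose_of_mem_same _ hx, DirectSum.of_eq_same]
    · rw [DirectSum.decompose_of_mem_ne _ hx h, DirectSum.of_eq_of_ne _ _ _ (Ne.symm h)]
      rfl
  | add a b ha hb =>
    rw [map_add, Subalgebra.coe_add, DirectSum.decompose_add, DirectSum.add_apply,
      Submodule.coe_add, ha, hb]
    rfl

theorem OSym.isInternal : DirectSum.IsInternal (OSymComp 𝕜 k) := by
  classical
  constructor
  · intro z w h
    refine DFinsupp.ext fun g => Subtype.ext (Subtype.ext ?_)
    have h1 := OSym.decompose_coe z g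
    rw [h, OSym.decompose_coe w g] at h1
    exact h1.symm
  · intro f
    refine ⟨∑ g ∈ DFinsupp.support (DirectSum.decompose (OPolComp 𝕜 k) (f : OPol 𝕜 k)),
      DirectSum.of (fun g => OSymComp 𝕜 k g) g ⟨⟨_, OSym.component_mem f.2 g⟩,
        (DirectSum.decompose (OPolComp 𝕜 k) (f : OPol 𝕜 k) g).2⟩, ?_⟩
    rw [map_sum]
    simp only [DirectSum.coeAddMonoidHom_of]
    refine Subtype.ext ?_
    rw [AddSubmonoidClass.coe_finsetSum]
    exact DirectSum.sum_support_decompose (OPolComp 𝕜 k) (f : OPol 𝕜 k)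

instance OSym_decomposition : DirectSum.Decomposition (OSymComp 𝕜 k) :=
  OSym.isInternal.chooseDecomposition

instance : GradedAlgebra (OSymComp 𝕜 k) where

/-- The signed variables `x̃_i = (-1)^(i-1) x_i`, for `i = 1, …, k`. -/
def OPol.xt (𝕜 : Type*) [CommRing 𝕜] {k : ℕ} (i : Fin k) : OPol 𝕜 k :=
  (-1) ^ (i : ℕ) * OPol.x 𝕜 i

/-- The odd complete symmetric polynomial `h_m`: the sum of the products
`x̃_{i_1} ⋯ x̃_{i_m}` over `i_1 ≤ ⋯ ≤ i_m`, that is of the ordered monomials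
`x̃_1^{a_1} ⋯ x̃_k^{a_k}` with `a_1 + ⋯ + a_k = m`. -/
def OPol.h (𝕜 : Type*) [CommRing 𝕜] (k m : ℕ) : OPol 𝕜 k :=
  ∑ a ∈ Finset.Nat.antidiagonalTuple k m, (List.ofFn fun i => OPol.xt 𝕜 i ^ a i).prod

/-- Auxiliary: the recursive form of complete symmetric expressions in a list of elements. -/
def hList {R : Type*} [Ring R] : List R → ℕ → R
  | [], m => if m = 0 then 1 else 0
  | y :: l, m => ∑ p ∈ Finset.HasAntidiagonal.antidiagonal m, y ^ p.1 * hList l p.2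

theorem sum_antidiagonalTuple_succ {R : Type*} [Ring R] (k m : ℕ) (f : (Fin (k + 1) → ℕ) → R) :
    ∑ a ∈ Finset.Nat.antidiagonalTuple (k + 1) m, f a
      = ∑ p ∈ Finset.HasAntidiagonal.antidiagonal m, ∑ b ∈ Finset.Nat.antidiagonalTuple k p.2,
          f (Fin.cons p.1 b) := by
  rw [Finset.sum_sigma']
  refine Finset.sum_bij' (fun a _ => ⟨(a 0, m - a 0), Fin.tail a⟩) (fun x _ => Fin.cons x.1.1 x.2)
    ?_ ?_ ?_ ?_ ?_
  · intro a ha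
    rw [Finset.Nat.mem_antidiagonalTuple, Fin.sum_univ_succ] at ha
    simp only [Finset.mem_sigma, Finset.HasAntidiagonal.mem_antidiagonal, Finset.Nat.mem_antidiagonalTuple,
      Fin.tail]
    omega
  · rintro ⟨⟨p, q⟩, b⟩ hx
    simp only [Finset.mem_sigma, Finset.HasAntidiagonal.mem_antidiagonal, Finset.Nat.mem_antidiagonalTuple] at hx
    rw [Finset.Nat.mem_antidiagonalTuple, Fin.sum_cons]
    dsimp only
    omega
  · intro a ha
    exact Fin.cons_self_tail a
  · rintro ⟨⟨p, q⟩, b⟩ hx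
    simp only [Finset.mem_sigma, Finset.HasAntidiagonal.mem_antidiagonal] at hx
    have : m - p = q := by omega
    simp [this]
  · intro a ha
    simp [Fin.cons_self_tail]

theorem sum_ofFn_eq_hList {R : Type*} [Ring R] (k m : ℕ) (y : Fin k → R) :
    ∑ a ∈ Finset.Nat.antidiagonalTuple k m, (List.ofFn fun i => y i ^ a i).prod
      = hList (List.ofFn y) m := by
  induction k generalizing m with
  | zero =>
    cases m with
    | zero => simp [hList]
    | succ m => simp [hList]
  | succ k ih =>
    rw [sum_antidiagonalTuple_succ, List.ofFn_succ, hList]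
    refine Finset.sum_congr rfl fun p _ => ?_
    rw [← ih, Finset.mul_sum]
    refine Finset.sum_congr rfl fun b _ => ?_
    simp [List.ofFn_succ]

section

variable {R : Type*} [Ring R]

theorem pair_mem (K : Subring R) {a b : R} (h1 : a + b ∈ K) (h2 : b * a ∈ K) (m : ℕ) :
    ∑ p ∈ Finset.HasAntidiagonal.antidiagonal m, a ^ p.1 * b ^ p.2 ∈ K := by
  have step : ∀ m, ∑ p ∈ Finset.HasAntidiagonal.antidiagonal (m + 1), a ^ p.1 * b ^ p.2
      = (∑ p ∈ Finset.HasAntidiagonal.antidiagonal m, a ^ p.1 * b ^ p.2) * b + a ^ (m + 1) := by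
    intro m
    rw [Finset.Nat.antidiagonal_succ', Finset.sum_cons, Finset.sum_map, Finset.sum_mul, add_comm]
    simp [pow_succ, mul_assoc]
  have main : ∀ m, (∑ p ∈ Finset.HasAntidiagonal.antidiagonal m, a ^ p.1 * b ^ p.2 ∈ K) ∧
      (∑ p ∈ Finset.HasAntidiagonal.antidiagonal (m + 1), a ^ p.1 * b ^ p.2 ∈ K) := by
    intro m
    induction m with
    | zero =>
      refine ⟨by simp [K.one_mem], ?_⟩
      rw [step]
      simpa [add_comm] using h1
    | succ m ih =>
      refine ⟨ih.2, ?_⟩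
      have e : ∑ p ∈ Finset.HasAntidiagonal.antidiagonal (m + 1 + 1), a ^ p.1 * b ^ p.2
          = (∑ p ∈ Finset.HasAntidiagonal.antidiagonal (m + 1), a ^ p.1 * b ^ p.2) * (a + b)
            - (∑ p ∈ Finset.HasAntidiagonal.antidiagonal m, a ^ p.1 * b ^ p.2) * (b * a) := by
        rw [step (m + 1), mul_add, step m]
        simp only [add_mul, pow_succ, mul_assoc]
        abel
      rw [e]
      exact K.sub_mem (K.mul_mem ih.2 h1) (K.mul_mem ih.1 h2)
  exact (main m).1

theorem hList_mem (K : Subring R) {l : List R} (hl : ∀ y ∈ l, y ∈ K) (m : ℕ) : hList l m ∈ K := by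
  induction l generalizing m with
  | nil =>
    rw [hList]
    split_ifs
    · exact K.one_mem
    · exact K.zero_mem
  | cons y l ih =>
    rw [hList]
    refine K.sum_mem fun p _ => K.mul_mem (K.pow_mem (hl y (by simp)) _) (ih ?_ _)
    exact fun z hz => hl z (by simp [hz])

theorem hList_pair_mem (K : Subring R) {l l' : List R} {a b : R} (hl : ∀ y ∈ l, y ∈ K)
    (hl' : ∀ y ∈ l', y ∈ K) (h1 : a + b ∈ K) (h2 : b * a ∈ K) (m : ℕ) :
    hList (l ++ a :: b :: l') m ∈ K := by
  induction l generalizing m with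
  | nil =>
    have e : hList (a :: b :: l') m
        = ∑ p ∈ Finset.HasAntidiagonal.antidiagonal m,
          (∑ q ∈ Finset.HasAntidiagonal.antidiagonal p.1, a ^ q.1 * b ^ q.2) * hList l' p.2 := by
      simp only [hList, Finset.mul_sum, Finset.sum_mul, ← mul_assoc]
      rw [Finset.sum_sigma', Finset.sum_sigma']
      refine (Finset.sum_bij' (fun x _ => ⟨(x.2.1, x.2.2 + x.1.2), (x.2.2, x.1.2)⟩)
        (fun x _ => ⟨(x.1.1 + x.2.1, x.2.2), (x.1.1, x.2.1)⟩) ?_ ?_ ?_ ?_ ?_).symm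
      · rintro ⟨⟨p, q⟩, ⟨r, s⟩⟩ hx
        simp only [Finset.mem_sigma, Finset.HasAntidiagonal.mem_antidiagonal] at hx ⊢
        constructor <;> first | omega | dsimp only
      · rintro ⟨⟨p, q⟩, ⟨r, s⟩⟩ hx
        simp only [Finset.mem_sigma, Finset.HasAntidiagonal.mem_antidiagonal] at hx ⊢
        constructor <;> first | omega | dsimp only
      · rintro ⟨⟨p, q⟩, ⟨r, s⟩⟩ hx
        simp only [Finset.mem_sigma, Finset.HasAntidiagonal.mem_antidiagonal] at hx ⊢
        obtain ⟨h3, h4⟩ := hx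
        subst h4
        rfl
      · rintro ⟨⟨p, q⟩, ⟨r, s⟩⟩ hx
        simp only [Finset.mem_sigma, Finset.HasAntidiagonal.mem_antidiagonal] at hx ⊢
        obtain ⟨h3, h4⟩ := hx
        subst h4
        rfl
      · rintro ⟨⟨p, q⟩, ⟨r, s⟩⟩ hx
        rfl
    rw [List.nil_append, e]
    exact K.sum_mem fun p _ => K.mul_mem (pair_mem K h1 h2 _) (hList_mem K hl' _)
  | cons y l ih =>
    rw [List.cons_append, hList]
    refine K.sum_mem fun p _ => K.mul_mem (K.pow_mem (hl y (by simp)) _) (ih ?_ _)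
    exact fun z hz => hl z (by simp [hz])

end

/-- The kernel of a single odd divided difference. -/
def OPol.ker (i : Fin (k - 1)) : Subring (OPol 𝕜 k) where
  carrier := {f | OPol.d i f = 0}
  zero_mem' := map_zero _
  one_mem' := OPol.d_one i
  add_mem' := by
    intro a b ha hb
    simp only [Set.mem_ofPred_eq] at ha hb ⊢
    rw [map_add, ha, hb, add_zero]
  neg_mem' := by
    intro a ha
    simp only [Set.mem_ofPred_eq] at ha ⊢
    rw [map_neg, ha, neg_zero]
  mul_mem' := by
    intro a b ha hb
    simp only [Set.mem_ofPred_eq] at ha hb ⊢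
    rw [OPol.d_mul, ha, hb, zero_mul, mul_zero, add_zero]

/-- The odd complete symmetric polynomials are odd symmetric. -/
theorem OPol.h_mem (m : ℕ) : OPol.h 𝕜 k m ∈ OSym 𝕜 k := by
  intro i
  change OPol.h 𝕜 k m ∈ OPol.ker i
  rw [OPol.h, sum_ofFn_eq_hList]
  have hpow : ∀ n : ℕ, ((-1) ^ n : OPol 𝕜 k) ∈ OPol.ker i := fun n =>
    (OPol.ker i).pow_mem ((OPol.ker i).neg_mem (OPol.ker i).one_mem) n
  have hother : ∀ j : Fin k, j ≠ lo i → j ≠ hi i → OPol.xt 𝕜 j ∈ OPol.ker i := by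
    intro j h1 h2
    refine (OPol.ker i).mul_mem (hpow _) ?_
    change OPol.d i (OPol.x 𝕜 j) = 0
    rw [OPol.d_x, if_neg (by tauto)]
  have hsplit : List.ofFn (OPol.xt 𝕜 (k := k))
      = (List.ofFn (OPol.xt 𝕜 (k := k))).take i ++ OPol.xt 𝕜 (lo i) :: OPol.xt 𝕜 (hi i)
        :: (List.ofFn (OPol.xt 𝕜 (k := k))).drop (i + 2) := by
    have h1 : (i : ℕ) < (List.ofFn (OPol.xt 𝕜 (k := k))).length := by simp; omega
    have h2 : (i : ℕ) + 1 < (List.ofFn (OPol.xt 𝕜 (k := k))).length := by simp; omega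
    conv_lhs => rw [← List.take_append_drop i (List.ofFn (OPol.xt 𝕜 (k := k))),
      List.drop_eq_getElem_cons h1, List.drop_eq_getElem_cons h2]
    simp [lo, hi]
  rw [hsplit]
  refine hList_pair_mem _ ?_ ?_ ?_ ?_ m
  · intro y hy
    rw [List.mem_take_iff_getElem] at hy
    obtain ⟨j, hj, rfl⟩ := hy
    rw [List.getElem_ofFn]
    refine hother _ ?_ ?_ <;> simp [lo, hi, Fin.ext_iff] <;> omega
  · intro y hy
    rw [List.mem_drop_iff_getElem] at hy
    obtain ⟨j, hj, rfl⟩ := hy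
    rw [List.getElem_ofFn]
    refine hother _ ?_ ?_ <;> simp [lo, hi, Fin.ext_iff] <;> omega
  · change OPol.d i (OPol.xt 𝕜 (lo i) + OPol.xt 𝕜 (hi i)) = 0
    have e : OPol.xt 𝕜 (lo i) + OPol.xt 𝕜 (hi i)
        = (-1) ^ (i : ℕ) * (OPol.x 𝕜 (lo i) - OPol.x 𝕜 (hi i)) := by
      simp only [OPol.xt, lo, hi, pow_succ]
      noncomm_ring
    rw [e]
    refine (OPol.ker i).mul_mem (hpow _) ?_
    change OPol.d i (OPol.x 𝕜 (lo i) - OPol.x 𝕜 (hi i)) = 0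
    simp [OPol.d_x]
  · have e : OPol.xt 𝕜 (hi i) * OPol.xt 𝕜 (lo i)
        = (-1) ^ ((hi i : Fin k) : ℕ) * ((-1) ^ ((lo i : Fin k) : ℕ)
          * (OPol.x 𝕜 (hi i) * OPol.x 𝕜 (lo i))) := by
      have hc : Commute (OPol.x 𝕜 (hi i)) ((-1) ^ ((lo i : Fin k) : ℕ)) :=
        ((Commute.one_right _).neg_right).pow_right _
      simp only [OPol.xt]
      rw [mul_assoc, ← mul_assoc (OPol.x 𝕜 (hi i)), hc.eq, mul_assoc]
    rw [e]
    refine (OPol.ker i).mul_mem (hpow _) ((OPol.ker i).mul_mem (hpow _) ?_)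
    change OPol.d i (OPol.x 𝕜 (hi i) * OPol.x 𝕜 (lo i)) = 0
    rw [OPol.d_mul, OPol.d_x, OPol.d_x, OPol.s_x, Equiv.swap_apply_right]
    simp

/-- The odd complete symmetric polynomial `h_m`, as an element of the algebra of odd symmetric
polynomials. -/
def OSym.h (𝕜 : Type*) [CommRing 𝕜] (k m : ℕ) : OSym 𝕜 k := ⟨OPol.h 𝕜 k m, OPol.h_mem m⟩

end OSym

/-! ### The odd nilHecke algebra and its polynomial representation -/

/-- The generators of the odd nilHecke algebra. -/
inductive ONHGen (k : ℕ) : Type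
  | x (i : Fin k) : ONHGen k
  | t (i : Fin (k - 1)) : ONHGen k

/-- The bidegrees of the generators of the odd nilHecke algebra. -/
def ONHGen.deg {k : ℕ} : ONHGen k → Bideg
  | .x _ => (2, 1)
  | .t _ => (-2, 1)

/-- The generator `x_i` in the free algebra. -/
abbrev fx (𝕜 : Type*) [CommRing 𝕜] {k : ℕ} (i : Fin k) : FreeAlgebra 𝕜 (ONHGen k) :=
  FreeAlgebra.ι 𝕜 (ONHGen.x i)

/-- The generator `τ_i` in the free algebra. -/
abbrev ft (𝕜 : Type*) [CommRing 𝕜] {k : ℕ} (i : Fin (k - 1)) : FreeAlgebra 𝕜 (ONHGen k) :=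
  FreeAlgebra.ι 𝕜 (ONHGen.t i)

/-- The relations of the odd nilHecke algebra. -/
inductive ONHRel (𝕜 : Type*) [CommRing 𝕜] (k : ℕ) : FreeAlgebra 𝕜 (ONHGen k) → Prop
  | t_sq (i : Fin (k - 1)) : ONHRel 𝕜 k (ft 𝕜 i * ft 𝕜 i)
  | braid (i j : Fin (k - 1)) (h : (j : ℕ) = i + 1) :
      ONHRel 𝕜 k (ft 𝕜 i * ft 𝕜 j * ft 𝕜 i - ft 𝕜 j * ft 𝕜 i * ft 𝕜 j)
  | x_t (i : Fin (k - 1)) : ONHRel 𝕜 k (fx 𝕜 (lo i) * ft 𝕜 i + ft 𝕜 i * fx 𝕜 (hi i) - 1)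
  | t_x (i : Fin (k - 1)) : ONHRel 𝕜 k (ft 𝕜 i * fx 𝕜 (lo i) + fx 𝕜 (hi i) * ft 𝕜 i - 1)
  | x_x (i j : Fin k) (h : i ≠ j) : ONHRel 𝕜 k (fx 𝕜 i * fx 𝕜 j + fx 𝕜 j * fx 𝕜 i)
  | t_t (i j : Fin (k - 1)) (h : (i : ℕ) + 1 < j ∨ (j : ℕ) + 1 < i) :
      ONHRel 𝕜 k (ft 𝕜 i * ft 𝕜 j + ft 𝕜 j * ft 𝕜 i)
  | x_t_far (i : Fin k) (j : Fin (k - 1)) (h1 : i ≠ lo j) (h2 : i ≠ hi j) :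
      ONHRel 𝕜 k (fx 𝕜 i * ft 𝕜 j + ft 𝕜 j * fx 𝕜 i)

/-- The odd nilHecke algebra. -/
abbrev ONH (𝕜 : Type*) [CommRing 𝕜] (k : ℕ) : Type _ := QuotBy (ONHRel 𝕜 k)

/-- The component of bidegree `g` of the odd nilHecke algebra. -/
abbrev ONHComp (𝕜 : Type*) [CommRing 𝕜] (k : ℕ) (g : Bideg) : Submodule 𝕜 (ONH 𝕜 k) :=
  presComp ONHGen.deg (ONHRel 𝕜 k) g

/-- The element `x_i` of the odd nilHecke algebra. -/
def ONH.x (𝕜 : Type*) [CommRing 𝕜] {k : ℕ} (i : Fin k) : ONH 𝕜 k :=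
  QuotBy.mk 𝕜 (ONHRel 𝕜 k) (fx 𝕜 i)

section ONH

variable {𝕜 : Type*} [CommRing 𝕜] {k : ℕ}

theorem ONHRel.homogeneous (r : FreeAlgebra 𝕜 (ONHGen k)) (hr : ONHRel 𝕜 k r) :
    ∃ g, r ∈ wordComp 𝕜 ONHGen.deg g := by
  have hx : ∀ i : Fin k, fx 𝕜 i ∈ wordComp 𝕜 ONHGen.deg (2, 1) :=
    fun i => wordComp_gen ONHGen.deg (ONHGen.x i)
  have ht : ∀ i : Fin (k - 1), ft 𝕜 i ∈ wordComp 𝕜 ONHGen.deg (-2, 1) :=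
    fun i => wordComp_gen ONHGen.deg (ONHGen.t i)
  have h1 : (1 : FreeAlgebra 𝕜 (ONHGen k)) ∈ wordComp 𝕜 ONHGen.deg 0 := wordComp_one _
  generalize hX : ((2, 1) : Bideg) = X at hx
  generalize hT : ((-2, 1) : Bideg) = T at ht
  have e1 : X + T = 0 := by rw [← hX, ← hT]; decide
  have e2 : T + X = 0 := by rw [← hX, ← hT]; decide
  cases hr with
  | t_sq i => exact ⟨T + T, wordComp_mul _ (ht i) (ht i) rfl⟩
  | braid i j h =>
    exact ⟨T + T + T, Submodule.sub_mem _
      (wordComp_mul _ (wordComp_mul _ (ht i) (ht j) rfl) (ht i) rfl)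
      (wordComp_mul _ (wordComp_mul _ (ht j) (ht i) rfl) (ht j) rfl)⟩
  | x_t i =>
    exact ⟨0, Submodule.sub_mem _ (Submodule.add_mem _
      (wordComp_mul _ (hx _) (ht _) e1) (wordComp_mul _ (ht _) (hx _) e2)) h1⟩
  | t_x i =>
    exact ⟨0, Submodule.sub_mem _ (Submodule.add_mem _
      (wordComp_mul _ (ht _) (hx _) e2) (wordComp_mul _ (hx _) (ht _) e1)) h1⟩
  | x_x i j h =>
    exact ⟨X + X, Submodule.add_mem _ (wordComp_mul _ (hx i) (hx j) rfl)
      (wordComp_mul _ (hx j) (hx i) rfl)⟩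
  | t_t i j h =>
    exact ⟨T + T, Submodule.add_mem _ (wordComp_mul _ (ht i) (ht j) rfl)
      (wordComp_mul _ (ht j) (ht i) rfl)⟩
  | x_t_far i j h1 h2 =>
    exact ⟨0, Submodule.add_mem _ (wordComp_mul _ (hx i) (ht j) e1)
      (wordComp_mul _ (ht j) (hx i) e2)⟩

instance : GradedAlgebra (ONHComp 𝕜 k) :=
  presGraded _ _ ONHRel.homogeneous

theorem OPol.d_x_mul (i : Fin (k - 1)) (a : Fin k) (f : OPol 𝕜 k) :
    OPol.d i (OPol.x 𝕜 a * f) = (if a = lo i ∨ a = hi i then f else 0)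
      - OPol.x 𝕜 (Equiv.swap (lo i) (hi i) a) * OPol.d i f := by
  rw [OPol.d_mul, OPol.d_x, OPol.s_x, ite_mul, one_mul, zero_mul, neg_mul, sub_eq_add_neg]

theorem swap_val (i : Fin (k - 1)) (a : Fin k) :
    ((Equiv.swap (lo i) (hi i) a : Fin k) : ℕ)
      = if (a : ℕ) = i then (i : ℕ) + 1 else if (a : ℕ) = i + 1 then (i : ℕ) else a := by
  rw [Equiv.swap_apply_def]
  simp only [lo, hi, Fin.ext_iff]
  split_ifs <;> rfl

theorem swap_braid_nat (i a : ℕ) :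
    (fun b : ℕ => if b = i then i + 1 else if b = i + 1 then i else b)
      ((fun b : ℕ => if b = i + 1 then i + 1 + 1 else if b = i + 1 + 1 then i + 1 else b)
        ((fun b : ℕ => if b = i then i + 1 else if b = i + 1 then i else b) a))
      = (fun b : ℕ => if b = i + 1 then i + 1 + 1 else if b = i + 1 + 1 then i + 1 else b)
      ((fun b : ℕ => if b = i then i + 1 else if b = i + 1 then i else b)
        ((fun b : ℕ => if b = i + 1 then i + 1 + 1 else if b = i + 1 + 1 then i + 1 else b) a)) := by
  have n1 : i + 1 ≠ i := by omega
  have n2 : i + 1 + 1 ≠ i := by omega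
  have n3 : i + 1 + 1 ≠ i + 1 := by omega
  have n4 : i ≠ i + 1 := by omega
  have n5 : i ≠ i + 1 + 1 := by omega
  have n6 : i + 1 ≠ i + 1 + 1 := by omega
  beta_reduce
  rcases (show a = i ∨ a = i + 1 ∨ a = i + 1 + 1 ∨ (a ≠ i ∧ a ≠ i + 1 ∧ a ≠ i + 1 + 1) by omega)
    with h | h | h | ⟨h1, h2, h3⟩
  · rw [h]
    simp only [if_pos, if_neg n2, if_neg n3, if_neg n4, if_neg n5, if_neg n6]
  · rw [h]
    simp only [if_pos, if_neg n1, if_neg n2, if_neg n3, if_neg n4, if_neg n5, if_neg n6]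
  · rw [h]
    simp only [if_pos, if_neg n1, if_neg n2, if_neg n3, if_neg n4, if_neg n5]
  · simp only [if_neg h1, if_neg h2, if_neg h3]

theorem near_iff (i : Fin (k - 1)) (a : Fin k) :
    (a = lo i ∨ a = hi i) ↔ ((a : ℕ) = i ∨ (a : ℕ) = i + 1) := by
  simp [lo, hi, Fin.ext_iff]

theorem near_swap (i : Fin (k - 1)) (a : Fin k) :
    (Equiv.swap (lo i) (hi i) a = lo i ∨ Equiv.swap (lo i) (hi i) a = hi i)
      ↔ (a = lo i ∨ a = hi i) := by
  rw [near_iff, near_iff, swap_val]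
  split_ifs <;> omega

theorem OPol.d_d (i : Fin (k - 1)) (f : OPol 𝕜 k) : OPol.d i (OPol.d i f) = 0 := by
  refine OPol.mem_of_mul (N := LinearMap.ker ((OPol.d i).comp (OPol.d i))) ?_ ?_ f
  · simp [OPol.d_one]
  · intro a f hf
    simp only [LinearMap.mem_ker, LinearMap.comp_apply] at hf ⊢
    rw [OPol.d_x_mul, map_sub, OPol.d_x_mul, hf, mul_zero, sub_zero]
    simp only [near_swap]
    split_ifs <;> simp

theorem OPol.d_ite (l : Fin (k - 1)) (p : Prop) [Decidable p] (g : OPol 𝕜 k) :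
    OPol.d l (if p then g else 0) = if p then OPol.d l g else 0 := by
  split_ifs
  · rfl
  · exact map_zero _

theorem OPol.d_far (i j : Fin (k - 1)) (h : (i : ℕ) + 1 < j ∨ (j : ℕ) + 1 < i) (f : OPol 𝕜 k) :
    OPol.d i (OPol.d j f) + OPol.d j (OPol.d i f) = 0 := by
  refine OPol.mem_of_mul
    (N := LinearMap.ker ((OPol.d i).comp (OPol.d j) + (OPol.d j).comp (OPol.d i))) ?_ ?_ f
  · simp [OPol.d_one]
  · intro a f hf
    simp only [LinearMap.mem_ker, LinearMap.comp_apply, LinearMap.add_apply] at hf ⊢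
    have e1 : (Equiv.swap (lo j) (hi j) a = lo i ∨ Equiv.swap (lo j) (hi j) a = hi i)
        ↔ (a = lo i ∨ a = hi i) := by
      rw [near_iff, near_iff, swap_val]
      split_ifs <;> omega
    have e2 : (Equiv.swap (lo i) (hi i) a = lo j ∨ Equiv.swap (lo i) (hi i) a = hi j)
        ↔ (a = lo j ∨ a = hi j) := by
      rw [near_iff, near_iff, swap_val]
      split_ifs <;> omega
    have e3 : Equiv.swap (lo i) (hi i) (Equiv.swap (lo j) (hi j) a)
        = Equiv.swap (lo j) (hi j) (Equiv.swap (lo i) (hi i) a) := by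
      rw [Fin.ext_iff, swap_val, swap_val, swap_val, swap_val]
      split_ifs <;> omega
    have e4 : OPol.d i (OPol.d j f) = - OPol.d j (OPol.d i f) := eq_neg_of_add_eq_zero_left hf
    rw [OPol.d_x_mul j, OPol.d_x_mul i, map_sub, map_sub, OPol.d_x_mul, OPol.d_x_mul, e3, e4,
      OPol.d_ite, OPol.d_ite, if_congr e1 rfl rfl, if_congr e2 rfl rfl, mul_neg]
    abel

theorem OPol.d_braid (i j : Fin (k - 1)) (h : (j : ℕ) = i + 1) (f : OPol 𝕜 k) :
    OPol.d i (OPol.d j (OPol.d i f)) - OPol.d j (OPol.d i (OPol.d j f)) = 0 := by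
  refine OPol.mem_of_mul
    (N := LinearMap.ker ((OPol.d i).comp ((OPol.d j).comp (OPol.d i))
      - (OPol.d j).comp ((OPol.d i).comp (OPol.d j)))) ?_ ?_ f
  · simp [OPol.d_one]
  · intro a f hf
    simp only [LinearMap.mem_ker, LinearMap.comp_apply, LinearMap.sub_apply] at hf ⊢
    have e1 : (Equiv.swap (lo i) (hi i) (Equiv.swap (lo j) (hi j) a) = lo j
        ∨ Equiv.swap (lo i) (hi i) (Equiv.swap (lo j) (hi j) a) = hi j)
        ↔ (a = lo i ∨ a = hi i) := by
      rw [near_iff, near_iff, swap_val, swap_val]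
      split_ifs <;> omega
    have e2 : (Equiv.swap (lo j) (hi j) (Equiv.swap (lo i) (hi i) a) = lo i
        ∨ Equiv.swap (lo j) (hi j) (Equiv.swap (lo i) (hi i) a) = hi i)
        ↔ (a = lo j ∨ a = hi j) := by
      rw [near_iff, near_iff, swap_val, swap_val]
      split_ifs <;> omega
    have e3 : Equiv.swap (lo i) (hi i) (Equiv.swap (lo j) (hi j) (Equiv.swap (lo i) (hi i) a))
        = Equiv.swap (lo j) (hi j) (Equiv.swap (lo i) (hi i) (Equiv.swap (lo j) (hi j) a)) := by
      rw [Fin.ext_iff, swap_val, swap_val, swap_val, swap_val, swap_val, swap_val, h]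
      exact swap_braid_nat i a
    have step : ∀ u v : Fin (k - 1), OPol.d u (OPol.d v (OPol.d u (OPol.x 𝕜 a * f)))
        = (if a = lo u ∨ a = hi u then OPol.d u (OPol.d v f) else 0)
          + (if Equiv.swap (lo v) (hi v) (Equiv.swap (lo u) (hi u) a) = lo u ∨
              Equiv.swap (lo v) (hi v) (Equiv.swap (lo u) (hi u) a) = hi u
              then OPol.d v (OPol.d u f) else 0)
          - OPol.x 𝕜 (Equiv.swap (lo u) (hi u) (Equiv.swap (lo v) (hi v)
              (Equiv.swap (lo u) (hi u) a))) * OPol.d u (OPol.d v (OPol.d u f)) := by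
      intro u v
      rw [OPol.d_x_mul u a f, map_sub, map_sub, OPol.d_x_mul v, map_sub, OPol.d_x_mul u,
        OPol.d_ite, OPol.d_ite, OPol.d_ite, OPol.d_d, ite_self]
      abel
    have e4 := sub_eq_zero.mp hf
    rw [step, step, e3, e4, if_congr e1 rfl rfl, if_congr e2 rfl rfl]
    abel

/-- The polynomial representation of the odd nilHecke algebra: `x_i` acts by left multiplication
and `τ_i` acts by the odd divided difference `∂_i`. -/
def polyRep (𝕜 : Type*) [CommRing 𝕜] (k : ℕ) : ONH 𝕜 k →ₐ[𝕜] Module.End 𝕜 (OPol 𝕜 k) :=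
  QuotBy.lift (ONHRel 𝕜 k)
    (FreeAlgebra.lift 𝕜 (fun y : ONHGen k => match y with
      | .x i => LinearMap.mulLeft 𝕜 (OPol.x 𝕜 i)
      | .t i => OPol.d i))
    (by
      intro r hr
      refine LinearMap.ext fun f => ?_
      cases hr with
      | t_sq i => simpa using OPol.d_d i f
      | braid i j h => simpa using OPol.d_braid i j h f
      | x_t i => simp [OPol.d_x_mul]
      | t_x i => simp [OPol.d_x_mul]
      | x_x i j h =>
        have := congrArg (· * f) (OPol.x_anti (𝕜 := 𝕜) h)
        simpa [add_mul, mul_assoc] using this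
      | t_t i j h => simpa using OPol.d_far i j h f
      | x_t_far i j h1 h2 =>
        simp [OPol.d_x_mul, h1, h2, Equiv.swap_apply_of_ne_of_ne h1 h2])

end ONH

/-! ### The coefficient superalgebra -/

/-- The generators of the coefficient algebra `A_n`. -/
inductive AGen (n : ℕ) : Type
  | chi (i : Fin (n / 2)) : AGen n
  | d : AGen n

/-- The bidegrees of the generators: `χ_i` is even of degree `4 i` and `d` is odd of degree `2`
(the generator with index `i : Fin (n / 2)` is `χ_{i+1}`). -/
def AGen.deg {n : ℕ} : AGen n → Bideg
  | .chi i => (4 * ((i : ℤ) + 1), 0)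
  | .d => (2, 1)

/-- `χ_j` in the free algebra, with `χ_0 = 1`. -/
def fchi (𝕜 : Type*) [CommRing 𝕜] (n j : ℕ) : FreeAlgebra 𝕜 (AGen n) :=
  if j = 0 then 1
  else if h : j - 1 < n / 2 then FreeAlgebra.ι 𝕜 (AGen.chi ⟨j - 1, h⟩) else 0

/-- The relations of `A_n`. -/
inductive ARel (𝕜 : Type*) [CommRing 𝕜] (n : ℕ) : FreeAlgebra 𝕜 (AGen n) → Prop
  | comm (a b : AGen n) :
      ARel 𝕜 n (FreeAlgebra.ι 𝕜 a * FreeAlgebra.ι 𝕜 b - FreeAlgebra.ι 𝕜 b * FreeAlgebra.ι 𝕜 a)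
  | d_sq : ARel 𝕜 n (FreeAlgebra.ι 𝕜 AGen.d * FreeAlgebra.ι 𝕜 AGen.d)
  | d_top (h : Even n) : ARel 𝕜 n (FreeAlgebra.ι 𝕜 AGen.d * fchi 𝕜 n (n / 2))

/-- The supercommutative superalgebra `A_n`. -/
abbrev A (𝕜 : Type*) [CommRing 𝕜] (n : ℕ) : Type _ := QuotBy (ARel 𝕜 n)

/-- The component of bidegree `g` of `A_n`. -/
abbrev AComp (𝕜 : Type*) [CommRing 𝕜] (n : ℕ) (g : Bideg) : Submodule 𝕜 (A 𝕜 n) :=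
  presComp AGen.deg (ARel 𝕜 n) g

instance {𝕜 : Type*} [CommRing 𝕜] {n : ℕ} : GradedAlgebra (AComp 𝕜 n) :=
  presGraded _ _ (by
    intro r hr
    cases hr with
    | comm a b =>
      exact ⟨_, Submodule.sub_mem _ (wordComp_mul _ (wordComp_gen _ a) (wordComp_gen _ b) rfl)
        (wordComp_mul _ (wordComp_gen _ b) (wordComp_gen _ a) (add_comm _ _))⟩
    | d_sq => exact ⟨_, wordComp_mul _ (wordComp_gen _ _) (wordComp_gen _ _) rfl⟩
    | d_top h =>
      have hc : ∃ g, fchi 𝕜 n (n / 2) ∈ wordComp 𝕜 AGen.deg g := by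
        unfold fchi
        split_ifs
        · exact ⟨0, wordComp_one _⟩
        · exact ⟨_, wordComp_gen _ _⟩
        · exact ⟨0, Submodule.zero_mem _⟩
      obtain ⟨g, hg⟩ := hc
      exact ⟨_, wordComp_mul _ (wordComp_gen _ _) hg rfl⟩)

/-- The element `c_i` of `A_n`, for `i ≤ n`: it is `χ_{i/2}` for even `i` and `d χ_{(i-1)/2}` for
odd `i`. -/
def A.c (𝕜 : Type*) [CommRing 𝕜] (n i : ℕ) : A 𝕜 n :=
  if Even i then QuotBy.mk 𝕜 (ARel 𝕜 n) (fchi 𝕜 n (i / 2))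
  else QuotBy.mk 𝕜 (ARel 𝕜 n) (FreeAlgebra.ι 𝕜 AGen.d * fchi 𝕜 n ((i - 1) / 2))

/-! ### The deformed cyclotomic quotient -/

section Main

variable (𝕜 : Type*) [CommRing 𝕜] (k n : ℕ)

/-- The element `a^n(x_i) = ∑_ℓ (-1)^ℓ x_i^ℓ c_{n-ℓ}` of `ONH_k ⊗ A_n`. -/
def aPoly (i : Fin k) : ONHComp 𝕜 k ᵍ⊗[𝕜] AComp 𝕜 n :=
  ∑ l ∈ Finset.range (n + 1), (-1) ^ l * ((ONH.x 𝕜 i ^ l) ᵍ⊗ₜ[𝕜] A.c 𝕜 n (n - l))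

/-- The element `a^n(x_1)`; there is none when `k = 0`. -/
inductive CycRel : ONHComp 𝕜 k ᵍ⊗[𝕜] AComp 𝕜 n → Prop
  | mk (i : Fin k) (h : (i : ℕ) = 0) : CycRel (aPoly 𝕜 k n i)

/-- The deformed cyclotomic quotient `ONH_k^n = (ONH_k ⊗ A_n) / a^n(x_1)`. -/
abbrev CycONH : Type _ := QuotBy (CycRel 𝕜 k n)

/-- The quotient map `ONH_k ⊗ A_n → ONH_k^n`. -/
abbrev CycONH.mk : (ONHComp 𝕜 k ᵍ⊗[𝕜] AComp 𝕜 n) →ₐ[𝕜] CycONH 𝕜 k n :=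
  QuotBy.mk 𝕜 (CycRel 𝕜 k n)

/-- The component of bidegree `g` of the deformed cyclotomic quotient. -/
def CycONHComp (g : Bideg) : Submodule 𝕜 (CycONH 𝕜 k n) :=
  (tensComp (ONHComp 𝕜 k) (AComp 𝕜 n) g).map (CycONH.mk 𝕜 k n).toLinearMap

/-! ### The odd equivariant Grassmannian cohomology -/

/-- The element `h'_m = ∑_r (-1)^r h_{m-r} ⊗ c_r` of `OΛ_k ⊗ A_n`. -/
def hPrime (m : ℕ) : OSymComp 𝕜 k ᵍ⊗[𝕜] AComp 𝕜 n :=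
  ∑ r ∈ Finset.range (m + 1), (-1) ^ r * (OSym.h 𝕜 k (m - r) ᵍ⊗ₜ[𝕜] A.c 𝕜 n r)

/-- The elements `h'_m` with `n - k + 1 ≤ m ≤ n`. -/
inductive GrRel : OSymComp 𝕜 k ᵍ⊗[𝕜] AComp 𝕜 n → Prop
  | mk (m : ℕ) (h1 : n + 1 ≤ m + k) (h2 : m ≤ n) : GrRel (hPrime 𝕜 k n m)

/-- The odd equivariant Grassmannian cohomology superalgebra `M_k^n`. -/
abbrev M : Type _ := QuotBy (GrRel 𝕜 k n)

/-- The quotient map `OΛ_k ⊗ A_n → M_k^n`. -/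
abbrev M.mk : (OSymComp 𝕜 k ᵍ⊗[𝕜] AComp 𝕜 n) →ₐ[𝕜] M 𝕜 k n := QuotBy.mk 𝕜 (GrRel 𝕜 k n)

/-- The component of bidegree `g` of `M_k^n`. -/
def MComp (g : Bideg) : Submodule 𝕜 (M 𝕜 k n) :=
  (tensComp (OSymComp 𝕜 k) (AComp 𝕜 n) g).map (M.mk 𝕜 k n).toLinearMap

/-! ### Induction of skew polynomials to the Grassmannian algebra -/

/-- The automorphism `θ` of skew polynomials with `θ(x_i) = (-1)^(k-1) x_{k+1-i}`, that is,
`θ(x̃_i) = x̃_{k+1-i}`. On odd elementary symmetric polynomials it is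
`ε_r ↦ (-1)^(r(r-1)/2) ε_r`. -/
def theta : OPol 𝕜 k →ₐ[𝕜] OPol 𝕜 k :=
  OPol.lift (fun i => (-1) ^ (k - 1) * OPol.x 𝕜 (Fin.rev i)) (by
    intro i j h
    have hc : ∀ a : Fin k, Commute (OPol.x 𝕜 a) ((-1 : OPol 𝕜 k) ^ (k - 1)) := fun a =>
      ((Commute.one_right _).neg_right).pow_right _
    have e : ∀ a b : Fin k, ((-1 : OPol 𝕜 k) ^ (k - 1) * OPol.x 𝕜 a)
        * ((-1) ^ (k - 1) * OPol.x 𝕜 b)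
        = (-1) ^ (k - 1) * ((-1) ^ (k - 1) * (OPol.x 𝕜 a * OPol.x 𝕜 b)) := by
      intro a b
      rw [mul_assoc, ← mul_assoc (OPol.x 𝕜 a), (hc a).eq, mul_assoc]
    rw [e, e, ← mul_add, ← mul_add, OPol.x_anti (fun he => h (Fin.rev_injective he)), mul_zero,
      mul_zero])

/-- The elements by which one divides `OPol_k ⊗_𝕜 M_k^n` in order to get
`OPol_k ⊗_{OΛ_k} M_k^n`, where `g ∈ OΛ_k` acts on the right of `OPol_k` by multiplication by
`θ(g)` and on the left of `M_k^n` by multiplication by the class of `g ⊗ 1`. The two factors are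
written in the opposite order, so that `M_k^n` acts on the right through the factor `M_k^n`. -/
def balanced : Submodule (M 𝕜 k n)ᵐᵒᵖ (M 𝕜 k n ⊗[𝕜] OPol 𝕜 k) :=
  Submodule.span (M 𝕜 k n)ᵐᵒᵖ {z | ∃ (f : OPol 𝕜 k) (g : OSym 𝕜 k) (m : M 𝕜 k n),
    z = m ⊗ₜ[𝕜] (f * theta 𝕜 k (g : OPol 𝕜 k)) - (M.mk 𝕜 k n (g ᵍ⊗ₜ[𝕜] 1) * m) ⊗ₜ[𝕜] f}

/-- The right `M_k^n`-module `OPol_k ⊗_{OΛ_k} M_k^n`. -/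
abbrev T : Type _ := (M 𝕜 k n ⊗[𝕜] OPol 𝕜 k) ⧸ balanced 𝕜 k n

variable {𝕜 k n} in
/-- The element `f ⊗ m` of `OPol_k ⊗_{OΛ_k} M_k^n`. -/
def T.tmul (f : OPol 𝕜 k) (m : M 𝕜 k n) : T 𝕜 k n :=
  Submodule.Quotient.mk (m ⊗ₜ[𝕜] f)

/-- The component of bidegree `g` of `OPol_k ⊗_{OΛ_k} M_k^n`. -/
def TComp (g : Bideg) : Submodule 𝕜 (T 𝕜 k n) :=
  Submodule.span 𝕜 {z | ∃ p q : Bideg, p + q = g ∧ ∃ f ∈ OPolComp 𝕜 k p, ∃ m ∈ MComp 𝕜 k n q,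
    z = T.tmul f m}

/-- The algebra of endomorphisms of the right `M_k^n`-module `OPol_k ⊗_{OΛ_k} M_k^n`. -/
abbrev EndT : Type _ := Module.End (M 𝕜 k n)ᵐᵒᵖ (T 𝕜 k n)

/-- The endomorphisms that are homogeneous of bidegree `g`. -/
def EndTComp (g : Bideg) : Set (EndT 𝕜 k n) :=
  {u | ∀ p, ∀ z ∈ TComp 𝕜 k n p, u z ∈ TComp 𝕜 k n (g + p)}

/-- The exponents `(a_1, …, a_k)` with `0 ≤ a_i ≤ k - i`. -/
abbrev Staircase : Type := (i : Fin k) → Fin (k - i)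

theorem card_staircase : Fintype.card (Staircase k) = k ! := by
  rw [Fintype.card_pi]
  simp only [Fintype.card_fin]
  rw [Fin.prod_univ_eq_prod_range (fun i => k - i) k, ← Finset.prod_range_add_one_eq_factorial,
    ← Finset.prod_range_reflect]
  refine Finset.prod_congr rfl fun i hi => ?_
  rw [Finset.mem_range] at hi
  omega

/-- A fixed enumeration of the staircase exponents. -/
def stair : Fin (k !) ≃ Staircase k :=
  (Fintype.equivFinOfCardEq (card_staircase k)).symm

/-- The monomials `x_1^{a_1} ⋯ x_k^{a_k}` with staircase exponents, which form a basis of the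
right `OΛ_k`-module `OPol_k`. -/
def stairMonomial (j : Fin (k !)) : OPol 𝕜 k :=
  (List.ofFn fun i => OPol.x 𝕜 i ^ (stair k j i : ℕ)).prod

/-- The bidegree of a staircase monomial. -/
def stairDeg (j : Fin (k !)) : Bideg :=
  (2 * ∑ i, ((stair k j i : ℕ) : ℤ), ∑ i, ((stair k j i : ℕ) : ZMod 2))

/-- The component of bidegree `g` of the matrix superalgebra `Mat_{k!}(M_k^n)`: the rows and
columns are indexed by the staircase monomials and are shifted by their bidegrees, so that it is
the endomorphism superalgebra of a free graded right supermodule with basis in these bidegrees. -/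
def MatComp (g : Bideg) : Set (Matrix (Fin (k !)) (Fin (k !)) (M 𝕜 k n)) :=
  {B | ∀ i j, B i j ∈ MComp 𝕜 k n (g + stairDeg k j - stairDeg k i)}

end Main

end OddGrassmannian

/-! The whole argument rests on vectors killed by every `τ_l`, called vacuum vectors (`IsVac`). If
`v` is a vacuum vector in any `ONH_k`-module, then `f ↦ f v` is a module map out of `OPol_k`
(`IsVac.smul_toONH_smul`). In `OPol_k` itself the vacuum vectors are the odd symmetric polynomials.
Faithfulness of the polynomial representation is never needed: identities in `ONH_k` are proved by a
vanishing criterion valid in every module (`IsVac.eq_zero_of_chain`).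

Two facts about `ONH_k` carry the proof. The first is the existence of elements `y_j` of `ONH_k`,
themselves killed on the left by all `τ_l`, that are dual to the staircase monomials `b_j`: `y_i`
sends `b_j` to `δ_ij`, and `∑ b_j y_j = 1` in `ONH_k` (`exists_stairMonomial_coeff`). They are built
one variable at a time: the chain `τ_{i+m-1} ⋯ τ_i`, taken to its full length, pairs the powers of
`x_i` triangularly with signs on the antidiagonal, and the triangular system is solved. The second
is an expansion `x_1^l = ∑ g_p θ(h_{l-p})` with `g_p = 0` for `p ≥ k`, in which the `g_p` with `p <
k` are linearly independent over vacuum vectors (`X_pow_eq_sum`, `eq_zero_of_sum_gPol`). It turns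
`a^n(x_1)` into `± ∑_p g_p h'_{n-p}`, and the range `p < k` is exactly the range of the relations of
`M_k^n`.

The expansion is used in both directions. On `1 ⊗ m` it shows that `a^n(x_1)` acts by zero; the
commutation rules of `a^n(x_1)` with the variables, where the relations of `A_n` enter, propagate
this to all `f ⊗ m`, so `Φ` exists (`actTens_aPoly_eq_zero`). Conversely, in `ONH_k^n` one has
`a^n(x_1) v = 0` for every vacuum vector `v`, and independence of the `g_p` makes each `h'_{n-p}`
with `p < k`, `p ≤ n` kill `v`; so `M_k^n` acts on vacuum vectors (`IsVac.symTens_hPrime_mul`), and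
`f ⊗ m ↦ f m y_j` is a well-defined equivariant map to `ONH_k^n` (`stairMap`).

Injectivity of `Φ` follows from `z = ∑ z b_j y_j`, which recovers `z` from its values on the `b_j ⊗
1`. Surjectivity follows because the image of `t` under the `j`-th map sends `b_l ⊗ 1` to `δ_jl t`.
The same `y_j` give coordinates, so the `b_j ⊗ 1` form a basis over `M_k^n` and `Ψ` is the matrix of
`Φ`. Since `y_j` has bidegree `-deg b_j`, all these maps respect the gradings in both directions. -/

namespace OddGrassmannian


/-! ### The odd nilHecke algebra: relations and the polynomial module -/

section ONHBasics

variable {𝕜 : Type*} [CommRing 𝕜] {k : ℕ}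

/-- The generator `x_{i+1}` of the odd nilHecke algebra, zero if it does not exist. -/
def ONH.X (𝕜 : Type*) [CommRing 𝕜] (k i : ℕ) : ONH 𝕜 k :=
  if h : i < k then ONH.x 𝕜 ⟨i, h⟩ else 0

/-- The generator `τ_{i+1}` of the odd nilHecke algebra, zero if it does not exist. -/
def ONH.t (𝕜 : Type*) [CommRing 𝕜] (k i : ℕ) : ONH 𝕜 k :=
  if h : i + 1 < k then QuotBy.mk 𝕜 (ONHRel 𝕜 k) (ft 𝕜 ⟨i, by omega⟩) else 0

/-- The variable `x_{i+1}`, zero if it does not exist. -/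
def OPol.X (𝕜 : Type*) [CommRing 𝕜] (k i : ℕ) : OPol 𝕜 k :=
  if h : i < k then OPol.x 𝕜 ⟨i, h⟩ else 0

theorem ONH.X_val (i : Fin k) : ONH.X 𝕜 k i = ONH.x 𝕜 i := by
  simp [ONH.X]

theorem OPol.X_val (i : Fin k) : OPol.X 𝕜 k i = OPol.x 𝕜 i := by
  simp [OPol.X]

theorem ONH.t_val (i : Fin (k - 1)) :
    ONH.t 𝕜 k i = QuotBy.mk 𝕜 (ONHRel 𝕜 k) (ft 𝕜 i) := by
  have := i.2
  rw [ONH.t, dif_pos (by omega)]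

theorem ONH.t_of_le {i : ℕ} (h : k ≤ i + 1) : ONH.t 𝕜 k i = 0 := by
  rw [ONH.t, dif_neg (by omega)]

/-- The default value zero makes the homogeneous relations hold for all natural indices. Only the
two relations containing the constant 1 need the bound `i + 1 < k`. -/
theorem ONH.t_sq (i : ℕ) : ONH.t 𝕜 k i * ONH.t 𝕜 k i = 0 := by
  by_cases h : i + 1 < k
  · have := QuotBy.mk_eq_zero (𝕜 := 𝕜) (ONHRel 𝕜 k) (ONHRel.t_sq ⟨i, by omega⟩)
    rw [map_mul] at this
    rw [ONH.t, dif_pos h, this]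
  · rw [ONH.t_of_le (by omega), mul_zero]

theorem ONH.braid (i : ℕ) : ONH.t 𝕜 k i * ONH.t 𝕜 k (i + 1) * ONH.t 𝕜 k i
    = ONH.t 𝕜 k (i + 1) * ONH.t 𝕜 k i * ONH.t 𝕜 k (i + 1) := by
  by_cases h : i + 1 + 1 < k
  · have := QuotBy.mk_eq_zero (𝕜 := 𝕜) (ONHRel 𝕜 k)
      (ONHRel.braid ⟨i, by omega⟩ ⟨i + 1, by omega⟩ rfl)
    rw [map_sub, map_mul, map_mul, map_mul, map_mul, sub_eq_zero] at this
    rw [ONH.t, dif_pos (by omega), ONH.t, dif_pos h, this]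
  · rw [ONH.t_of_le (i := i + 1) (by omega), mul_zero, zero_mul, mul_zero]

theorem ONH.t_far {i j : ℕ} (hij : i + 1 < j ∨ j + 1 < i) :
    ONH.t 𝕜 k i * ONH.t 𝕜 k j = - (ONH.t 𝕜 k j * ONH.t 𝕜 k i) := by
  by_cases hi : i + 1 < k
  · by_cases hj : j + 1 < k
    · have := QuotBy.mk_eq_zero (𝕜 := 𝕜) (ONHRel 𝕜 k)
        (ONHRel.t_t ⟨i, by omega⟩ ⟨j, by omega⟩ hij)
      rw [map_add, map_mul, map_mul] at this
      rw [ONH.t, dif_pos hi, ONH.t, dif_pos hj]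
      exact eq_neg_of_add_eq_zero_left this
    · rw [ONH.t_of_le (i := j) (by omega), mul_zero, zero_mul, neg_zero]
  · rw [ONH.t_of_le (i := i) (by omega), mul_zero, zero_mul, neg_zero]

theorem ONH.t_X {i : ℕ} (h : i + 1 < k) :
    ONH.t 𝕜 k i * ONH.X 𝕜 k i = 1 - ONH.X 𝕜 k (i + 1) * ONH.t 𝕜 k i := by
  have := QuotBy.mk_eq_zero (𝕜 := 𝕜) (ONHRel 𝕜 k) (ONHRel.t_x ⟨i, by omega⟩)
  rw [map_sub, map_add, map_mul, map_mul, map_one, sub_eq_zero] at this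
  rw [ONH.t, dif_pos h, ONH.X, dif_pos (by omega), ONH.X, dif_pos h]
  exact eq_sub_of_add_eq this

theorem ONH.t_X_succ {i : ℕ} (h : i + 1 < k) :
    ONH.t 𝕜 k i * ONH.X 𝕜 k (i + 1) = 1 - ONH.X 𝕜 k i * ONH.t 𝕜 k i := by
  have := QuotBy.mk_eq_zero (𝕜 := 𝕜) (ONHRel 𝕜 k) (ONHRel.x_t ⟨i, by omega⟩)
  rw [map_sub, map_add, map_mul, map_mul, map_one, sub_eq_zero] at this
  rw [ONH.t, dif_pos h, ONH.X, dif_pos (by omega), ONH.X, dif_pos (by omega)]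
  exact eq_sub_of_add_eq' this

theorem ONH.t_X_far {i j : ℕ} (h1 : j ≠ i) (h2 : j ≠ i + 1) :
    ONH.t 𝕜 k i * ONH.X 𝕜 k j = - (ONH.X 𝕜 k j * ONH.t 𝕜 k i) := by
  by_cases hi : i + 1 < k
  · by_cases hj : j < k
    · have := QuotBy.mk_eq_zero (𝕜 := 𝕜) (ONHRel 𝕜 k)
        (ONHRel.x_t_far ⟨j, hj⟩ ⟨i, by omega⟩ (by simp [lo, Fin.ext_iff, h1])
          (by simp [OddGrassmannian.hi, Fin.ext_iff, h2]))
      rw [map_add, map_mul, map_mul] at this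
      rw [ONH.t, dif_pos hi, ONH.X, dif_pos hj]
      exact eq_neg_of_add_eq_zero_right this
    · rw [ONH.X, dif_neg hj, mul_zero, zero_mul, neg_zero]
  · rw [ONH.t_of_le (i := i) (by omega), mul_zero, zero_mul, neg_zero]

theorem ONH.x_anti {i j : Fin k} (h : i ≠ j) :
    ONH.x 𝕜 i * ONH.x 𝕜 j + ONH.x 𝕜 j * ONH.x 𝕜 i = 0 := by
  have := QuotBy.mk_eq_zero (𝕜 := 𝕜) (ONHRel 𝕜 k) (ONHRel.x_x i j h)
  rwa [map_add, map_mul, map_mul] at this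

theorem OPol.X_anti {i j : ℕ} (h : i ≠ j) :
    OPol.X 𝕜 k i * OPol.X 𝕜 k j = - (OPol.X 𝕜 k j * OPol.X 𝕜 k i) := by
  unfold OPol.X
  split_ifs
  · exact eq_neg_of_add_eq_zero_left (OPol.x_anti (by simpa using h))
  all_goals simp

theorem ONH.X_mem (i : ℕ) : ONH.X 𝕜 k i ∈ ONHComp 𝕜 k (2, 1) := by
  unfold ONH.X
  split_ifs
  · exact presComp_gen ONHGen.deg (ONHGen.x _)
  · exact Submodule.zero_mem _

theorem ONH.t_mem (i : ℕ) : ONH.t 𝕜 k i ∈ ONHComp 𝕜 k (-2, 1) := by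
  unfold ONH.t
  split_ifs
  · exact presComp_gen ONHGen.deg (ONHGen.t _)
  · exact Submodule.zero_mem _

theorem OPol.X_mem (i : ℕ) : OPol.X 𝕜 k i ∈ OPolComp 𝕜 k (2, 1) := by
  unfold OPol.X
  split_ifs
  · exact OPol.x_mem _
  · exact Submodule.zero_mem _

/-- Induction over the generators of the odd nilHecke algebra. -/
theorem ONH.induction {p : ONH 𝕜 k → Prop} (hr : ∀ r : 𝕜, p (algebraMap 𝕜 _ r))
    (hX : ∀ i, p (ONH.X 𝕜 k i)) (ht : ∀ i, p (ONH.t 𝕜 k i))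
    (hmul : ∀ u v, p u → p v → p (u * v)) (hadd : ∀ u v, p u → p v → p (u + v))
    (u : ONH 𝕜 k) : p u := by
  obtain ⟨a, rfl⟩ := QuotBy.mk_surj (𝕜 := 𝕜) (ONHRel 𝕜 k) u
  induction a using FreeAlgebra.induction with
  | grade0 r => rw [AlgHom.commutes]; exact hr r
  | grade1 g =>
    cases g with
    | x i => have := hX i; rwa [ONH.X_val] at this
    | t i => have := ht i; rwa [ONH.t_val] at this
  | mul a b ha hb => rw [map_mul]; exact hmul _ _ ha hb
  | add a b ha hb => rw [map_add]; exact hadd _ _ ha hb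

/-- Skew polynomials as a module over the odd nilHecke algebra. -/
instance OPol.instModuleONH : Module (ONH 𝕜 k) (OPol 𝕜 k) :=
  Module.compHom (OPol 𝕜 k) (polyRep 𝕜 k).toRingHom

theorem OPol.smul_def (u : ONH 𝕜 k) (f : OPol 𝕜 k) : u • f = polyRep 𝕜 k u f := rfl

theorem OPol.t_smul (i : Fin (k - 1)) (f : OPol 𝕜 k) : ONH.t 𝕜 k i • f = OPol.d i f := by
  rw [OPol.smul_def, ONH.t_val, polyRep, QuotBy.lift_mk, FreeAlgebra.lift_ι_apply]

theorem OPol.X_smul (i : ℕ) (f : OPol 𝕜 k) : ONH.X 𝕜 k i • f = OPol.X 𝕜 k i * f := by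
  rw [OPol.smul_def]
  unfold ONH.X OPol.X
  split_ifs
  · rw [ONH.x, polyRep, QuotBy.lift_mk, FreeAlgebra.lift_ι_apply]
    rfl
  · rw [map_zero, zero_mul, LinearMap.zero_apply]

theorem OPol.algebraMap_smul (r : 𝕜) (f : OPol 𝕜 k) : algebraMap 𝕜 (ONH 𝕜 k) r • f = r • f := by
  rw [OPol.smul_def, AlgHom.commutes, Module.algebraMap_end_apply]

/-- The skew polynomials as a subalgebra of the odd nilHecke algebra. -/
def OPol.toONH (𝕜 : Type*) [CommRing 𝕜] (k : ℕ) : OPol 𝕜 k →ₐ[𝕜] ONH 𝕜 k :=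
  OPol.lift (fun i => ONH.x 𝕜 i) fun _ _ h => ONH.x_anti h

theorem OPol.toONH_X (i : ℕ) : OPol.toONH 𝕜 k (OPol.X 𝕜 k i) = ONH.X 𝕜 k i := by
  unfold ONH.X OPol.X
  split_ifs
  · exact OPol.lift_x _ _ _
  · exact map_zero _

theorem OPol.toONH_smul (f g : OPol 𝕜 k) : OPol.toONH 𝕜 k f • g = f * g := by
  let N : Submodule 𝕜 (OPol 𝕜 k) :=
    { carrier := {f | ∀ g, OPol.toONH 𝕜 k f • g = f * g}
      zero_mem' := by simp
      add_mem' := by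
        intro a b ha hb g
        rw [map_add, add_smul, ha, hb, add_mul]
      smul_mem' := by
        intro c a ha g
        rw [map_smul, Algebra.smul_def, mul_smul, ha, OPol.algebraMap_smul, smul_mul_assoc] }
  refine OPol.mem_of_mul (N := N) (fun g => by rw [map_one, one_smul, one_mul]) ?_ f g
  intro i f hf g
  rw [map_mul, mul_smul, hf g, ← OPol.X_val, OPol.toONH_X, OPol.X_smul, mul_assoc]

/-- Induction for graded pieces of presented algebras. -/
theorem presComp_induction {X : Type*} {deg : X → Bideg} {S : FreeAlgebra 𝕜 X → Prop}
    {g : Bideg} {N : Submodule 𝕜 (QuotBy S)}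
    (h : ∀ l : List X, (l.map deg).sum = g →
      (l.map fun x => QuotBy.mk 𝕜 S (FreeAlgebra.ι 𝕜 x)).prod ∈ N)
    {a : QuotBy S} (ha : a ∈ presComp deg S g) : a ∈ N := by
  obtain ⟨w, hw, rfl⟩ := ha
  rw [AlgHom.toLinearMap_apply]
  induction hw using Submodule.span_induction with
  | mem x hx =>
    obtain ⟨l, rfl, hl⟩ := hx
    have := h l hl
    rwa [map_list_prod, List.map_map]
  | zero => rw [map_zero]; exact N.zero_mem
  | add x y hx hy h1 h2 => rw [map_add]; exact N.add_mem h1 h2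
  | smul c x hx h1 => rw [map_smul]; exact N.smul_mem _ h1

theorem OPol.toONH_mem {g : Bideg} {f : OPol 𝕜 k} (hf : f ∈ OPolComp 𝕜 k g) :
    OPol.toONH 𝕜 k f ∈ ONHComp 𝕜 k g := by
  refine presComp_induction (N := (ONHComp 𝕜 k g).comap (OPol.toONH 𝕜 k).toLinearMap) ?_ hf
  rintro l rfl
  rw [Submodule.mem_comap, AlgHom.toLinearMap_apply]
  clear hf
  induction l with
  | nil =>
    simp only [List.map_nil, List.prod_nil, List.sum_nil, map_one]
    exact presComp_one _
  | cons i l ih =>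
    simp only [List.map_cons, List.prod_cons, List.sum_cons, map_mul]
    refine presComp_mul _ ?_ ih
    have := ONH.X_mem (𝕜 := 𝕜) (k := k) i
    rw [← OPol.toONH_X, OPol.X_val] at this
    exact this

/-- The polynomial representation is graded. -/
theorem OPol.smul_mem {p q : Bideg} {u : ONH 𝕜 k} (hu : u ∈ ONHComp 𝕜 k p) {f : OPol 𝕜 k}
    (hf : f ∈ OPolComp 𝕜 k q) : u • f ∈ OPolComp 𝕜 k (p + q) := by
  let N : Submodule 𝕜 (ONH 𝕜 k) :=
    (OPolComp 𝕜 k (p + q)).comap ((LinearMap.applyₗ f).comp (polyRep 𝕜 k).toLinearMap)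
  refine presComp_induction (N := N) ?_ hu
  rintro l rfl
  change (_ : ONH 𝕜 k) • f ∈ OPolComp 𝕜 k _
  clear hu N
  induction l with
  | nil =>
    simp only [List.map_nil, List.prod_nil, List.sum_nil, one_smul, zero_add]
    exact hf
  | cons g l ih =>
    simp only [List.map_cons, List.prod_cons, List.sum_cons, mul_smul]
    rw [add_assoc]
    cases g with
    | x i =>
      have e := OPol.X_smul (𝕜 := 𝕜) (k := k) i
      rw [ONH.X_val, ONH.x] at e
      rw [e]
      exact presComp_mul _ (OPol.X_mem i) ih
    | t i =>
      have e := OPol.t_smul (𝕜 := 𝕜) (k := k) i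
      rw [ONH.t_val] at e
      rw [e, add_comm]
      exact OPol.d_mem i ih

/-- In the odd nilHecke algebra, `τ_i f = ∂_i(f) + s_i(f) τ_i`. -/
theorem ONH.t_mul_toONH (i : Fin (k - 1)) (f : OPol 𝕜 k) :
    ONH.t 𝕜 k i * OPol.toONH 𝕜 k f
      = OPol.toONH 𝕜 k (OPol.d i f) + OPol.toONH 𝕜 k (OPol.s i f) * ONH.t 𝕜 k i := by
  have hi := i.2
  let N : Submodule 𝕜 (OPol 𝕜 k) :=
    LinearMap.eqLocus ((LinearMap.mulLeft 𝕜 (ONH.t 𝕜 k i)).comp (OPol.toONH 𝕜 k).toLinearMap)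
      ((OPol.toONH 𝕜 k).toLinearMap.comp (OPol.d i)
        + (LinearMap.mulRight 𝕜 (ONH.t 𝕜 k i)).comp
          ((OPol.toONH 𝕜 k).comp (OPol.s i)).toLinearMap)
  refine OPol.mem_of_mul (N := N) ?_ ?_ f
  · simp [N, OPol.d_one]
  · intro j f hf
    simp only [N, LinearMap.mem_eqLocus, LinearMap.comp_apply, LinearMap.add_apply,
      AlgHom.toLinearMap_apply, LinearMap.mulLeft_apply, LinearMap.mulRight_apply,
      AlgHom.comp_apply] at hf ⊢
    have key : ONH.t 𝕜 k i * OPol.toONH 𝕜 k (OPol.x 𝕜 j)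
        = OPol.toONH 𝕜 k (OPol.d i (OPol.x 𝕜 j))
          + OPol.toONH 𝕜 k (OPol.s i (OPol.x 𝕜 j)) * ONH.t 𝕜 k i := by
      rw [OPol.d_x, OPol.s_x, map_neg, ← OPol.X_val, ← OPol.X_val, OPol.toONH_X, OPol.toONH_X,
        swap_val]
      simp only [near_iff]
      by_cases h1 : (j : ℕ) = i
      · rw [if_pos (Or.inl h1), if_pos h1, h1, ONH.t_X (by omega), map_one, sub_eq_add_neg, neg_mul]
      · by_cases h2 : (j : ℕ) = i + 1
        · rw [if_pos (Or.inr h2), if_neg h1, if_pos h2, h2, ONH.t_X_succ (by omega), map_one,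
            sub_eq_add_neg, neg_mul]
        · rw [if_neg (by tauto), if_neg h1, if_neg h2, ONH.t_X_far h1 h2, map_zero, zero_add,
            neg_mul]
    rw [map_mul, ← mul_assoc, key, OPol.d_mul, map_mul, map_add, map_mul, map_mul, map_mul,
      add_mul, mul_assoc (OPol.toONH 𝕜 k (OPol.s i (OPol.x 𝕜 j))), hf]
    noncomm_ring

/-- The vectors of a module over the odd nilHecke algebra that are killed by `τ_l` for `l > i`
(in zero-based indexing, for `l ≥ i`). -/
def IsVac (𝕜 : Type*) [CommRing 𝕜] (k i : ℕ) {V : Type*} [AddCommGroup V] [Module (ONH 𝕜 k) V]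
    (v : V) : Prop :=
  ∀ l, i ≤ l → ONH.t 𝕜 k l • v = 0

section Vac

variable {V : Type*} [AddCommGroup V] [Module (ONH 𝕜 k) V] {i : ℕ}

theorem IsVac.mono {v : V} (hv : IsVac 𝕜 k i v) {j : ℕ} (h : i ≤ j) : IsVac 𝕜 k j v :=
  fun l hl => hv l (h.trans hl)

/-- All the `τ_l` concerned are zero by default. This is the start of the induction over the
variables, which runs from the last variable to the first. -/
theorem isVac_top {v : V} (h : k ≤ i + 1) : IsVac 𝕜 k i v := fun l hl => by
  rw [ONH.t_of_le (by omega), zero_smul]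

theorem IsVac.add {v w : V} (hv : IsVac 𝕜 k i v) (hw : IsVac 𝕜 k i w) :
    IsVac 𝕜 k i (v + w) := fun l hl => by rw [smul_add, hv l hl, hw l hl, add_zero]

theorem IsVac.neg {v : V} (hv : IsVac 𝕜 k i v) :
    IsVac 𝕜 k i (-v) := fun l hl => by rw [smul_neg, hv l hl, neg_zero]

theorem IsVac.sub {v w : V} (hv : IsVac 𝕜 k i v) (hw : IsVac 𝕜 k i w) :
    IsVac 𝕜 k i (v - w) := fun l hl => by rw [smul_sub, hv l hl, hw l hl, sub_zero]

theorem isVac_zero : IsVac 𝕜 k i (0 : V) := fun _ _ => smul_zero _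

theorem IsVac.sum {ι : Type*} {s : Finset ι} {v : ι → V} (hv : ∀ j ∈ s, IsVac 𝕜 k i (v j)) :
    IsVac 𝕜 k i (∑ j ∈ s, v j) := fun l hl => by
  rw [Finset.smul_sum]
  exact Finset.sum_eq_zero fun j hj => hv j hj l hl

theorem IsVac.X_smul {v : V} (hv : IsVac 𝕜 k (i + 1) v) :
    IsVac 𝕜 k (i + 1) (ONH.X 𝕜 k i • v) := fun l hl => by
  rw [← mul_smul, ONH.t_X_far (by omega) (by omega), neg_smul, mul_smul, hv l hl, smul_zero,
    neg_zero]

theorem IsVac.X_pow_smul {v : V} (hv : IsVac 𝕜 k (i + 1) v) (q : ℕ) :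
    IsVac 𝕜 k (i + 1) (ONH.X 𝕜 k i ^ q • v) := by
  induction q with
  | zero => rwa [pow_zero, one_smul]
  | succ q ih => rw [pow_succ', mul_smul]; exact ih.X_smul

/-- In `τ_l f = ∂_l(f) + s_l(f) τ_l` the first term vanishes because of `f` and the second because
of `v`. -/
theorem IsVac.toONH_smul {v : V} (hv : IsVac 𝕜 k i v) {f : OPol 𝕜 k} (hf : IsVac 𝕜 k i f) :
    IsVac 𝕜 k i (OPol.toONH 𝕜 k f • v) := fun l hl => by
  by_cases h : l + 1 < k
  · have e := ONH.t_mul_toONH (𝕜 := 𝕜) (k := k) ⟨l, by omega⟩ f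
    have h2 := hf l hl
    rw [OPol.t_smul ⟨l, by omega⟩ f] at h2
    rw [← mul_smul, e, h2, map_zero, zero_add, mul_smul, hv l hl, smul_zero]
  · rw [ONH.t_of_le (by omega), zero_smul]

/-- If `v` is killed by the `τ_l` with `l ≥ i`, then so does `u` act on `f v` by its action on the
skew polynomial `f`, for `u` in the subalgebra generated by the `x_j` and these `τ_l`. -/
theorem IsVac.t_smul_toONH_smul {v : V} (hv : IsVac 𝕜 k i v) (f : OPol 𝕜 k) {l : ℕ}
    (hl : i ≤ l) : ONH.t 𝕜 k l • OPol.toONH 𝕜 k f • v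
      = OPol.toONH 𝕜 k (ONH.t 𝕜 k l • f) • v := by
  by_cases h : l + 1 < k
  · have e := ONH.t_mul_toONH (𝕜 := 𝕜) (k := k) ⟨l, by omega⟩ f
    have e2 := OPol.t_smul (𝕜 := 𝕜) (k := k) ⟨l, by omega⟩ f
    dsimp only at e e2
    rw [← mul_smul, e, e2, add_smul, mul_smul, hv l hl, smul_zero, add_zero]
  · rw [ONH.t_of_le (by omega), zero_smul, zero_smul, map_zero, zero_smul]

/-- A vector killed by all `τ_l` behaves like `1` in `OPol_k`, so computations in the polynomial
representation transfer to the submodule it generates in any `ONH_k`-module. -/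
theorem IsVac.smul_toONH_smul {v : V} (hv : IsVac 𝕜 k 0 v) (u : ONH 𝕜 k) (f : OPol 𝕜 k) :
    u • OPol.toONH 𝕜 k f • v = OPol.toONH 𝕜 k (u • f) • v := by
  induction u using ONH.induction generalizing f with
  | hr r => rw [OPol.algebraMap_smul, map_smul, Algebra.smul_def, mul_smul]
  | hX i => rw [OPol.X_smul, map_mul, OPol.toONH_X, mul_smul]
  | ht l => exact hv.t_smul_toONH_smul f (Nat.zero_le _)
  | hmul a b ha hb => rw [mul_smul, hb, ha, mul_smul]
  | hadd a b ha hb => rw [add_smul, ha, hb, add_smul, map_add, add_smul]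

end Vac

/-- `τ_l` acts linearly over the polynomials killed by it. -/
theorem IsVac.t_smul_mul {i : ℕ} {g : OPol 𝕜 k} (hg : IsVac 𝕜 k i g) (f : OPol 𝕜 k) {l : ℕ}
    (hl : i ≤ l) : ONH.t 𝕜 k l • (f * g) = (ONH.t 𝕜 k l • f) * g := by
  rw [← OPol.toONH_smul f g, hg.t_smul_toONH_smul f hl, OPol.toONH_smul]

theorem IsVac.smul_mul {g : OPol 𝕜 k} (hg : IsVac 𝕜 k 0 g) (u : ONH 𝕜 k) (f : OPol 𝕜 k) :
    u • (f * g) = (u • f) * g := by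
  rw [← OPol.toONH_smul f g, hg.smul_toONH_smul, OPol.toONH_smul]

theorem mem_OSym_iff {f : OPol 𝕜 k} : f ∈ OSym 𝕜 k ↔ IsVac 𝕜 k 0 f := by
  constructor
  · intro hf l _
    by_cases h : l + 1 < k
    · have := hf ⟨l, by omega⟩
      rwa [← OPol.t_smul] at this
    · rw [ONH.t_of_le (by omega), zero_smul]
  · intro hf i
    rw [← OPol.t_smul]
    exact hf i (Nat.zero_le _)

end ONHBasics


/-! ### Skew polynomials over the odd symmetric polynomials -/

section Staircase

variable {𝕜 : Type*} [CommRing 𝕜] {k : ℕ}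

/-- The product `τ_{i+m-1} ⋯ τ_{i+1} τ_i`. -/
def ONH.chain (𝕜 : Type*) [CommRing 𝕜] (k i : ℕ) : ℕ → ONH 𝕜 k
  | 0 => 1
  | m + 1 => ONH.t 𝕜 k (i + m) * ONH.chain 𝕜 k i m

theorem ONH.chain_mem (i m : ℕ) : ONH.chain 𝕜 k i m ∈ ONHComp 𝕜 k (m • (-2, 1)) := by
  induction m with
  | zero => rw [zero_smul]; exact presComp_one _
  | succ m ih =>
    rw [succ_nsmul']
    exact presComp_mul _ (ONH.t_mem _) ih

section Module

variable {V : Type*} [AddCommGroup V] [Module (ONH 𝕜 k) V] {i : ℕ}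

/-- Compare `l` with the index of the leftmost factor of the chain. If they are equal, `τ_l² = 0`.
If `l` is one less, the braid relation leaves `τ_{l+1}` acting on a chain shorter by two, where
induction applies. Otherwise `τ_l` anticommutes past that factor. The excluded index `i + m` is the
one that would lengthen the chain. -/
theorem IsVac.t_chain_smul {v : V} (hv : IsVac 𝕜 k (i + 1) v) (m : ℕ) {l : ℕ} (hl : i ≤ l)
    (hlm : l ≠ i + m) : ONH.t 𝕜 k l • ONH.chain 𝕜 k i m • v = 0 := by
  induction m using Nat.strong_induction_on generalizing l with
  | _ m ih =>
    cases m with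
    | zero =>
      rw [ONH.chain, one_smul]
      exact hv l (by omega)
    | succ m =>
      rw [ONH.chain, mul_smul]
      by_cases h1 : l = i + m
      · rw [h1, ← mul_smul, ONH.t_sq, zero_smul]
      · by_cases h2 : l + 1 = i + m
        · obtain ⟨p, rfl⟩ : ∃ p, m = p + 1 := ⟨m - 1, by omega⟩
          have e : l = i + p := by omega
          subst e
          rw [ONH.chain, mul_smul, ← mul_smul, ← mul_smul, ← add_assoc, ONH.braid,
            mul_smul, add_assoc, ih p (by omega) (by omega) (by omega), smul_zero]
        · rw [← mul_smul, ONH.t_far (by omega), neg_smul, mul_smul, ih m (by omega) hl h1,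
            smul_zero, neg_zero]

/-- At full length, lengthening the chain would need `τ_{i+m}`, which does not exist. The full chain
therefore gains one more killing index, and this drives the induction over the variables. -/
theorem IsVac.chain_smul {v : V} (hv : IsVac 𝕜 k (i + 1) v) {m : ℕ} (h : i + m + 1 = k) :
    IsVac 𝕜 k i (ONH.chain 𝕜 k i m • v) := fun l hl => by
  by_cases hlm : l = i + m
  · rw [ONH.t_of_le (by omega), zero_smul]
  · exact hv.t_chain_smul m hl hlm

/-- The variable travels leftwards through the chain, and each crossing yields a constant term and a
sign. Only the constant term of the last crossing survives, because the next `τ` kills the earlier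
ones by `IsVac.t_chain_smul`. -/
theorem IsVac.chain_succ_X_smul {v : V} (hv : IsVac 𝕜 k (i + 1) v) {m : ℕ} (h : i + m + 1 < k) :
    ONH.chain 𝕜 k i (m + 1) • ONH.X 𝕜 k i • v = (-1 : ℤˣ) ^ m • (ONH.chain 𝕜 k i m • v
      - ONH.X 𝕜 k (i + m + 1) • ONH.chain 𝕜 k i (m + 1) • v) := by
  induction m with
  | zero =>
    simp only [ONH.chain, add_zero, mul_one, pow_zero, one_smul]
    rw [← mul_smul, ONH.t_X (by omega), sub_smul, one_smul, mul_smul]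
  | succ m ih =>
    rw [ONH.chain, mul_smul, ih (by omega), smul_comm, smul_sub, ← add_assoc,
      hv.t_chain_smul m (by omega) (by omega), zero_sub, ← mul_smul, add_assoc i m 1,
      ONH.t_X (by omega), sub_smul, one_smul, pow_succ, mul_smul ((-1 : ℤˣ) ^ m), Units.neg_smul,
      one_smul, mul_smul, ← mul_smul (ONH.t 𝕜 k (i + (m + 1)))]

/-- Read backwards, `IsVac.chain_succ_X_smul` expresses `chain_p x^j v` by `chain_{p+1} x^{j+1} v`
and `x_{i+p+1} chain_{p+1} x^j v`. Vanishing at full length thus descends to shorter chains, at the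
price of one power of `x` per step, and length 0 gives `v`. This criterion takes the place of
faithfulness of the polynomial representation. -/
theorem IsVac.eq_zero_of_chain {v : V} (hv : IsVac 𝕜 k (i + 1) v) {m : ℕ} (h : i + m + 1 = k)
    (h0 : ∀ j ≤ m, ONH.chain 𝕜 k i m • ONH.X 𝕜 k i ^ j • v = 0) : v = 0 := by
  have main : ∀ p ≤ m, ∀ j, j + p ≤ m → ONH.chain 𝕜 k i (m - p) • ONH.X 𝕜 k i ^ j • v = 0 := by
    intro p
    induction p with
    | zero => intro _ j hj; exact h0 j (by omega)
    | succ p ih =>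
      intro hp j hj
      have e := (hv.X_pow_smul j).chain_succ_X_smul (m := m - (p + 1)) (by omega)
      have e1 : m - (p + 1) + 1 = m - p := by omega
      rw [e1, ih (by omega) j (by omega), ← mul_smul (ONH.X 𝕜 k i), ← pow_succ',
        ih (by omega) (j + 1) (by omega), smul_zero, sub_zero] at e
      exact (smul_eq_zero_iff_eq _).mp e.symm
  simpa [ONH.chain] using main m le_rfl 0 (by omega)

end Module

theorem isVac_one (i : ℕ) : IsVac 𝕜 k i (1 : OPol 𝕜 k) := fun l _ => by
  by_cases h : l + 1 < k
  · have e := OPol.t_smul (𝕜 := 𝕜) (k := k) ⟨l, by omega⟩ 1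
    rw [OPol.d_one] at e
    exact e
  · rw [ONH.t_of_le (by omega), zero_smul]

theorem OPol.X_pow_smul (i q : ℕ) (f : OPol 𝕜 k) :
    ONH.X 𝕜 k i ^ q • f = OPol.X 𝕜 k i ^ q * f := by
  rw [← OPol.toONH_X, ← map_pow, OPol.toONH_smul]

theorem isVac_X_pow (i q : ℕ) : IsVac 𝕜 k (i + 1) (OPol.X 𝕜 k i ^ q) := by
  have := (isVac_one (𝕜 := 𝕜) (k := k) (i + 1)).X_pow_smul q
  rwa [OPol.X_pow_smul, mul_one] at this

/-- The value of the chain of divided differences on a power of the first variable. -/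
def chainVal (𝕜 : Type*) [CommRing 𝕜] (k i m q : ℕ) : OPol 𝕜 k :=
  ONH.chain 𝕜 k i m • OPol.X 𝕜 k i ^ q

theorem chainVal_isVac {i m : ℕ} (h : i + m + 1 = k) (q : ℕ) :
    IsVac 𝕜 k i (chainVal 𝕜 k i m q) :=
  (isVac_X_pow i q).chain_smul h

/-- Each `τ` lowers the polynomial degree by one. The recursion of `IsVac.chain_succ_X_smul`
replaces this degree argument. -/
theorem chainVal_of_lt {i m : ℕ} (h : i + m + 1 ≤ k) {q : ℕ} (hq : q < m) :
    chainVal 𝕜 k i m q = 0 := by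
  induction q generalizing m with
  | zero =>
    obtain ⟨p, rfl⟩ : ∃ p, m = p + 1 := ⟨m - 1, by omega⟩
    clear hq
    induction p with
    | zero =>
      rw [chainVal, ONH.chain, ONH.chain, mul_one, pow_zero]
      exact isVac_one (i + 0) _ le_rfl
    | succ p ih =>
      have := ih (by omega)
      rw [chainVal] at this ⊢
      rw [ONH.chain, mul_smul, this, smul_zero]
  | succ q ih =>
    obtain ⟨p, rfl⟩ : ∃ p, m = p + 1 := ⟨m - 1, by omega⟩
    have e := (isVac_X_pow (𝕜 := 𝕜) (k := k) i q).chain_succ_X_smul (m := p) (by omega)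
    have e1 := ih (m := p) (by omega) (by omega)
    have e2 := ih (m := p + 1) (by omega) (by omega)
    rw [chainVal] at e1 e2 ⊢
    rw [e1, e2, smul_zero, sub_zero, smul_zero, OPol.X_smul, ← pow_succ'] at e
    exact e

theorem chainVal_self {i m : ℕ} (h : i + m + 1 ≤ k) :
    ∃ c : ℤˣ, chainVal 𝕜 k i m m = c • 1 := by
  induction m with
  | zero => exact ⟨1, by rw [chainVal, ONH.chain, pow_zero, one_smul, one_smul]⟩
  | succ m ih =>
    obtain ⟨c, hc⟩ := ih (by omega)
    have e := (isVac_X_pow (𝕜 := 𝕜) (k := k) i m).chain_succ_X_smul (m := m) (by omega)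
    have e2 := chainVal_of_lt (𝕜 := 𝕜) (k := k) (i := i) (m := m + 1) h (q := m) (by omega)
    rw [chainVal] at hc e2 ⊢
    rw [hc, e2, smul_zero, sub_zero, OPol.X_smul, ← pow_succ'] at e
    exact ⟨(-1) ^ m * c, by rw [e, mul_smul]⟩

theorem IsVac.chain_smul_mul {i : ℕ} {g : OPol 𝕜 k} (hg : IsVac 𝕜 k i g) (m : ℕ) (f : OPol 𝕜 k) :
    ONH.chain 𝕜 k i m • (f * g) = (ONH.chain 𝕜 k i m • f) * g := by
  induction m with
  | zero => rw [ONH.chain, one_smul, one_smul]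
  | succ m ih => rw [ONH.chain, mul_smul, ih, hg.t_smul_mul _ (by omega), mul_smul]

theorem IsVac.chain_smul_toONH {V : Type*} [AddCommGroup V] [Module (ONH 𝕜 k) V] {i : ℕ} {v : V}
    (hv : IsVac 𝕜 k i v) (m : ℕ) (f : OPol 𝕜 k) :
    ONH.chain 𝕜 k i m • OPol.toONH 𝕜 k f • v = OPol.toONH 𝕜 k (ONH.chain 𝕜 k i m • f) • v := by
  induction m with
  | zero => rw [ONH.chain, one_smul, one_smul]
  | succ m ih => rw [ONH.chain, mul_smul, ih, hv.t_smul_toONH_smul _ (by omega), mul_smul]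

/-- The coefficient functionals of the decomposition along the powers of `x_i`, by a triangular
recursion. -/
def coeffRec (𝕜 : Type*) [CommRing 𝕜] (k i m : ℕ) (c : ℤˣ) : ℕ → ONH 𝕜 k
  -- The pairing of `s` with `j` given by `chain x^{s+j}` vanishes for `s + j < m` and is the sign
  -- `c` for `s + j = m`. The recursion inverts this triangular pairing; dividing by `c` is
  -- multiplying by it.
  | s => c • (ONH.chain 𝕜 k i m * ONH.X 𝕜 k i ^ s
      - ∑ t : Fin s, OPol.toONH 𝕜 k (chainVal 𝕜 k i m (m + s - t)) * coeffRec 𝕜 k i m c t)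

theorem units_smul_mem {M : Type*} [AddCommGroup M] [Module 𝕜 M] (N : Submodule 𝕜 M) (c : ℤˣ)
    {x : M} (hx : x ∈ N) : c • x ∈ N := by
  rcases Int.units_eq_one_or c with rfl | rfl
  · rwa [one_smul]
  · rw [Units.neg_smul, one_smul]
    exact N.neg_mem hx

theorem X_pow_mem (i q : ℕ) : OPol.X 𝕜 k i ^ q ∈ OPolComp 𝕜 k (q • (2, 1)) :=
  SetLike.pow_mem_graded q (OPol.X_mem i)

theorem ONH_X_pow_mem (i q : ℕ) : ONH.X 𝕜 k i ^ q ∈ ONHComp 𝕜 k (q • (2, 1)) :=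
  SetLike.pow_mem_graded q (ONH.X_mem i)

theorem coeffRec_mem (i m : ℕ) (c : ℤˣ) (s : ℕ) (hs : s ≤ m) :
    coeffRec 𝕜 k i m c s ∈ ONHComp 𝕜 k (-((m - s) • (2, 1))) := by
  have neg : ((-2, 1) : Bideg) = -(2, 1) := by decide
  induction s using Nat.strong_induction_on with
  | _ s ih =>
    rw [coeffRec]
    refine units_smul_mem _ _ (Submodule.sub_mem _ ?_ (Submodule.sum_mem _ fun t _ => ?_))
    · have := presComp_mul ONHGen.deg (ONH.chain_mem (𝕜 := 𝕜) (k := k) i m) (ONH_X_pow_mem i s)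
      have e : -((m - s) • ((2, 1) : Bideg)) = m • (-2, 1) + s • (2, 1) := by
        rw [neg]
        obtain ⟨r, rfl⟩ := Nat.exists_eq_add_of_le hs
        rw [Nat.add_sub_cancel_left, add_smul, smul_neg, smul_neg]
        abel
      rw [e]
      exact this
    · have h1 := OPol.toONH_mem (OPol.smul_mem (ONH.chain_mem (𝕜 := 𝕜) (k := k) i m)
        (X_pow_mem i (m + s - t)))
      have h2 := ih t t.2 (by omega)
      have := presComp_mul ONHGen.deg h1 h2
      have e : -((m - s) • ((2, 1) : Bideg))
          = m • (-2, 1) + (m + s - t) • (2, 1) + -((m - t) • (2, 1)) := by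
        rw [neg]
        obtain ⟨r, hr⟩ := Nat.exists_eq_add_of_le hs
        obtain ⟨r', hr'⟩ := Nat.exists_eq_add_of_le t.2.le
        have e1 : m - s = r := by omega
        have e2 : m + s - t = m + r' := by omega
        have e3 : m - t = r + r' := by omega
        rw [e1, e2, e3, add_smul, add_smul, smul_neg]
        abel
      rw [e]
      exact this

theorem coeffRec_isVac {V : Type*} [AddCommGroup V] [Module (ONH 𝕜 k) V] {i m : ℕ}
    (h : i + m + 1 = k) (c : ℤˣ) (s : ℕ) {v : V} (hv : IsVac 𝕜 k (i + 1) v) :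
    IsVac 𝕜 k i (coeffRec 𝕜 k i m c s • v) := by
  induction s using Nat.strong_induction_on with
  | _ s ih =>
    rw [coeffRec]
    have key : IsVac 𝕜 k i ((ONH.chain 𝕜 k i m * ONH.X 𝕜 k i ^ s
      - ∑ t : Fin s, OPol.toONH 𝕜 k (chainVal 𝕜 k i m (m + s - t)) * coeffRec 𝕜 k i m c t) • v) := by
      rw [sub_smul, mul_smul, Finset.sum_smul]
      refine IsVac.sub ((hv.X_pow_smul s).chain_smul h) (IsVac.sum fun t _ => ?_)
      rw [mul_smul]
      exact (ih t t.2).toONH_smul (chainVal_isVac h _)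
    rcases Int.units_eq_one_or c with rfl | rfl
    · rwa [one_smul]
    · rw [Units.neg_smul, one_smul, neg_smul]
      exact key.neg

/-- By induction, among the subtracted terms only `t = m - j` acts nontrivially on `x^j g`. It
occurs when `s + j > m`, and then it cancels the unwanted value of the chain exactly. The functional
numbered `s` thus reads off the coefficient of `x_i^{m-s}`. -/
theorem coeffRec_smul {i m : ℕ} (h : i + m + 1 = k) {c : ℤˣ}
    (hc : chainVal 𝕜 k i m m = c • 1) (s : ℕ) (hs : s ≤ m) (j : ℕ) (hj : j ≤ m) {g : OPol 𝕜 k}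
    (hg : IsVac 𝕜 k i g) :
    coeffRec 𝕜 k i m c s • (OPol.X 𝕜 k i ^ j * g) = if s + j = m then g else 0 := by
  induction s using Nat.strong_induction_on with
  | _ s ih =>
    have e1 : (ONH.chain 𝕜 k i m * ONH.X 𝕜 k i ^ s) • (OPol.X 𝕜 k i ^ j * g)
        = chainVal 𝕜 k i m (s + j) * g := by
      rw [mul_smul, OPol.X_pow_smul, ← mul_assoc, ← pow_add, hg.chain_smul_mul, chainVal]
    have e2 : (∑ t : Fin s, OPol.toONH 𝕜 k (chainVal 𝕜 k i m (m + s - t))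
          * coeffRec 𝕜 k i m c t) • (OPol.X 𝕜 k i ^ j * g)
        = if m < s + j then chainVal 𝕜 k i m (s + j) * g else 0 := by
      rw [Finset.sum_smul]
      have e3 : ∀ t : Fin s, (OPol.toONH 𝕜 k (chainVal 𝕜 k i m (m + s - t))
          * coeffRec 𝕜 k i m c t) • (OPol.X 𝕜 k i ^ j * g)
          = if (t : ℕ) + j = m then chainVal 𝕜 k i m (s + j) * g else 0 := by
        intro t
        rw [mul_smul, ih t t.2 (by omega), OPol.toONH_smul]
        split_ifs with h1
        · congr 2; omega
        · rw [mul_zero]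
      rw [Finset.sum_congr rfl fun t _ => e3 t]
      split_ifs with h1
      · rw [Finset.sum_eq_single ⟨m - j, by omega⟩, if_pos (by dsimp only; omega)]
        · intro b _ hb
          rw [if_neg]
          intro hb'
          exact hb (Fin.ext (by dsimp only; omega))
        · simp
      · exact Finset.sum_eq_zero fun t _ => by rw [if_neg (by omega)]
    rw [coeffRec]
    have e4 : (ONH.chain 𝕜 k i m * ONH.X 𝕜 k i ^ s
      - ∑ t : Fin s, OPol.toONH 𝕜 k (chainVal 𝕜 k i m (m + s - t)) * coeffRec 𝕜 k i m c t)
        • (OPol.X 𝕜 k i ^ j * g) = if s + j = m then c • g else 0 := by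
      rw [sub_smul, e1, e2]
      split_ifs with h1 h2 h2
      · omega
      · rw [sub_self]
      · rw [h2, hc, sub_zero, smul_mul_assoc, one_mul]
      · rw [chainVal_of_lt h.le (by omega), zero_mul, sub_zero]
    rcases Int.units_eq_one_or c with rfl | rfl
    · rw [one_smul, e4]; simp
    · rw [Units.neg_smul, one_smul, neg_smul, e4]
      split_ifs
      · rw [Units.neg_smul, one_smul, neg_neg]
      · rw [neg_zero]

/-- By `IsVac.eq_zero_of_chain` it suffices to compare both sides after applying `chain x^j` for `j
≤ m`. The resulting identity is the recursion defining `coeffRec`, solved for its leading term.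
Since this holds in any module, the regular one yields an identity inside `ONH_k`. -/
theorem sum_coeffRec {V : Type*} [AddCommGroup V] [Module (ONH 𝕜 k) V] {i m : ℕ}
    (h : i + m + 1 = k) {c : ℤˣ} (hc : chainVal 𝕜 k i m m = c • 1) {v : V}
    (hv : IsVac 𝕜 k (i + 1) v) :
    ∑ s ∈ Finset.range (m + 1), ONH.X 𝕜 k i ^ (m - s) • coeffRec 𝕜 k i m c s • v = v := by
  rw [eq_comm, ← sub_eq_zero]
  have hz : ∀ s, IsVac 𝕜 k i (coeffRec 𝕜 k i m c s • v) := fun s => coeffRec_isVac h c s hv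
  refine IsVac.eq_zero_of_chain (hv.sub (IsVac.sum fun s _ =>
    ((hz s).mono (Nat.le_succ i)).X_pow_smul _)) h fun j hj => ?_
  rw [smul_sub, smul_sub, Finset.smul_sum, Finset.smul_sum, sub_eq_zero]
  have e : ∀ s ∈ Finset.range (m + 1), ONH.chain 𝕜 k i m • ONH.X 𝕜 k i ^ j
      • ONH.X 𝕜 k i ^ (m - s) • coeffRec 𝕜 k i m c s • v
      = OPol.toONH 𝕜 k (chainVal 𝕜 k i m (m + j - s)) • coeffRec 𝕜 k i m c s • v := by
    intro s hs
    rw [Finset.mem_range] at hs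
    rw [← mul_smul (ONH.X 𝕜 k i ^ j), ← pow_add, ← OPol.toONH_X, ← map_pow,
      (hz s).chain_smul_toONH, chainVal]
    congr 5
    omega
  rw [Finset.sum_congr rfl e]
  have e2 : ∑ s ∈ Finset.range (m + 1), OPol.toONH 𝕜 k (chainVal 𝕜 k i m (m + j - s))
      • coeffRec 𝕜 k i m c s • v
      = ∑ s ∈ Finset.range (j + 1), OPol.toONH 𝕜 k (chainVal 𝕜 k i m (m + j - s))
      • coeffRec 𝕜 k i m c s • v := by
    refine (Finset.sum_subset (Finset.range_mono (by omega)) fun s hs hs' => ?_).symm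
    rw [Finset.mem_range] at hs hs'
    rw [chainVal_of_lt h.le (by omega), map_zero, zero_smul]
  rw [e2, Finset.sum_range_succ, Nat.add_sub_cancel, hc]
  have e3 : OPol.toONH 𝕜 k (c • 1) • coeffRec 𝕜 k i m c j • v
      = (ONH.chain 𝕜 k i m * ONH.X 𝕜 k i ^ j
      - ∑ t : Fin j, OPol.toONH 𝕜 k (chainVal 𝕜 k i m (m + j - t)) * coeffRec 𝕜 k i m c t) • v := by
    conv_lhs => rw [coeffRec]
    rcases Int.units_eq_one_or c with rfl | rfl
    · rw [one_smul, one_smul, map_one, one_smul]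
    · rw [Units.neg_smul, one_smul, Units.neg_smul, one_smul, map_neg, map_one, ← mul_smul,
        neg_mul_neg, one_mul]
  rw [e3, sub_smul, Finset.sum_smul, mul_smul,
    Finset.sum_range fun s => OPol.toONH 𝕜 k (chainVal 𝕜 k i m (m + j - s))
      • coeffRec 𝕜 k i m c s • v]
  simp only [mul_smul]
  abel

/-- The coefficient functionals of the decomposition of the vectors killed by `τ_l`, `l > i`,
along the powers of `x_i`. -/
theorem exists_coeff {i m : ℕ} (h : i + m + 1 = k) : ∃ z : Fin (m + 1) → ONH 𝕜 k,
    (∀ j : Fin (m + 1), z j ∈ ONHComp 𝕜 k (-((j : ℕ) • (2, 1)))) ∧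
    (∀ (j : Fin (m + 1)) (u : ONH 𝕜 k), IsVac 𝕜 k (i + 1) u → IsVac 𝕜 k i (z j * u)) ∧
    (∀ u : ONH 𝕜 k, IsVac 𝕜 k (i + 1) u →
      ∑ j : Fin (m + 1), ONH.X 𝕜 k i ^ (j : ℕ) * (z j * u) = u) ∧
    (∀ (j j' : Fin (m + 1)) (g : OPol 𝕜 k), IsVac 𝕜 k i g →
      z j • (OPol.X 𝕜 k i ^ (j' : ℕ) * g) = if j = j' then g else 0) := by
  obtain ⟨c, hc⟩ := chainVal_self (𝕜 := 𝕜) (k := k) h.le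
  refine ⟨fun j => coeffRec 𝕜 k i m c (m - j), fun j => ?_, fun j u hu => ?_, fun u hu => ?_,
    fun j j' g hg => ?_⟩
  · have := coeffRec_mem (𝕜 := 𝕜) (k := k) i m c (m - j) (Nat.sub_le _ _)
    rwa [show m - (m - (j : ℕ)) = j by omega] at this
  · exact coeffRec_isVac h c _ hu
  · have := sum_coeffRec h hc hu
    rw [← Finset.sum_range_reflect, Finset.sum_range] at this
    conv_rhs => rw [← this]
    refine Finset.sum_congr rfl fun j _ => ?_
    rw [show m + 1 - 1 - (j : ℕ) = m - j by omega, show m - (m - (j : ℕ)) = j by omega]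
    rfl
  · rw [coeffRec_smul h hc _ (Nat.sub_le _ _) _ (by omega) hg]
    exact if_congr (by rw [Fin.ext_iff]; omega) rfl rfl

end Staircase


/-! ### Functionals dual to the staircase monomials -/

section StairBasis

variable {𝕜 : Type*} [CommRing 𝕜] {k : ℕ}

/-- Staircase exponents as a first exponent and staircase exponents of smaller length. -/
def stairCons (m : ℕ) : Fin (m + 1) × Staircase m ≃ Staircase (m + 1) where
  toFun p := Fin.cons (α := fun i : Fin (m + 1) => Fin (m + 1 - i)) (Fin.cast (by simp) p.1)
    fun l => Fin.cast (by simp) (p.2 l)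
  invFun a := (Fin.cast (by simp) (a 0), fun l => Fin.cast (by simp) (a l.succ))
  left_inv p := by
    refine Prod.ext ?_ (funext fun l => ?_) <;> rfl
  right_inv a := by
    funext l
    refine Fin.cases ?_ (fun l => ?_) l <;> rfl

theorem stairCons_succ (m : ℕ) (p : Fin (m + 1) × Staircase m) (l : Fin m) :
    ((stairCons m p l.succ : Fin _) : ℕ) = p.2 l := rfl

/-- The staircase monomials in the last `m` of `i + m` variables. -/
def smon (𝕜 : Type*) [CommRing 𝕜] (k i m : ℕ) (a : Staircase m) : OPol 𝕜 k :=
  (List.ofFn fun l : Fin m => OPol.X 𝕜 k (i + l) ^ (a l : ℕ)).prod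

theorem smon_cons (i m : ℕ) (p : Fin (m + 1) × Staircase m) :
    smon 𝕜 k i (m + 1) (stairCons m p) = OPol.X 𝕜 k i ^ (p.1 : ℕ) * smon 𝕜 k (i + 1) m p.2 := by
  rw [smon, List.ofFn_succ, List.prod_cons, smon]
  congr 2
  refine congrArg _ (funext fun l => ?_)
  rw [stairCons_succ, Fin.val_succ, show i + ((l : ℕ) + 1) = i + 1 + l by omega]

/-- Skew monomials in distinct variables commute up to sign. The sign stays unspecified because it
will be absorbed into the dual functional, where it cancels. -/
theorem X_pow_mul_smon (i r m : ℕ) (h : i < r) (j : ℕ) (a : Staircase m) : ∃ ε : ℤˣ,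
    OPol.X 𝕜 k i ^ j * smon 𝕜 k r m a = ε • (smon 𝕜 k r m a * OPol.X 𝕜 k i ^ j) := by
  have hXX : ∀ s, i < s → ∃ ε : ℤˣ, OPol.X 𝕜 k i * OPol.X 𝕜 k s
      = ε • (OPol.X 𝕜 k s * OPol.X 𝕜 k i) := fun s hs =>
    ⟨-1, by rw [OPol.X_anti hs.ne, Units.neg_smul, one_smul]⟩
  have hpow : ∀ {x y : OPol 𝕜 k}, (∃ ε : ℤˣ, x * y = ε • (y * x)) → ∀ n : ℕ,
      ∃ ε : ℤˣ, x * y ^ n = ε • (y ^ n * x) := by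
    rintro x y ⟨ε, h⟩ n
    induction n with
    | zero => exact ⟨1, by simp⟩
    | succ n ih =>
      obtain ⟨δ, hδ⟩ := ih
      exact ⟨δ * ε, by rw [pow_succ, ← mul_assoc, hδ, smul_mul_assoc, mul_assoc, h,
        mul_smul_comm, smul_smul, mul_assoc]⟩
  have hsymm : ∀ {x y : OPol 𝕜 k}, (∃ ε : ℤˣ, x * y = ε • (y * x)) →
      ∃ ε : ℤˣ, y * x = ε • (x * y) := by
    rintro x y ⟨ε, h⟩
    exact ⟨ε, by rw [h, smul_smul, Int.units_mul_self, one_smul]⟩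
  induction m generalizing r with
  | zero => exact ⟨1, by simp [smon]⟩
  | succ m ih =>
    obtain ⟨p, rfl⟩ := (stairCons m).surjective a
    obtain ⟨δ, hδ⟩ := ih (r + 1) (by omega) p.2
    obtain ⟨ε, hε⟩ := hpow (hsymm (hpow (hsymm (hXX r h)) j)) p.1
    exact ⟨ε * δ, by rw [smon_cons, ← mul_assoc, hε, smul_mul_assoc, mul_assoc, hδ,
      mul_smul_comm, smul_smul, mul_assoc]⟩

/-- The coefficient functionals of the staircase monomials, realised in the odd nilHecke algebra. -/
theorem exists_stair_coeff {i m : ℕ} (h : i + m = k) : ∃ y : Staircase m → ONH 𝕜 k,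
    (∀ a, y a ∈ ONHComp 𝕜 k (-((∑ l, (a l : ℕ)) • (2, 1)))) ∧
    (∀ a, IsVac 𝕜 k i (y a)) ∧
    (∑ a, OPol.toONH 𝕜 k (smon 𝕜 k i m a) * y a = 1) ∧
    (∀ (a b : Staircase m) (g : OPol 𝕜 k), IsVac 𝕜 k i g →
      y a • (smon 𝕜 k i m b * g) = if a = b then g else 0) := by
  induction m generalizing i with
  | zero =>
    refine ⟨fun _ => 1, fun a => ?_, fun a => isVac_top (by omega), ?_, fun a b g _ => ?_⟩
    · simp only [Finset.univ_eq_empty, Finset.sum_empty, zero_smul, neg_zero]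
      exact presComp_one _
    · simp [smon]
    · rw [if_pos (Subsingleton.elim _ _), one_smul]
      simp [smon]
  | succ m ih =>
    obtain ⟨y, y1, y2, y3, y4⟩ := ih (i := i + 1) (by omega)
    obtain ⟨z, z1, z2, z3, z4⟩ := exists_coeff (𝕜 := 𝕜) (k := k) (i := i) (m := m) (by omega)
    choose ε hε using fun p : Fin (m + 1) × Staircase m =>
      X_pow_mul_smon (𝕜 := 𝕜) (k := k) i (i + 1) m (Nat.lt_succ_self i) p.1 p.2
    -- The factor `y` acts first and reads off the monomial in the later variables; its remaining
    -- factor `x_i^q g` is still killed by the `τ_l` with index above `i`. Then `z` reads off the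
    -- power of `x_i`. The sign comes from moving that power to the right of the monomial.
    let w : Fin (m + 1) × Staircase m → ONH 𝕜 k := fun p => ε p • (z p.1 * y p.2)
    have smul_zu : ∀ (c : ℤˣ) (u : ONH 𝕜 k) (f : OPol 𝕜 k), (c • u) • f = c • u • f := by
      intro c u f
      rcases Int.units_eq_one_or c with rfl | rfl
      · rw [one_smul, one_smul]
      · rw [Units.neg_smul, one_smul, neg_smul, Units.neg_smul, one_smul]
    have smul_uz : ∀ (c : ℤˣ) (u : ONH 𝕜 k) (f : OPol 𝕜 k), u • (c • f) = c • u • f := by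
      intro c u f
      exact smul_comm _ _ _
    have map_z : ∀ (c : ℤˣ) (f : OPol 𝕜 k), OPol.toONH 𝕜 k (c • f) = c • OPol.toONH 𝕜 k f := by
      intro c f
      rcases Int.units_eq_one_or c with rfl | rfl
      · rw [one_smul, one_smul]
      · rw [Units.neg_smul, one_smul, map_neg, Units.neg_smul, one_smul]
    refine ⟨fun a => w ((stairCons m).symm a), ?_, ?_, ?_, ?_⟩
    · rw [(stairCons m).symm.forall_congr_left]
      intro p
      rw [Equiv.symm_symm]
      beta_reduce
      rw [Equiv.symm_apply_apply, Fin.sum_univ_succ]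
      have := presComp_mul ONHGen.deg (z1 p.1) (y1 p.2)
      rw [← neg_add, ← add_smul] at this
      exact units_smul_mem _ _ this
    · rw [(stairCons m).symm.forall_congr_left]
      intro p
      rw [Equiv.symm_symm]
      beta_reduce
      rw [Equiv.symm_apply_apply]
      intro l hl
      have := z2 p.1 _ (y2 p.2) l hl
      rw [smul_comm, this, smul_zero]
    · rw [← (stairCons m).sum_comp, Fintype.sum_prod_type_right]
      rw [← y3]
      refine Finset.sum_congr rfl fun a _ => ?_
      -- Each `y a` is killed by the `τ_l` with index above `i`, so it can be expanded along the
      -- powers of `x_i`.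
      have e := z3 _ (y2 a)
      conv_rhs => rw [← e, Finset.mul_sum]
      refine Finset.sum_congr rfl fun j _ => ?_
      beta_reduce
      rw [Equiv.symm_apply_apply, smon_cons, hε (j, a), map_z, map_mul, map_pow, OPol.toONH_X]
      simp only [w]
      rw [smul_mul_assoc, mul_smul_comm, smul_smul, Int.units_mul_self, one_smul, mul_assoc]
    · intro a b g hg
      obtain ⟨p, rfl⟩ := (stairCons m).surjective a
      obtain ⟨q, rfl⟩ := (stairCons m).surjective b
      have hg' : IsVac 𝕜 k (i + 1) (OPol.X 𝕜 k i ^ (q.1 : ℕ) * g) := by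
        rw [← OPol.X_pow_smul]
        exact (hg.mono (Nat.le_succ i)).X_pow_smul _
      beta_reduce
      rw [Equiv.symm_apply_apply, smon_cons, hε q, smul_mul_assoc, smul_uz]
      simp only [w]
      rw [smul_zu, smul_smul, mul_smul (z p.1), mul_assoc, y4 _ _ _ hg',
        if_congr (stairCons m).injective.eq_iff rfl rfl]
      by_cases h1 : p = q
      · subst h1
        rw [if_pos rfl, if_pos rfl, z4 _ _ _ hg, if_pos rfl, Int.units_mul_self, one_smul]
      · rw [if_neg h1]
        split_ifs with h2
        · rw [z4 _ _ _ hg, if_neg fun h3 => h1 (Prod.ext h3 h2), smul_zero]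
        · rw [smul_zero, smul_zero]

theorem stairMonomial_eq (j : Fin (k !)) :
    stairMonomial 𝕜 k j = smon 𝕜 k 0 k (stair k j) := by
  rw [stairMonomial, smon]
  refine congrArg _ (congrArg _ (funext fun l => ?_))
  rw [zero_add, OPol.X_val]

theorem stairDeg_eq (j : Fin (k !)) :
    stairDeg k j = (∑ l, (stair k j l : ℕ)) • ((2, 1) : Bideg) := by
  rw [stairDeg]
  refine Prod.ext ?_ ?_
  · simp [mul_comm]
  · simp

/-- The coefficient functionals of the staircase monomials, realised in the odd nilHecke algebra. -/
theorem exists_stairMonomial_coeff (𝕜 : Type*) [CommRing 𝕜] (k : ℕ) : ∃ y : Fin (k !) → ONH 𝕜 k,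
    (∀ j, y j ∈ ONHComp 𝕜 k (-stairDeg k j)) ∧ (∀ j, IsVac 𝕜 k 0 (y j)) ∧
    (∑ j, OPol.toONH 𝕜 k (stairMonomial 𝕜 k j) * y j = 1) ∧
    (∀ i j, y i • stairMonomial 𝕜 k j = if i = j then 1 else 0) := by
  obtain ⟨y, y1, y2, y3, y4⟩ := exists_stair_coeff (𝕜 := 𝕜) (k := k) (i := 0) (m := k) (by omega)
  refine ⟨fun j => y (stair k j), fun j => ?_, fun j => y2 _, ?_, fun i j => ?_⟩
  · rw [stairDeg_eq]
    exact y1 _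
  · rw [← y3, ← (stair k).sum_comp]
    simp only [stairMonomial_eq]
  · have := y4 (stair k i) (stair k j) 1 (isVac_one 0)
    rw [mul_one, ← stairMonomial_eq, if_congr (stair k).injective.eq_iff rfl rfl] at this
    exact this

/-- A choice of coefficient functionals of the staircase monomials. -/
def stairCoeff (𝕜 : Type*) [CommRing 𝕜] (k : ℕ) : Fin (k !) → ONH 𝕜 k :=
  (exists_stairMonomial_coeff 𝕜 k).choose

theorem stairCoeff_mem (j : Fin (k !)) : stairCoeff 𝕜 k j ∈ ONHComp 𝕜 k (-stairDeg k j) :=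
  (exists_stairMonomial_coeff 𝕜 k).choose_spec.1 j

theorem stairCoeff_isVac (j : Fin (k !)) : IsVac 𝕜 k 0 (stairCoeff 𝕜 k j) :=
  (exists_stairMonomial_coeff 𝕜 k).choose_spec.2.1 j

theorem sum_stairCoeff :
    ∑ j, OPol.toONH 𝕜 k (stairMonomial 𝕜 k j) * stairCoeff 𝕜 k j = 1 :=
  (exists_stairMonomial_coeff 𝕜 k).choose_spec.2.2.1

theorem stairCoeff_smul (i j : Fin (k !)) :
    stairCoeff 𝕜 k i • stairMonomial 𝕜 k j = if i = j then 1 else 0 :=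
  (exists_stairMonomial_coeff 𝕜 k).choose_spec.2.2.2 i j

theorem stairMonomial_mem (j : Fin (k !)) :
    stairMonomial 𝕜 k j ∈ OPolComp 𝕜 k (stairDeg k j) := by
  rw [stairMonomial_eq, stairDeg_eq]
  have main : ∀ (m i : ℕ) (a : Staircase m),
      smon 𝕜 k i m a ∈ OPolComp 𝕜 k ((∑ l, (a l : ℕ)) • ((2, 1) : Bideg)) := by
    intro m
    induction m with
    | zero =>
      intro i a
      simp only [Finset.univ_eq_empty, Finset.sum_empty, zero_smul, smon, List.ofFn_zero,
        List.prod_nil]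
      exact presComp_one _
    | succ m ih =>
      intro i a
      obtain ⟨p, rfl⟩ := (stairCons m).surjective a
      rw [smon_cons, Fin.sum_univ_succ, add_smul]
      exact presComp_mul _ (X_pow_mem i _) (ih _ _)
  exact main k 0 _

end StairBasis


/-! ### Complete symmetric polynomials and the automorphism `θ` -/

section HSeries

variable {R : Type*} [Ring R]

theorem hList_map {S : Type*} [Ring S] (f : R →+* S) (l : List R) (m : ℕ) :
    f (hList l m) = hList (l.map f) m := by
  induction l generalizing m with
  | nil => rw [List.map_nil, hList, hList]; split_ifs <;> simp
  | cons y l ih => simp [hList, ih]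

theorem hList_zero (l : List R) : hList l 0 = 1 := by
  induction l with
  | nil => simp [hList]
  | cons y l ih => simp [hList, ih]

theorem geom_mul (a : R) :
    (1 - PowerSeries.C a * PowerSeries.X) * PowerSeries.mk (fun n => a ^ n) = 1 := by
  ext n
  cases n with
  | zero => simp [sub_mul, mul_assoc]
  | succ n =>
    rw [sub_mul, one_mul, mul_assoc, PowerSeries.X_mul, map_sub, PowerSeries.coeff_C_mul,
      PowerSeries.coeff_succ_mul_X, PowerSeries.coeff_mk, PowerSeries.coeff_mk, pow_succ',
      sub_self, PowerSeries.coeff_one, if_neg (Nat.succ_ne_zero n)]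

theorem hList_series_cons (a : R) (l : List R) :
    PowerSeries.mk (hList (a :: l))
      = PowerSeries.mk (fun n => a ^ n) * PowerSeries.mk (hList l) := by
  ext n
  simp [PowerSeries.coeff_mul, hList]

/-- A geometric series is a polynomial multiple of the series of complete symmetric expressions in
a list of elements that ends in the given one. -/
theorem exists_mul_hList_series (l : List R) (y : R) : ∃ G : PowerSeries R,
    (∀ j, l.length < j → PowerSeries.coeff j G = 0) ∧ PowerSeries.coeff 0 G = 1 ∧
    G * PowerSeries.mk (hList (l ++ [y])) = PowerSeries.mk (fun n => y ^ n) := by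
  induction l with
  | nil =>
    refine ⟨1, fun j hj => ?_, by simp, ?_⟩
    · rw [PowerSeries.coeff_one, if_neg]
      rintro rfl
      simp at hj
    · rw [one_mul, List.nil_append, hList_series_cons]
      have : PowerSeries.mk (hList ([] : List R)) = 1 := by
        ext n
        simp [hList, PowerSeries.coeff_one]
      rw [this, mul_one]
  | cons a l ih =>
    obtain ⟨G, h1, h2, h3⟩ := ih
    -- The series of a list is the product of the geometric series of its entries, in order. The new
    -- factor cancels the first of them, and `G` cancels the others except the last.
    refine ⟨G * (1 - PowerSeries.C a * PowerSeries.X), fun j hj => ?_, ?_, ?_⟩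
    · rw [List.length_cons] at hj
      obtain ⟨j, rfl⟩ : ∃ i, j = i + 1 := ⟨j - 1, by omega⟩
      rw [mul_sub, mul_one, ← mul_assoc, map_sub, PowerSeries.coeff_succ_mul_X,
        PowerSeries.coeff_mul_C, h1 _ (by omega), h1 _ (by omega), zero_mul, sub_zero]
    · rw [mul_sub, mul_one, ← mul_assoc, map_sub, PowerSeries.coeff_zero_mul_X, sub_zero, h2]
    · rw [List.cons_append, hList_series_cons, mul_assoc, ← mul_assoc (1 - _), geom_mul, one_mul,
        h3]

end HSeries

section Theta

variable {𝕜 : Type*} [CommRing 𝕜] {k : ℕ}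

theorem theta_x (i : Fin k) :
    theta 𝕜 k (OPol.x 𝕜 i) = (-1 : 𝕜) ^ (k - 1) • OPol.x 𝕜 (Fin.rev i) := by
  rw [theta, OPol.lift_x, Algebra.smul_def, map_pow, map_neg, map_one]

theorem theta_theta (f : OPol 𝕜 k) : theta 𝕜 k (theta 𝕜 k f) = f := by
  refine OPol.mem_of_mul (N := LinearMap.eqLocus ((theta 𝕜 k).comp (theta 𝕜 k)).toLinearMap
    LinearMap.id) ?_ ?_ f
  · simp
  · intro i f hf
    simp only [LinearMap.mem_eqLocus, AlgHom.toLinearMap_apply, AlgHom.comp_apply,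
      LinearMap.id_apply] at hf ⊢
    rw [map_mul, map_mul, hf, theta_x, map_smul, theta_x, Fin.rev_rev, smul_smul, ← mul_pow,
      neg_mul_neg, one_mul, one_pow, one_smul]

theorem theta_mem {g : Bideg} {f : OPol 𝕜 k} (hf : f ∈ OPolComp 𝕜 k g) :
    theta 𝕜 k f ∈ OPolComp 𝕜 k g := by
  refine presComp_induction (N := (OPolComp 𝕜 k g).comap (theta 𝕜 k).toLinearMap) ?_ hf
  rintro l rfl
  rw [Submodule.mem_comap, AlgHom.toLinearMap_apply]
  clear hf
  induction l with
  | nil =>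
    simp only [List.map_nil, List.prod_nil, List.sum_nil, map_one]
    exact presComp_one _
  | cons i l ih =>
    simp only [List.map_cons, List.prod_cons, List.sum_cons, map_mul]
    refine presComp_mul _ ?_ ih
    have := theta_x (𝕜 := 𝕜) i
    rw [OPol.x] at this
    rw [this]
    exact Submodule.smul_mem _ _ (OPol.x_mem _)

theorem rev_swap (i : Fin (k - 1)) (j : Fin k) :
    Fin.rev (Equiv.swap (lo (Fin.rev i)) (hi (Fin.rev i)) j)
      = Equiv.swap (lo i) (hi i) (Fin.rev j) := by
  rw [Fin.ext_iff, Fin.val_rev, swap_val, swap_val, Fin.val_rev, Fin.val_rev]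
  split_ifs <;> omega

/-- Reversing the variables permutes the divided differences up to a common sign; hence `θ`
preserves their common kernel. -/
theorem d_theta (i : Fin (k - 1)) (f : OPol 𝕜 k) :
    OPol.d i (theta 𝕜 k f) = (-1 : 𝕜) ^ (k - 1) • theta 𝕜 k (OPol.d (Fin.rev i) f) := by
  refine OPol.mem_of_mul (N := LinearMap.eqLocus ((OPol.d i).comp (theta 𝕜 k).toLinearMap)
    ((-1 : 𝕜) ^ (k - 1) • (theta 𝕜 k).toLinearMap.comp (OPol.d (Fin.rev i)))) ?_ ?_ f
  · simp [OPol.d_one]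
  · intro j f hf
    simp only [LinearMap.mem_eqLocus, AlgHom.toLinearMap_apply, LinearMap.comp_apply,
      LinearMap.smul_apply] at hf ⊢
    have e : (Fin.rev j = lo i ∨ Fin.rev j = hi i)
        ↔ (j = lo (Fin.rev i) ∨ j = hi (Fin.rev i)) := by
      rw [near_iff, near_iff, Fin.val_rev, Fin.val_rev]
      omega
    rw [map_mul, theta_x, smul_mul_assoc, map_smul, OPol.d_x_mul, OPol.d_x_mul, hf, map_sub,
      map_mul, theta_x, rev_swap, if_congr e rfl rfl, mul_smul_comm, smul_mul_assoc]
    congr 2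
    split_ifs <;> simp

theorem theta_isVac {f : OPol 𝕜 k} (hf : IsVac 𝕜 k 0 f) : IsVac 𝕜 k 0 (theta 𝕜 k f) := by
  rw [← mem_OSym_iff] at hf ⊢
  intro i
  rw [d_theta, hf, map_zero, smul_zero]

theorem theta_xt (i : Fin k) : theta 𝕜 k (OPol.xt 𝕜 i) = OPol.xt 𝕜 (Fin.rev i) := by
  have h1 : ∀ j : Fin k, OPol.xt 𝕜 j = (-1 : 𝕜) ^ (j : ℕ) • OPol.x 𝕜 j := fun j => by
    rw [OPol.xt, Algebra.smul_def, map_pow, map_neg, map_one]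
  rw [h1, h1, map_smul, theta_x, smul_smul, ← pow_add, Fin.val_rev]
  congr 1
  have := i.2
  rw [show (i : ℕ) + (k - 1) = (k - (i + 1)) + 2 * i by omega, pow_add, pow_mul]
  simp

/-- This is the reason for `θ`. It reverses the ordered product, so that `x_1` becomes the last
letter; the other letters can then be stripped off from the left, which leaves the symmetric factor
on the right. -/
theorem theta_h (m : ℕ) :
    theta 𝕜 k (OPol.h 𝕜 k m) = hList (List.ofFn (OPol.xt 𝕜 (k := k))).reverse m := by
  rw [OPol.h, sum_ofFn_eq_hList]
  have := hList_map (theta 𝕜 k).toRingHom (List.ofFn (OPol.xt 𝕜 (k := k))) m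
  refine this.trans ?_
  congr 1
  refine List.ext_getElem (by simp) fun n h1 h2 => ?_
  have h3 : n < k := by simpa using h1
  rw [List.getElem_map, List.getElem_ofFn, List.getElem_reverse, List.getElem_ofFn]
  refine (theta_xt _).trans (congrArg _ (Fin.ext ?_))
  rw [Fin.val_rev]
  simp only [List.length_ofFn]
  omega

/-- The powers of the first variable in terms of complete symmetric polynomials. -/
theorem exists_pow_eq_sum (𝕜 : Type*) [CommRing 𝕜] (k : ℕ) (hk : 0 < k) : ∃ G : ℕ → OPol 𝕜 k,
    (∀ p, k ≤ p → G p = 0) ∧ (∀ l, OPol.X 𝕜 k 0 ^ l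
      = ∑ p ∈ Finset.HasAntidiagonal.antidiagonal l, G p.1 * theta 𝕜 k (OPol.h 𝕜 k p.2)) := by
  obtain ⟨k, rfl⟩ : ∃ i, k = i + 1 := ⟨k - 1, by omega⟩
  -- The list consists of the other variables; its length is one less than their total number, which
  -- is why the coefficients `G p` vanish from `p = k` on.
  obtain ⟨G, h1, -, h3⟩ := exists_mul_hList_series
    (List.ofFn fun i : Fin k => OPol.xt 𝕜 i.succ).reverse (OPol.xt 𝕜 (0 : Fin (k + 1)))
  refine ⟨fun p => PowerSeries.coeff p G, fun p hp => h1 p (by simpa using hp), fun l => ?_⟩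
  have h4 := congrArg (PowerSeries.coeff l) h3
  rw [PowerSeries.coeff_mul, PowerSeries.coeff_mk] at h4
  have h5 : OPol.X 𝕜 (k + 1) 0 = OPol.xt 𝕜 (0 : Fin (k + 1)) := by
    simp [OPol.xt, OPol.X]
  rw [h5, ← h4]
  refine Finset.sum_congr rfl fun p _ => ?_
  rw [PowerSeries.coeff_mk, theta_h, List.ofFn_succ, List.reverse_cons]

/-- The coefficients of the powers of the first variable with respect to the complete symmetric
polynomials. -/
def gPol (𝕜 : Type*) [CommRing 𝕜] (k : ℕ) : ℕ → OPol 𝕜 k :=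
  if hk : 0 < k then (exists_pow_eq_sum 𝕜 k hk).choose else 0

theorem gPol_of_le {p : ℕ} (h : k ≤ p) : gPol 𝕜 k p = 0 := by
  unfold gPol
  split_ifs with hk
  · exact (exists_pow_eq_sum 𝕜 k hk).choose_spec.1 p h
  · rfl

theorem X_pow_eq_sum (hk : 0 < k) (l : ℕ) : OPol.X 𝕜 k 0 ^ l
    = ∑ p ∈ Finset.HasAntidiagonal.antidiagonal l,
      gPol 𝕜 k p.1 * theta 𝕜 k (OPol.h 𝕜 k p.2) := by
  rw [gPol, dif_pos hk]
  exact (exists_pow_eq_sum 𝕜 k hk).choose_spec.2 l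

theorem h_zero : OPol.h 𝕜 k 0 = 1 := by
  rw [OPol.h, sum_ofFn_eq_hList, hList_zero]

theorem h_isVac (m : ℕ) : IsVac 𝕜 k 0 (OPol.h 𝕜 k m) :=
  mem_OSym_iff.mp (OPol.h_mem m)

/-- Since `h_0 = 1`, the polynomial `g_j` equals `x_1^j` minus earlier `g_p` times odd symmetric
polynomials. The chain is linear over the latter and kills the earlier terms by induction, so it
cannot tell `g_j` from `x_1^j`. -/
theorem chain_gPol {m : ℕ} (h : m + 1 = k) (j s : ℕ) (hs : s + j ≤ m) :
    ONH.chain 𝕜 k 0 m • (OPol.X 𝕜 k 0 ^ s * gPol 𝕜 k j)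
      = if s + j = m then chainVal 𝕜 k 0 m m else 0 := by
  induction j using Nat.strong_induction_on with
  | _ j ih =>
    have e := X_pow_eq_sum (𝕜 := 𝕜) (k := k) (by omega) j
    rw [Finset.Nat.sum_antidiagonal_eq_sum_range_succ
      (fun a b => gPol 𝕜 k a * theta 𝕜 k (OPol.h 𝕜 k b)), Finset.sum_range_succ, Nat.sub_self,
      h_zero, map_one, mul_one] at e
    rw [← sub_eq_iff_eq_add'.mpr e, mul_sub, ← pow_add, smul_sub, Finset.mul_sum,
      Finset.smul_sum]
    rw [Finset.sum_eq_zero, sub_zero]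
    · split_ifs with h1
      · rw [h1]; rfl
      · exact chainVal_of_lt (by omega) (by omega)
    · intro p hp
      rw [Finset.mem_range] at hp
      rw [← mul_assoc, (theta_isVac (h_isVac _)).chain_smul_mul, ih p hp (by omega),
        if_neg (by omega), zero_mul]

/-- The polynomials `gPol` are linearly independent over the vectors killed by all `τ_l`. -/
theorem eq_zero_of_sum_gPol {V : Type*} [AddCommGroup V] [Module (ONH 𝕜 k) V] {w : ℕ → V}
    (hw : ∀ j, IsVac 𝕜 k 0 (w j))
    (h0 : ∑ j ∈ Finset.range k, OPol.toONH 𝕜 k (gPol 𝕜 k j) • w j = 0) (j : ℕ) (hj : j < k) :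
    w j = 0 := by
  obtain ⟨m, rfl⟩ : ∃ m, k = m + 1 := ⟨k - 1, by omega⟩
  obtain ⟨c, hc⟩ := chainVal_self (𝕜 := 𝕜) (k := m + 1) (i := 0) (m := m) (by omega)
  suffices h : ∀ s ≤ m, w (m - s) = 0 by
    have := h (m - j) (by omega)
    rwa [show m - (m - j) = j by omega] at this
  intro s
  induction s using Nat.strong_induction_on with
  | _ s ih =>
    intro hs
    -- After applying `chain x_1^s`, the terms with `j < m - s` vanish by `chain_gPol` and those
    -- with `j > m - s` by induction. The remaining term is `± w (m - s)`.
    have e := congrArg (fun v => ONH.chain 𝕜 (m + 1) 0 m • ONH.X 𝕜 (m + 1) 0 ^ s • v) h0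
    simp only [smul_zero, Finset.smul_sum] at e
    rw [Finset.sum_eq_single (m - s)] at e
    · rw [← OPol.toONH_X, ← map_pow, ← mul_smul (OPol.toONH 𝕜 (m + 1) _), ← map_mul,
        (hw _).chain_smul_toONH, chain_gPol rfl _ _ (by omega), if_pos (by omega), hc] at e
      rcases Int.units_eq_one_or c with rfl | rfl
      · simpa using e
      · rw [Units.neg_smul, one_smul, map_neg, map_one, neg_smul, one_smul, neg_eq_zero] at e
        exact e
    · intro j hj1 hj2
      rw [Finset.mem_range] at hj1
      by_cases h1 : m - s < j
      · have := ih (m - j) (by omega) (by omega)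
        rw [show m - (m - j) = j by omega] at this
        rw [this, smul_zero, smul_zero, smul_zero]
      · rw [← OPol.toONH_X, ← map_pow, ← mul_smul (OPol.toONH 𝕜 (m + 1) _), ← map_mul,
          (hw _).chain_smul_toONH, chain_gPol rfl _ _ (by omega), if_neg (by omega), map_zero,
          zero_smul]
    · intro h1
      exact absurd (Finset.mem_range.mpr (by omega)) h1

/-- Rewriting the polynomial `a^n(x_1)` in terms of the elements `h'_m`. -/
theorem sum_pow_pairing {W : Type*} [AddCommGroup W] {n : ℕ} (hk : 0 < k)
    (β : OPol 𝕜 k →+ ℕ → W) :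
    ∑ l ∈ Finset.range (n + 1), (-1 : ℤ) ^ l • β (OPol.X 𝕜 k 0 ^ l) (n - l)
      = (-1 : ℤ) ^ n • ∑ p ∈ Finset.range (n + 1), ∑ r ∈ Finset.range (n - p + 1),
        (-1 : ℤ) ^ r • β (gPol 𝕜 k p * theta 𝕜 k (OPol.h 𝕜 k (n - p - r))) r := by
  simp only [X_pow_eq_sum hk, map_sum, Finset.sum_apply, Finset.smul_sum]
  rw [Finset.sum_sigma', Finset.sum_sigma']
  -- The new index is `r = n - l`, and `(-1)^l = (-1)^n (-1)^r`. The pairing `β` is left abstract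
  -- because the identity is needed both in `OPol_k ⊗ M_k^n` and for vacuum vectors.
  refine Finset.sum_bij' (fun x _ => ⟨x.2.1, n - x.1⟩)
    (fun x _ => ⟨n - x.2, (x.1, n - x.1 - x.2)⟩) ?_ ?_ ?_ ?_ ?_
  · rintro ⟨l, ⟨p, q⟩⟩ hx
    simp only [Finset.mem_sigma, Finset.HasAntidiagonal.mem_antidiagonal, Finset.mem_range] at hx ⊢
    omega
  · rintro ⟨p, r⟩ hx
    simp only [Finset.mem_sigma, Finset.HasAntidiagonal.mem_antidiagonal, Finset.mem_range] at hx ⊢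
    omega
  · rintro ⟨l, ⟨p, q⟩⟩ hx
    simp only [Finset.mem_sigma, Finset.HasAntidiagonal.mem_antidiagonal, Finset.mem_range] at hx
    obtain ⟨h1, rfl⟩ := hx
    have e1 : n - (n - (p + q)) = p + q := by omega
    have e2 : n - p - (n - (p + q)) = q := by omega
    simp [e1, e2]
  · rintro ⟨p, r⟩ hx
    simp only [Finset.mem_sigma, Finset.mem_range] at hx
    have e1 : n - (n - r) = r := by omega
    simp [e1]
  · rintro ⟨l, ⟨p, q⟩⟩ hx
    simp only [Finset.mem_sigma, Finset.HasAntidiagonal.mem_antidiagonal, Finset.mem_range] at hx ⊢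
    obtain ⟨h1, rfl⟩ := hx
    have e2 : n - p - (n - (p + q)) = q := by omega
    rw [e2, smul_smul, ← pow_add]
    congr 1
    rw [show n + (n - (p + q)) = p + q + 2 * (n - (p + q)) by omega, pow_add _ (p + q), pow_mul]
    simp

end Theta


/-! ### The module `OPol_k ⊗ M_k^n` -/

theorem map_intUnits_smul {F X Y : Type*} [AddCommGroup X] [AddCommGroup Y] [FunLike F X Y]
    [AddMonoidHomClass F X Y] (f : F) (c : ℤˣ) (x : X) : f (c • x) = c • f x := by
  rcases Int.units_eq_one_or c with rfl | rfl
  · rw [one_smul, one_smul]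
  · rw [Units.neg_smul, one_smul, map_neg, Units.neg_smul, one_smul]

section Instances

variable {𝕜 : Type*} [CommRing 𝕜] {k n : ℕ}

scoped instance : Ring (M 𝕜 k n) := inferInstance

scoped instance : Semiring (M 𝕜 k n) := inferInstance

scoped instance : AddCommGroup (M 𝕜 k n) := inferInstance

scoped instance : AddCommMonoid (M 𝕜 k n) := inferInstance

scoped instance : AddCommGroup (T 𝕜 k n) := inferInstance

scoped instance : AddCommMonoid (T 𝕜 k n) := inferInstance

scoped instance : Zero (T 𝕜 k n) := inferInstance

scoped instance : Ring (EndT 𝕜 k n) := inferInstance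

scoped instance : Semiring (EndT 𝕜 k n) := inferInstance

scoped instance : AddCommMonoid (EndT 𝕜 k n) := inferInstance

scoped instance : Algebra 𝕜 (EndT 𝕜 k n) := inferInstance

end Instances

section TModule

variable {𝕜 : Type*} [CommRing 𝕜] {k n : ℕ}

/-- The class of `g ⊗ 1`. -/
def M.left (𝕜 : Type*) [CommRing 𝕜] (k n : ℕ) : OSym 𝕜 k →ₐ[𝕜] M 𝕜 k n :=
  (M.mk 𝕜 k n).comp (GradedTensorProduct.includeLeft (OSymComp 𝕜 k) (AComp 𝕜 n))

/-- The class of `1 ⊗ a`. -/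
def M.right (𝕜 : Type*) [CommRing 𝕜] (k n : ℕ) : A 𝕜 n →ₐ[𝕜] M 𝕜 k n :=
  (M.mk 𝕜 k n).comp (GradedTensorProduct.includeRight (OSymComp 𝕜 k) (AComp 𝕜 n))

theorem M.left_apply (g : OSym 𝕜 k) : M.left 𝕜 k n g = M.mk 𝕜 k n (g ᵍ⊗ₜ[𝕜] 1) := rfl

theorem M.right_apply (a : A 𝕜 n) : M.right 𝕜 k n a = M.mk 𝕜 k n (1 ᵍ⊗ₜ[𝕜] a) := rfl

theorem M.left_mul_right (g : OSym 𝕜 k) (a : A 𝕜 n) :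
    M.left 𝕜 k n g * M.right 𝕜 k n a = M.mk 𝕜 k n (g ᵍ⊗ₜ[𝕜] a) := by
  rw [M.left_apply, M.right_apply, ← map_mul, GradedTensorProduct.tmul_one_mul_one_tmul]

theorem M.right_mul_left {p q : Bideg} {a : A 𝕜 n} (ha : a ∈ AComp 𝕜 n p) {g : OSym 𝕜 k}
    (hg : g ∈ OSymComp 𝕜 k q) : M.right 𝕜 k n a * M.left 𝕜 k n g
      = (-1 : ℤˣ) ^ (p * q) • (M.left 𝕜 k n g * M.right 𝕜 k n a) := by
  have := GradedTensorProduct.tmul_coe_mul_coe_tmul (R := 𝕜) (OSymComp 𝕜 k) (AComp 𝕜 n) 1 ⟨a, ha⟩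
    ⟨g, hg⟩ 1
  rw [mul_one, one_mul] at this
  rw [M.left_mul_right, M.right_apply, M.left_apply, ← map_mul, this, map_intUnits_smul]

theorem M.induction {p : M 𝕜 k n → Prop}
    (h : ∀ g a, p (M.left 𝕜 k n g * M.right 𝕜 k n a)) (hadd : ∀ x y, p x → p y → p (x + y))
    (m : M 𝕜 k n) : p m := by
  obtain ⟨z, rfl⟩ := QuotBy.mk_surj (𝕜 := 𝕜) (GrRel 𝕜 k n) m
  induction z using TensorProduct.induction_on with
  | zero =>
    have := h 0 0
    rw [map_zero, zero_mul] at this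
    exact (congrArg p (map_zero (M.mk 𝕜 k n))).mpr this
  | tmul g a =>
    have := h g a
    rwa [M.left_mul_right] at this
  | add x y hx hy =>
    exact (congrArg p (map_add (M.mk 𝕜 k n) x y)).mpr (hadd _ _ hx hy)

theorem T.tmul_add (f : OPol 𝕜 k) (m m' : M 𝕜 k n) :
    T.tmul f (m + m') = T.tmul f m + T.tmul f m' := by
  rw [T.tmul, TensorProduct.add_tmul]; rfl

theorem T.add_tmul (f f' : OPol 𝕜 k) (m : M 𝕜 k n) :
    T.tmul (f + f') m = T.tmul f m + T.tmul f' m := by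
  rw [T.tmul, TensorProduct.tmul_add]; rfl

/-- The tensor `f ⊗ m` as a bilinear function. -/
def T.tmulₗ (𝕜 : Type*) [CommRing 𝕜] (k n : ℕ) : OPol 𝕜 k →ₗ[𝕜] M 𝕜 k n →ₗ[𝕜] T 𝕜 k n :=
  LinearMap.mk₂ 𝕜 T.tmul T.add_tmul
    (fun c f m => by rw [T.tmul, TensorProduct.tmul_smul]; rfl)
    T.tmul_add
    (fun c f m => by rw [T.tmul, ← TensorProduct.smul_tmul']; rfl)

theorem T.smul_tmul (c : 𝕜) (f : OPol 𝕜 k) (m : M 𝕜 k n) :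
    T.tmul (c • f) m = c • T.tmul f m :=
  (T.tmulₗ 𝕜 k n).map_smul₂ c f m

theorem T.tmul_smul (c : 𝕜) (f : OPol 𝕜 k) (m : M 𝕜 k n) :
    T.tmul f (c • m) = c • T.tmul f m :=
  (T.tmulₗ 𝕜 k n f).map_smul c m

theorem T.zero_tmul (m : M 𝕜 k n) : T.tmul (0 : OPol 𝕜 k) m = 0 :=
  (T.tmulₗ 𝕜 k n).map_zero₂ m

theorem T.tmul_zero (f : OPol 𝕜 k) : T.tmul f (0 : M 𝕜 k n) = 0 :=
  (T.tmulₗ 𝕜 k n f).map_zero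

theorem T.units_smul_tmul (c : ℤˣ) (f : OPol 𝕜 k) (m : M 𝕜 k n) :
    T.tmul (c • f) m = c • T.tmul f m :=
  map_intUnits_smul ((T.tmulₗ 𝕜 k n).flip m) c f

theorem T.tmul_units_smul (c : ℤˣ) (f : OPol 𝕜 k) (m : M 𝕜 k n) :
    T.tmul f (c • m) = c • T.tmul f m :=
  map_intUnits_smul (T.tmulₗ 𝕜 k n f) c m

theorem T.op_smul_tmul (f : OPol 𝕜 k) (m m' : M 𝕜 k n) :
    MulOpposite.op m' • T.tmul f m = T.tmul f (m * m') := rfl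

theorem T.tmul_mul_theta (f : OPol 𝕜 k) (g : OSym 𝕜 k) (m : M 𝕜 k n) :
    T.tmul (f * theta 𝕜 k g) m = T.tmul f (M.left 𝕜 k n g * m) :=
  (Submodule.Quotient.eq _).mpr (Submodule.subset_span ⟨f, g, m, rfl⟩)

theorem T.induction {p : T 𝕜 k n → Prop} (h : ∀ f m, p (T.tmul f m))
    (hadd : ∀ x y, p x → p y → p (x + y)) (t : T 𝕜 k n) : p t := by
  obtain ⟨z, rfl⟩ := Submodule.Quotient.mk_surjective _ t
  induction z using TensorProduct.induction_on with
  | zero =>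
    have := h 0 0
    rwa [T.tmul_zero] at this
  | tmul m f => exact h f m
  | add x y hx hy => exact hadd _ _ hx hy

/-- `balanced` is a span over the opposite of `M_k^n`, while `F` is linear only over the base ring.
The induction therefore carries every multiple `r • z`; the generators are stable under this action.
-/
theorem balanced_le_of_map {N : Type*} [AddCommGroup N] [Module 𝕜 N]
    (F : M 𝕜 k n ⊗[𝕜] OPol 𝕜 k →ₗ[𝕜] N)
    (hF : ∀ (f : OPol 𝕜 k) (g : OSym 𝕜 k) (m : M 𝕜 k n),
      F (m ⊗ₜ[𝕜] (f * theta 𝕜 k g)) = F ((M.left 𝕜 k n g * m) ⊗ₜ[𝕜] f))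
    {z : M 𝕜 k n ⊗[𝕜] OPol 𝕜 k} (hz : z ∈ balanced 𝕜 k n) : F z = 0 := by
  suffices h : ∀ r : (M 𝕜 k n)ᵐᵒᵖ, F (r • z) = 0 by simpa using h 1
  induction hz using Submodule.span_induction with
  | mem x hx =>
    obtain ⟨f, g, m, rfl⟩ := hx
    intro r
    obtain ⟨m', rfl⟩ := MulOpposite.op_surjective r
    rw [smul_sub, TensorProduct.smul_tmul', TensorProduct.smul_tmul', map_sub,
      op_smul_eq_mul, op_smul_eq_mul, hF, mul_assoc, M.left_apply, sub_self]
  | zero => intro r; rw [smul_zero, map_zero]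
  | add x y _ _ h1 h2 => intro r; rw [smul_add, map_add, h1, h2, add_zero]
  | smul c x _ h1 => intro r; rw [smul_smul, h1]

/-- The linear map on the balanced tensor product induced by a balanced bilinear function. -/
def T.lift {N : Type*} [AddCommGroup N] [Module 𝕜 N] (F : M 𝕜 k n ⊗[𝕜] OPol 𝕜 k →ₗ[𝕜] N)
    (hF : ∀ (f : OPol 𝕜 k) (g : OSym 𝕜 k) (m : M 𝕜 k n),
      F (m ⊗ₜ[𝕜] (f * theta 𝕜 k g)) = F ((M.left 𝕜 k n g * m) ⊗ₜ[𝕜] f)) : T 𝕜 k n →ₗ[𝕜] N :=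
  (((balanced 𝕜 k n).restrictScalars 𝕜).liftQ F fun _ hz => balanced_le_of_map F hF hz).comp
    (Submodule.Quotient.restrictScalarsEquiv 𝕜 (balanced 𝕜 k n)).symm.toLinearMap

/-- Endomorphisms of the balanced tensor product acting on both factors. -/
def T.map (α : OPol 𝕜 k →ₗ[𝕜] OPol 𝕜 k) (b : M 𝕜 k n)
    (h : ∀ (f : OPol 𝕜 k) (g : OSym 𝕜 k) (m : M 𝕜 k n),
      T.tmul (α (f * theta 𝕜 k g)) (b * m) = T.tmul (α f) (b * (M.left 𝕜 k n g * m))) :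
    EndT 𝕜 k n :=
  Submodule.mapQ _ _ (TensorProduct.AlgebraTensorModule.map
    ({ toFun := fun m => b * m
       map_add' := mul_add b
       map_smul' := fun r m => by
        rw [RingHom.id_apply, ← MulOpposite.op_unop r, op_smul_eq_mul,
          op_smul_eq_mul, mul_assoc] } : M 𝕜 k n →ₗ[(M 𝕜 k n)ᵐᵒᵖ] M 𝕜 k n) α) (by
    rw [balanced, Submodule.span_le]
    rintro _ ⟨f, g, m, rfl⟩
    rw [SetLike.mem_coe, Submodule.mem_comap, map_sub]
    exact (Submodule.Quotient.eq _).mp (h f g m))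

theorem T.map_tmul (α : OPol 𝕜 k →ₗ[𝕜] OPol 𝕜 k) (b : M 𝕜 k n)
    (h : ∀ (f : OPol 𝕜 k) (g : OSym 𝕜 k) (m : M 𝕜 k n),
      T.tmul (α (f * theta 𝕜 k g)) (b * m) = T.tmul (α f) (b * (M.left 𝕜 k n g * m)))
    (f : OPol 𝕜 k) (m : M 𝕜 k n) : T.map α b h (T.tmul f m) = T.tmul (α f) (b * m) := rfl

theorem EndT.smul_apply (c : 𝕜) (E : EndT 𝕜 k n) (t : T 𝕜 k n) : (c • E) t = c • E t := rfl

theorem EndT.mul_apply (E E' : EndT 𝕜 k n) (t : T 𝕜 k n) : (E * E') t = E (E' t) := rfl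

theorem EndT.one_apply (t : T 𝕜 k n) : (1 : EndT 𝕜 k n) t = t := rfl

theorem EndT.units_smul_apply (c : ℤˣ) (E : EndT 𝕜 k n) (t : T 𝕜 k n) :
    (c • E) t = c • E t := by
  rcases Int.units_eq_one_or c with rfl | rfl
  · rw [one_smul, one_smul]
  · rw [Units.neg_smul, one_smul, LinearMap.neg_apply, Units.neg_smul, one_smul]

theorem EndT.ext_tmul {E E' : EndT 𝕜 k n} (h : ∀ f m, E (T.tmul f m) = E' (T.tmul f m)) :
    E = E' := by
  refine LinearMap.ext fun t => ?_
  induction t using T.induction with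
  | h f m => exact h f m
  | hadd x y hx hy => rw [map_add, map_add, hx, hy]

theorem EndT.ext_homogeneous {E E' : EndT 𝕜 k n}
    (h : ∀ q, ∀ f ∈ OPolComp 𝕜 k q, ∀ m, E (T.tmul f m) = E' (T.tmul f m)) : E = E' := by
  classical
  refine EndT.ext_tmul fun f m => ?_
  induction f using DirectSum.Decomposition.inductionOn (OPolComp 𝕜 k) with
  | zero => rw [T.zero_tmul, map_zero, map_zero]
  | homogeneous f => exact h _ _ f.2 m
  | add a b ha hb => rw [T.add_tmul, map_add, map_add, ha, hb]

end TModule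


/-! ### Algebra maps prescribed on homogeneous elements -/

section DecompLift

variable {R B C : Type*} [CommRing R] [Ring B] [Algebra R B] [Ring C] [Algebra R C]
  (ℬ : Bideg → Submodule R B) [GradedAlgebra ℬ]

/-- The linear map with given values on homogeneous elements. -/
def decompLift (ψ : ∀ p, ℬ p →ₗ[R] C) : B →ₗ[R] C :=
  (DirectSum.toModule R Bideg C ψ).comp (DirectSum.decomposeLinearEquiv ℬ).toLinearMap

theorem decompLift_coe (ψ : ∀ p, ℬ p →ₗ[R] C) {p : Bideg} (b : ℬ p) :
    decompLift ℬ ψ b = ψ p b := by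
  rw [decompLift, LinearMap.comp_apply, LinearEquiv.coe_coe, DirectSum.decomposeLinearEquiv_apply,
    DirectSum.decompose_coe, ← DirectSum.lof_eq_of R, DirectSum.toModule_lof]

/-- The algebra map with given values on homogeneous elements. -/
def decompAlgLift (ψ : ∀ p, ℬ p →ₗ[R] C) (h1 : ψ 0 ⟨1, SetLike.GradedOne.one_mem⟩ = 1)
    (hmul : ∀ p q (a : ℬ p) (b : ℬ q),
      ψ (p + q) ⟨a * b, SetLike.GradedMul.mul_mem a.2 b.2⟩ = ψ p a * ψ q b) : B →ₐ[R] C :=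
  AlgHom.ofLinearMap (decompLift ℬ ψ)
    (by
      rw [← h1]
      exact decompLift_coe ℬ ψ (⟨1, SetLike.GradedOne.one_mem⟩ : ℬ 0))
    (by
      intro a b
      induction a using DirectSum.Decomposition.inductionOn ℬ with
      | zero => rw [zero_mul, map_zero, zero_mul]
      | add a a' h h' => rw [add_mul, map_add, h, h', map_add, add_mul]
      | @homogeneous p a =>
        induction b using DirectSum.Decomposition.inductionOn ℬ with
        | zero => rw [mul_zero, map_zero, mul_zero]
        | add b b' h h' => rw [mul_add, map_add, h, h', map_add, mul_add]
        | @homogeneous q b =>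
          rw [decompLift_coe, decompLift_coe, ← hmul]
          exact decompLift_coe ℬ ψ (⟨a * b, SetLike.GradedMul.mul_mem a.2 b.2⟩ : ℬ (p + q)))

theorem decompAlgLift_of_mem (ψ : ∀ p, ℬ p →ₗ[R] C)
    (h1 : ψ 0 ⟨1, SetLike.GradedOne.one_mem⟩ = 1)
    (hmul : ∀ p q (a : ℬ p) (b : ℬ q),
      ψ (p + q) ⟨a * b, SetLike.GradedMul.mul_mem a.2 b.2⟩ = ψ p a * ψ q b)
    {p : Bideg} {b : B} (hb : b ∈ ℬ p) : decompAlgLift ℬ ψ h1 hmul b = ψ p ⟨b, hb⟩ :=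
  decompLift_coe ℬ ψ ⟨b, hb⟩

end DecompLift

/-! ### The action of the odd nilHecke algebra and of the coefficients -/

section Action

variable {𝕜 : Type*} [CommRing 𝕜] {k n : ℕ}

theorem theta_OSym_isVac (g : OSym 𝕜 k) : IsVac 𝕜 k 0 (theta 𝕜 k (g : OPol 𝕜 k)) :=
  theta_isVac (mem_OSym_iff.mp g.2)

theorem polyRep_mul_theta (u : ONH 𝕜 k) (f : OPol 𝕜 k) (g : OSym 𝕜 k) :
    polyRep 𝕜 k u (f * theta 𝕜 k g) = polyRep 𝕜 k u f * theta 𝕜 k g :=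
  (theta_OSym_isVac g).smul_mul u f

/-- The action of an element of the odd nilHecke algebra on the first factor. -/
def actONHEnd (𝕜 : Type*) [CommRing 𝕜] (k n : ℕ) (u : ONH 𝕜 k) : EndT 𝕜 k n :=
  T.map (polyRep 𝕜 k u) 1 fun f g m => by
    rw [polyRep_mul_theta, T.tmul_mul_theta, one_mul, one_mul]

theorem actONHEnd_tmul (u : ONH 𝕜 k) (f : OPol 𝕜 k) (m : M 𝕜 k n) :
    actONHEnd 𝕜 k n u (T.tmul f m) = T.tmul (u • f) m := by
  rw [actONHEnd, T.map_tmul, one_mul, OPol.smul_def]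

theorem actONHEnd_one : actONHEnd 𝕜 k n 1 = 1 :=
  EndT.ext_tmul fun f m => by rw [actONHEnd_tmul, one_smul, EndT.one_apply]

theorem actONHEnd_mul (u v : ONH 𝕜 k) :
    actONHEnd 𝕜 k n (u * v) = actONHEnd 𝕜 k n u * actONHEnd 𝕜 k n v :=
  EndT.ext_tmul fun f m => by
    rw [EndT.mul_apply, actONHEnd_tmul, actONHEnd_tmul, actONHEnd_tmul, mul_smul]

theorem actONHEnd_add (u v : ONH 𝕜 k) :
    actONHEnd 𝕜 k n (u + v) = actONHEnd 𝕜 k n u + actONHEnd 𝕜 k n v :=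
  EndT.ext_tmul fun f m => by
    rw [LinearMap.add_apply, actONHEnd_tmul, actONHEnd_tmul, actONHEnd_tmul, add_smul, T.add_tmul]

theorem actONHEnd_smul (c : 𝕜) (u : ONH 𝕜 k) :
    actONHEnd 𝕜 k n (c • u) = c • actONHEnd 𝕜 k n u :=
  EndT.ext_tmul fun f m => by
    rw [EndT.smul_apply, actONHEnd_tmul, actONHEnd_tmul, Algebra.smul_def,
      mul_smul, OPol.algebraMap_smul, T.smul_tmul]

/-- The action of the odd nilHecke algebra on the first factor. -/
def actONH (𝕜 : Type*) [CommRing 𝕜] (k n : ℕ) : ONH 𝕜 k →ₐ[𝕜] EndT 𝕜 k n :=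
  AlgHom.ofLinearMap (IsLinearMap.mk' (actONHEnd 𝕜 k n) ⟨actONHEnd_add, actONHEnd_smul⟩)
    actONHEnd_one actONHEnd_mul

theorem actONH_tmul (u : ONH 𝕜 k) (f : OPol 𝕜 k) (m : M 𝕜 k n) :
    actONH 𝕜 k n u (T.tmul f m) = T.tmul (u • f) m :=
  actONHEnd_tmul u f m

/-- The automorphism of skew polynomials that multiplies an element by the Koszul sign of its
bidegree and `p`. -/
def twist (𝕜 : Type*) [CommRing 𝕜] (k : ℕ) (p : Bideg) : OPol 𝕜 k →ₐ[𝕜] OPol 𝕜 k :=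
  OPol.lift (fun i => (-1 : ℤˣ) ^ (p * (2, 1)) • OPol.x 𝕜 i) (by
    intro i j h
    rw [smul_mul_smul_comm, smul_mul_smul_comm, ← smul_add, OPol.x_anti h, smul_zero])

theorem twist_x (p : Bideg) (i : Fin k) :
    twist 𝕜 k p (OPol.x 𝕜 i) = (-1 : ℤˣ) ^ (p * (2, 1)) • OPol.x 𝕜 i :=
  OPol.lift_x _ _ _

theorem twist_of_mem (p : Bideg) {q : Bideg} {f : OPol 𝕜 k} (hf : f ∈ OPolComp 𝕜 k q) :
    twist 𝕜 k p f = (-1 : ℤˣ) ^ (p * q) • f := by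
  let N : Submodule 𝕜 (OPol 𝕜 k) := LinearMap.eqLocus (twist 𝕜 k p).toLinearMap
    { toFun := fun f => (-1 : ℤˣ) ^ (p * q) • f
      map_add' := fun f g => smul_add _ _ _
      map_smul' := fun c f => smul_comm _ _ _ }
  refine presComp_induction (N := N) ?_ hf
  rintro l rfl
  change twist 𝕜 k p _ = (-1 : ℤˣ) ^ _ • (_ : OPol 𝕜 k)
  clear hf N
  induction l with
  | nil =>
    simp only [List.map_nil, List.prod_nil, List.sum_nil, map_one, mul_zero, uzpow_zero, one_smul]
  | cons i l ih =>
    simp only [List.map_cons, List.prod_cons, List.sum_cons, map_mul]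
    have := twist_x (𝕜 := 𝕜) p i
    rw [OPol.x] at this
    rw [this, ih, smul_mul_smul_comm, mul_add, uzpow_add]

theorem twist_twist (p : Bideg) (f : OPol 𝕜 k) : twist 𝕜 k p (twist 𝕜 k p f) = f := by
  classical
  induction f using DirectSum.Decomposition.inductionOn (OPolComp 𝕜 k) with
  | zero => rw [map_zero, map_zero]
  | homogeneous f =>
    rw [twist_of_mem p f.2, map_intUnits_smul, twist_of_mem p f.2, smul_smul,
      Int.units_mul_self, one_smul]
  | add a b ha hb => rw [map_add, map_add, ha, hb]

/-- Both sides produce the same Koszul sign: on the left the twist acts on `θ(g)`, which has the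
bidegree of `g`, and on the right `a` passes `g` inside `M_k^n`. -/
theorem tmul_twist_mul_theta {p : Bideg} {a : A 𝕜 n} (ha : a ∈ AComp 𝕜 n p) (f : OPol 𝕜 k)
    (g : OSym 𝕜 k) (m : M 𝕜 k n) :
    T.tmul (twist 𝕜 k p (f * theta 𝕜 k g)) (M.right 𝕜 k n a * m)
      = T.tmul (twist 𝕜 k p f) (M.right 𝕜 k n a * (M.left 𝕜 k n g * m)) := by
  classical
  induction g using DirectSum.Decomposition.inductionOn (OSymComp 𝕜 k) with
  | zero =>
    rw [map_zero, zero_mul, mul_zero, T.tmul_zero, ZeroMemClass.coe_zero, map_zero, mul_zero,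
      map_zero, T.zero_tmul]
  | @homogeneous q g =>
    have hg : theta 𝕜 k ((g : OSym 𝕜 k) : OPol 𝕜 k) ∈ OPolComp 𝕜 k q := theta_mem g.2
    rw [map_mul, twist_of_mem p hg, ← mul_assoc (M.right 𝕜 k n a), M.right_mul_left ha g.2,
      mul_smul_comm, smul_mul_assoc, mul_assoc, T.units_smul_tmul, T.tmul_units_smul,
      T.tmul_mul_theta]
  | add g g' h h' =>
    rw [Subalgebra.coe_add, map_add, mul_add, map_add, T.add_tmul, h, h', map_add, add_mul, mul_add,
      T.tmul_add]

/-- The action of a homogeneous coefficient. -/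
def actAEnd (𝕜 : Type*) [CommRing 𝕜] (k n : ℕ) (p : Bideg) (a : AComp 𝕜 n p) : EndT 𝕜 k n :=
  T.map (twist 𝕜 k p).toLinearMap (M.right 𝕜 k n a) (tmul_twist_mul_theta a.2)

theorem actAEnd_tmul {p : Bideg} (a : AComp 𝕜 n p) (f : OPol 𝕜 k) (m : M 𝕜 k n) :
    actAEnd 𝕜 k n p a (T.tmul f m) = T.tmul (twist 𝕜 k p f) (M.right 𝕜 k n a * m) := rfl

/-- The action of homogeneous coefficients. -/
def actAHom (𝕜 : Type*) [CommRing 𝕜] (k n : ℕ) (p : Bideg) : AComp 𝕜 n p →ₗ[𝕜] EndT 𝕜 k n where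
  toFun a := actAEnd 𝕜 k n p a
  map_add' a b := EndT.ext_tmul fun f m => by
    rw [LinearMap.add_apply, actAEnd_tmul, actAEnd_tmul, actAEnd_tmul, Submodule.coe_add, map_add,
      add_mul, T.tmul_add]
  map_smul' c a := EndT.ext_tmul fun f m => by
    rw [RingHom.id_apply, EndT.smul_apply, actAEnd_tmul, actAEnd_tmul, Submodule.coe_smul,
      map_smul, smul_mul_assoc, T.tmul_smul]

theorem actAHom_tmul {p : Bideg} (a : AComp 𝕜 n p) (f : OPol 𝕜 k) (m : M 𝕜 k n) :
    actAHom 𝕜 k n p a (T.tmul f m) = T.tmul (twist 𝕜 k p f) (M.right 𝕜 k n a * m) := rfl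

theorem actAHom_one : actAHom 𝕜 k n 0 ⟨1, SetLike.GradedOne.one_mem⟩ = 1 :=
  EndT.ext_homogeneous fun q f hf m => by
    rw [actAHom_tmul, twist_of_mem _ hf, zero_mul, uzpow_zero, one_smul, map_one, one_mul,
      EndT.one_apply]

theorem actAHom_mul (p q : Bideg) (a : AComp 𝕜 n p) (b : AComp 𝕜 n q) :
    actAHom 𝕜 k n (p + q) ⟨a * b, SetLike.GradedMul.mul_mem a.2 b.2⟩
      = actAHom 𝕜 k n p a * actAHom 𝕜 k n q b :=
  EndT.ext_homogeneous fun r f hf m => by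
    have e : twist 𝕜 k p (twist 𝕜 k q f) = twist 𝕜 k (p + q) f := by
      rw [twist_of_mem q hf, twist_of_mem (p + q) hf, map_intUnits_smul, twist_of_mem p hf,
        smul_smul, add_mul, uzpow_add, mul_comm]
    have e2 : T.tmul (twist 𝕜 k (p + q) f) (M.right 𝕜 k n (a * b) * m)
        = T.tmul (twist 𝕜 k p (twist 𝕜 k q f)) (M.right 𝕜 k n a * (M.right 𝕜 k n b * m)) := by
      rw [e, map_mul, mul_assoc]
    exact (actAHom_tmul _ f m).trans (e2.trans ((congrArg (actAHom 𝕜 k n p a)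
      (actAHom_tmul b f m)).trans (actAHom_tmul a (twist 𝕜 k q f) _)).symm)

/-- The action of the coefficients. -/
def actA (𝕜 : Type*) [CommRing 𝕜] (k n : ℕ) : A 𝕜 n →ₐ[𝕜] EndT 𝕜 k n :=
  decompAlgLift (AComp 𝕜 n) (actAHom 𝕜 k n) actAHom_one actAHom_mul

theorem actA_tmul {p : Bideg} {a : A 𝕜 n} (ha : a ∈ AComp 𝕜 n p) (f : OPol 𝕜 k)
    (m : M 𝕜 k n) :
    actA 𝕜 k n a (T.tmul f m) = T.tmul (twist 𝕜 k p f) (M.right 𝕜 k n a * m) :=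
  by rw [actA, decompAlgLift_of_mem (AComp 𝕜 n) _ _ _ ha, actAHom_tmul]

theorem actA_tmul_of_mem {p q : Bideg} {a : A 𝕜 n} (ha : a ∈ AComp 𝕜 n p) {f : OPol 𝕜 k}
    (hf : f ∈ OPolComp 𝕜 k q) (m : M 𝕜 k n) : actA 𝕜 k n a (T.tmul f m)
      = (-1 : ℤˣ) ^ (p * q) • T.tmul f (M.right 𝕜 k n a * m) := by
  rw [actA_tmul ha, twist_of_mem _ hf, T.units_smul_tmul]

theorem actA_tmul_one (a : A 𝕜 n) (m : M 𝕜 k n) :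
    actA 𝕜 k n a (T.tmul 1 m) = T.tmul 1 (M.right 𝕜 k n a * m) := by
  classical
  induction a using DirectSum.Decomposition.inductionOn (AComp 𝕜 n) with
  | zero => rw [map_zero, map_zero, zero_mul, T.tmul_zero, LinearMap.zero_apply]
  | homogeneous a => rw [actA_tmul a.2, map_one]
  | add a b ha hb => rw [map_add, LinearMap.add_apply, ha, hb, map_add, add_mul, T.tmul_add]

/-- The Koszul sign of `a` is taken with `f` in one order and with `u • f` in the other; they differ
by the sign of the bidegree of `u`. This is the hypothesis for a map out of the graded tensor
product. -/
theorem actONH_mul_actA {i j : Bideg} (u : ONHComp 𝕜 k i) (a : AComp 𝕜 n j) :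
    actONH 𝕜 k n u * actA 𝕜 k n a = (-1 : ℤˣ) ^ (j * i) • (actA 𝕜 k n a * actONH 𝕜 k n u) :=
  EndT.ext_homogeneous fun q f hf m => by
    have e1 : actONH 𝕜 k n u (actA 𝕜 k n a (T.tmul f m))
        = (-1 : ℤˣ) ^ (j * q) • T.tmul ((u : ONH 𝕜 k) • f) (M.right 𝕜 k n a * m) :=
      (congrArg (actONH 𝕜 k n u) (actA_tmul_of_mem a.2 hf m)).trans
        ((map_intUnits_smul (actONH 𝕜 k n u) ((-1) ^ (j * q)) _).trans
          (congrArg (fun t : T 𝕜 k n => (-1 : ℤˣ) ^ (j * q) • t)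
            (actONH_tmul (u : ONH 𝕜 k) f (M.right 𝕜 k n a * m))))
    have e2 : actA 𝕜 k n a (actONH 𝕜 k n u (T.tmul f m))
        = (-1 : ℤˣ) ^ (j * (i + q)) • T.tmul ((u : ONH 𝕜 k) • f) (M.right 𝕜 k n a * m) :=
      (congrArg (actA 𝕜 k n a) (actONH_tmul _ f m)).trans
        (actA_tmul_of_mem a.2 (OPol.smul_mem u.2 hf) m)
    refine e1.trans (Eq.trans ?_ ((EndT.units_smul_apply _ _ _).trans (congrArg
      (fun t : T 𝕜 k n => (-1 : ℤˣ) ^ (j * i) • t) e2)).symm)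
    rw [smul_smul, mul_add, uzpow_add, ← mul_assoc, Int.units_mul_self, one_mul]

/-- The action of `ONH_k ⊗ A_n`. -/
def actTens (𝕜 : Type*) [CommRing 𝕜] (k n : ℕ) : (ONHComp 𝕜 k ᵍ⊗[𝕜] AComp 𝕜 n) →ₐ[𝕜] EndT 𝕜 k n :=
  GradedTensorProduct.lift _ _ (actONH 𝕜 k n) (actA 𝕜 k n) fun _ _ => actONH_mul_actA

theorem actTens_tmul (u : ONH 𝕜 k) (a : A 𝕜 n) :
    actTens 𝕜 k n (u ᵍ⊗ₜ[𝕜] a) = actONH 𝕜 k n u * actA 𝕜 k n a := rfl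

end Action


/-! ### The cyclotomic relation -/

/-- Moving `X` past `C (n - l)` gives the wrong sign exactly when `n - l` is odd. The discrepancy is
twice `C (n - l) = C (n - l - 1) D` with its monomial, which is the term of index `l + 1` in `2 a
D`. The term of index 0 in `a D` vanishes because `C n * D = 0`. -/
theorem sum_mul_var {R : Type*} [Ring R] {n : ℕ} {X D : R} {C : ℕ → R}
    (hX : ∀ j ≤ n, C j * X = (-1) ^ j * (X * C j))
    (hD : ∀ j ≤ n, C j * D = if Even j ∧ j < n then C (j + 1) else 0) :
    (∑ l ∈ Finset.range (n + 1), (-1) ^ l * (X ^ l * C (n - l))) * X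
      = X * (∑ l ∈ Finset.range (n + 1), (-1) ^ l * (X ^ l * C (n - l)))
        + 2 * ((∑ l ∈ Finset.range (n + 1), (-1) ^ l * (X ^ l * C (n - l))) * D) := by
  have hs : ∀ (y : R) (l : ℕ), Commute y ((-1) ^ l) := fun y l =>
    ((Commute.one_right y).neg_right).pow_right l
  rw [Finset.sum_mul, Finset.mul_sum, Finset.sum_mul]
  have e1 : ∑ l ∈ Finset.range (n + 1), (-1) ^ l * (X ^ l * C (n - l)) * D
      = ∑ l ∈ Finset.range n, (-1) ^ (l + 1) * (if Even (n - (l + 1)) then X ^ (l + 1) * C (n - l)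
        else 0) := by
    rw [Finset.sum_range_succ', Nat.sub_zero, mul_assoc, mul_assoc, hD n le_rfl, if_neg (by omega),
      mul_zero, mul_zero, add_zero]
    refine Finset.sum_congr rfl fun l hl => ?_
    rw [Finset.mem_range] at hl
    rw [mul_assoc, mul_assoc, hD _ (by omega)]
    congr 1
    by_cases h : Even (n - (l + 1))
    · rw [if_pos ⟨h, by omega⟩, if_pos h, show n - (l + 1) + 1 = n - l by omega]
    · rw [if_neg (by tauto), if_neg h, mul_zero]
  have e2 : ∀ l ∈ Finset.range (n + 1), (-1) ^ l * (X ^ l * C (n - l)) * X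
      = (-1) ^ l * ((-1) ^ (n - l) * (X ^ (l + 1) * C (n - l))) := by
    intro l hl
    rw [mul_assoc, mul_assoc, hX _ (Nat.sub_le _ _), ← mul_assoc (X ^ l) ((-1) ^ (n - l)),
      (hs (X ^ l) _).eq, mul_assoc, ← mul_assoc (X ^ l), ← pow_succ]
  have e3 : ∀ l ∈ Finset.range (n + 1), X * ((-1) ^ l * (X ^ l * C (n - l)))
      = (-1) ^ l * (X ^ (l + 1) * C (n - l)) := by
    intro l hl
    rw [← mul_assoc, (hs X l).eq, mul_assoc, ← mul_assoc X, ← pow_succ']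
  rw [e1, Finset.sum_congr rfl e2, Finset.sum_congr rfl e3, Finset.sum_range_succ,
    Finset.sum_range_succ, Nat.sub_self, pow_zero, one_mul, Finset.mul_sum, add_right_comm,
    ← Finset.sum_add_distrib]
  congr 1
  refine Finset.sum_congr rfl fun l hl => ?_
  rw [Finset.mem_range] at hl
  obtain ⟨r, rfl⟩ := Nat.exists_eq_add_of_lt hl
  rw [show l + r + 1 - (l + 1) = r by omega, show l + r + 1 - l = r + 1 by omega]
  by_cases h : Even r
  · rw [if_pos h, pow_succ _ r, h.neg_one_pow, pow_succ]
    noncomm_ring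
  · rw [if_neg h, pow_succ _ r, (Nat.not_even_iff_odd.mp h).neg_one_pow]
    noncomm_ring

/-- The signs `(-1)^l` from the powers of `X` and `(-1)^(n-l)` from the coefficients combine to
`(-1)^n` in every term. -/
theorem sum_mul_var_of_anti {R : Type*} [Ring R] {n : ℕ} {X Y : R} {C : ℕ → R}
    (hXY : X * Y = - (Y * X)) (hC : ∀ j, C j * Y = (-1) ^ j * (Y * C j)) :
    (∑ l ∈ Finset.range (n + 1), (-1) ^ l * (X ^ l * C (n - l))) * Y
      = (-1) ^ n * (Y * ∑ l ∈ Finset.range (n + 1), (-1) ^ l * (X ^ l * C (n - l))) := by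
  have hs : ∀ (y : R) (l : ℕ), Commute y ((-1) ^ l) := fun y l =>
    ((Commute.one_right y).neg_right).pow_right l
  have hx : ∀ l : ℕ, X ^ l * Y = (-1) ^ l * (Y * X ^ l) := by
    intro l
    induction l with
    | zero => rw [pow_zero, pow_zero, one_mul, one_mul, mul_one]
    | succ l ih =>
      rw [pow_succ, mul_assoc, hXY, mul_neg, ← mul_assoc, ih, pow_succ]
      noncomm_ring
  rw [Finset.sum_mul, Finset.mul_sum, Finset.mul_sum]
  refine Finset.sum_congr rfl fun l hl => ?_
  obtain ⟨r, rfl⟩ := Nat.exists_eq_add_of_le (Finset.mem_range_succ_iff.mp hl)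
  rw [Nat.add_sub_cancel_left]
  calc (-1) ^ l * (X ^ l * C r) * Y = (-1) ^ l * (X ^ l * (C r * Y)) := by simp only [mul_assoc]
    _ = (-1) ^ l * ((-1) ^ r * (X ^ l * Y * C r)) := by
      rw [hC, ← mul_assoc (X ^ l) ((-1) ^ r), (hs _ r).eq]
      simp only [mul_assoc]
    _ = (-1) ^ l * ((-1) ^ r * ((-1) ^ l * (Y * (X ^ l * C r)))) := by
      rw [hx]
      simp only [mul_assoc]
    _ = (-1) ^ (l + r) * ((-1) ^ l * (Y * (X ^ l * C r))) := by rw [pow_add, mul_assoc]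
    _ = (-1) ^ (l + r) * (Y * ((-1) ^ l * (X ^ l * C r))) := by
      rw [← mul_assoc Y ((-1) ^ l), (hs Y l).eq, mul_assoc]

theorem tens_right_mul_left {R B C : Type*} [CommRing R] [Ring B] [Ring C] [Algebra R B]
    [Algebra R C] (ℬ : Bideg → Submodule R B) (𝒞 : Bideg → Submodule R C) [GradedAlgebra ℬ]
    [GradedAlgebra 𝒞] {p q : Bideg} {c : C} (hc : c ∈ 𝒞 p) {b : B} (hb : b ∈ ℬ q) :
    GradedTensorProduct.includeRight ℬ 𝒞 c * GradedTensorProduct.includeLeft ℬ 𝒞 b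
      = (-1 : ℤˣ) ^ (p * q) • (GradedTensorProduct.includeLeft ℬ 𝒞 b
        * GradedTensorProduct.includeRight ℬ 𝒞 c) := by
  have := GradedTensorProduct.tmul_coe_mul_coe_tmul (R := R) ℬ 𝒞 1 ⟨c, hc⟩ ⟨b, hb⟩ 1
  rw [mul_one, one_mul] at this
  rw [GradedTensorProduct.includeLeft_apply, GradedTensorProduct.includeRight_apply,
    GradedTensorProduct.tmul_one_mul_one_tmul]
  exact this

theorem neg_one_uzpow_gen : (-1 : ℤˣ) ^ (((2, 1) : Bideg) * (2, 1)) = -1 := rfl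

theorem neg_one_uzpow_nsmul (j : ℕ) :
    (-1 : ℤˣ) ^ ((j • ((2, 1) : Bideg)) * (2, 1)) = (-1) ^ j := by
  induction j with
  | zero => rw [zero_smul, zero_mul, uzpow_zero, pow_zero]
  | succ j ih => rw [succ_nsmul, add_mul, uzpow_add, ih, neg_one_uzpow_gen, pow_succ]

theorem units_pow_smul {R : Type*} [Ring R] (j : ℕ) (x : R) :
    ((-1 : ℤˣ) ^ j) • x = (-1) ^ j * x := by
  rcases Nat.even_or_odd j with h | h
  · rw [h.neg_one_pow, h.neg_one_pow, one_smul, one_mul]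
  · rw [h.neg_one_pow, h.neg_one_pow, Units.neg_smul, one_smul, neg_one_mul]

/-! ### The coefficients `c_j` and multiplication by `d` -/

section Coeff

variable {𝕜 : Type*} [CommRing 𝕜] {n : ℕ}

theorem fchi_mem (j : ℕ) : fchi 𝕜 n j ∈ wordComp 𝕜 AGen.deg ((2 * j) • ((2, 1) : Bideg)) := by
  unfold fchi
  split_ifs with h1 h2
  · rw [h1, mul_zero, zero_smul]
    exact wordComp_one _
  · have e : (2 * j) • ((2, 1) : Bideg) = AGen.deg (AGen.chi ⟨j - 1, h2⟩ : AGen n) := by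
      obtain ⟨i, rfl⟩ : ∃ i, j = i + 1 := ⟨j - 1, by omega⟩
      refine Prod.ext ?_ ?_
      · simp [AGen.deg]
        ring
      · have h2 : (2 : ZMod 2) = 0 := rfl
        simp [AGen.deg, h2]
    rw [e]
    exact wordComp_gen _ _
  · exact Submodule.zero_mem _

theorem A.c_mem (j : ℕ) : A.c 𝕜 n j ∈ AComp 𝕜 n (j • ((2, 1) : Bideg)) := by
  unfold A.c
  split_ifs with h
  · refine ⟨_, ?_, rfl⟩
    obtain ⟨i, rfl⟩ := even_iff_two_dvd.mp h
    rw [Nat.mul_div_cancel_left _ (by norm_num)]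
    exact fchi_mem i
  · refine ⟨_, ?_, rfl⟩
    obtain ⟨i, rfl⟩ := Nat.not_even_iff_odd.mp h
    rw [Nat.add_sub_cancel, Nat.mul_div_cancel_left _ (by norm_num)]
    refine wordComp_mul _ (wordComp_gen _ _) (fchi_mem i) ?_
    rw [succ_nsmul']
    rfl

theorem fchi_mul_d (j : ℕ) : QuotBy.mk 𝕜 (ARel 𝕜 n) (fchi 𝕜 n j * FreeAlgebra.ι 𝕜 AGen.d)
    = QuotBy.mk 𝕜 (ARel 𝕜 n) (FreeAlgebra.ι 𝕜 AGen.d * fchi 𝕜 n j) := by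
  unfold fchi
  split_ifs with h1 h2
  · rw [one_mul, mul_one]
  · have := QuotBy.mk_eq_zero (𝕜 := 𝕜) (ARel 𝕜 n) (ARel.comm (AGen.chi ⟨j - 1, h2⟩) AGen.d)
    rwa [map_sub, sub_eq_zero] at this
  · rw [zero_mul, mul_zero]

/-- Every relation of `A_n` is used here. Commutativity brings `d` to the front, `d² = 0` settles
odd `j`, and `d χ_{n/2} = 0` settles `j = n` even. -/
theorem A.c_mul_c_one {j : ℕ} (hj : j ≤ n) :
    A.c 𝕜 n j * A.c 𝕜 n 1 = if Even j ∧ j < n then A.c 𝕜 n (j + 1) else 0 := by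
  have h1 : A.c 𝕜 n 1 = QuotBy.mk 𝕜 (ARel 𝕜 n) (FreeAlgebra.ι 𝕜 AGen.d) := by
    rw [A.c, if_neg (by decide)]
    simp [fchi]
  rw [h1]
  by_cases h : Even j
  · rw [A.c, if_pos h, ← map_mul, fchi_mul_d]
    by_cases h2 : j < n
    · rw [if_pos ⟨h, h2⟩, A.c, if_neg (by rw [Nat.even_add_one]; simpa using h),
        Nat.add_sub_cancel]
    · rw [if_neg (by tauto)]
      obtain rfl : j = n := by omega
      exact QuotBy.mk_eq_zero (ARel 𝕜 j) (ARel.d_top h)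
  · rw [if_neg (by tauto), A.c, if_neg h, ← map_mul, mul_assoc, map_mul, fchi_mul_d, map_mul,
      ← mul_assoc, ← map_mul, QuotBy.mk_eq_zero (ARel 𝕜 n) ARel.d_sq, zero_mul]

end Coeff

/-! ### Commutation of `a^n(x_i)` with the variables -/

section CycRelation

variable {𝕜 : Type*} [CommRing 𝕜] {k n : ℕ}

/-- The element `u ⊗ 1`. -/
def tL (𝕜 : Type*) [CommRing 𝕜] (k n : ℕ) : ONH 𝕜 k →ₐ[𝕜] ONHComp 𝕜 k ᵍ⊗[𝕜] AComp 𝕜 n :=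
  GradedTensorProduct.includeLeft (ONHComp 𝕜 k) (AComp 𝕜 n)

/-- The element `1 ⊗ a`. -/
def tR (𝕜 : Type*) [CommRing 𝕜] (k n : ℕ) : A 𝕜 n →ₐ[𝕜] ONHComp 𝕜 k ᵍ⊗[𝕜] AComp 𝕜 n :=
  GradedTensorProduct.includeRight (ONHComp 𝕜 k) (AComp 𝕜 n)

theorem tL_mul_tR (u : ONH 𝕜 k) (a : A 𝕜 n) : tL 𝕜 k n u * tR 𝕜 k n a = u ᵍ⊗ₜ[𝕜] a :=
  GradedTensorProduct.tmul_one_mul_one_tmul _ _ u a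

theorem tR_c_mul_tL_x (j : ℕ) (i : Fin k) : tR 𝕜 k n (A.c 𝕜 n j) * tL 𝕜 k n (ONH.x 𝕜 i)
    = (-1) ^ j * (tL 𝕜 k n (ONH.x 𝕜 i) * tR 𝕜 k n (A.c 𝕜 n j)) := by
  have h := ONH.X_mem (𝕜 := 𝕜) (k := k) i
  rw [ONH.X_val] at h
  exact (tens_right_mul_left _ _ (A.c_mem j) h).trans (by rw [neg_one_uzpow_nsmul, units_pow_smul]; rfl)

theorem aPoly_eq (i : Fin k) : aPoly 𝕜 k n i = ∑ l ∈ Finset.range (n + 1),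
    (-1) ^ l * (tL 𝕜 k n (ONH.x 𝕜 i) ^ l * tR 𝕜 k n (A.c 𝕜 n (n - l))) := by
  rw [aPoly]
  refine Finset.sum_congr rfl fun l _ => ?_
  rw [← map_pow, tL_mul_tR]

theorem aPoly_mul_x (i : Fin k) : aPoly 𝕜 k n i * tL 𝕜 k n (ONH.x 𝕜 i)
    = tL 𝕜 k n (ONH.x 𝕜 i) * aPoly 𝕜 k n i
      + 2 * (aPoly 𝕜 k n i * tR 𝕜 k n (A.c 𝕜 n 1)) := by
  rw [aPoly_eq]
  refine sum_mul_var (C := fun j => tR 𝕜 k n (A.c 𝕜 n j)) (fun j _ => tR_c_mul_tL_x j i)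
    fun j hj => ?_
  rw [← map_mul, A.c_mul_c_one hj]
  split_ifs
  · rfl
  · exact map_zero _

theorem aPoly_mul_x_of_ne {i j : Fin k} (h : i ≠ j) : aPoly 𝕜 k n i * tL 𝕜 k n (ONH.x 𝕜 j)
    = (-1) ^ n * (tL 𝕜 k n (ONH.x 𝕜 j) * aPoly 𝕜 k n i) := by
  rw [aPoly_eq]
  refine sum_mul_var_of_anti (C := fun j => tR 𝕜 k n (A.c 𝕜 n j)) ?_
    fun l => tR_c_mul_tL_x l j
  rw [← map_mul, ← map_mul, ← map_neg, eq_neg_of_add_eq_zero_left (ONH.x_anti h)]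

end CycRelation


/-! ### The cyclotomic quotient acts on `OPol_k ⊗ M_k^n` -/

section Representation

variable {𝕜 : Type*} [CommRing 𝕜] {k n : ℕ}

theorem neg_one_pow_mul_eq_zsmul {R : Type*} [Ring R] (l : ℕ) (z : R) :
    (-1) ^ l * z = (-1 : ℤ) ^ l • z := by
  rw [zsmul_eq_mul, Int.cast_pow, Int.cast_neg, Int.cast_one]

theorem mk_hPrime (q : ℕ) : M.mk 𝕜 k n (hPrime 𝕜 k n q) = ∑ r ∈ Finset.range (q + 1),
    (-1 : ℤ) ^ r • (M.left 𝕜 k n (OSym.h 𝕜 k (q - r)) * M.right 𝕜 k n (A.c 𝕜 n r)) := by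
  rw [hPrime, map_sum]
  refine Finset.sum_congr rfl fun r _ => ?_
  rw [neg_one_pow_mul_eq_zsmul, map_zsmul, M.left_mul_right]

theorem mk_hPrime_eq_zero {p : ℕ} (hp : p < k) (hn : p ≤ n) :
    M.mk 𝕜 k n (hPrime 𝕜 k n (n - p)) = 0 :=
  QuotBy.mk_eq_zero _ (GrRel.mk (n - p) (by omega) (by omega))

section

variable {C : Type*} [Ring C] [Algebra 𝕜 C] (ψ : (ONHComp 𝕜 k ᵍ⊗[𝕜] AComp 𝕜 n) →ₐ[𝕜] C)

theorem map_aPoly (i : Fin k) : ψ (aPoly 𝕜 k n i) = ∑ l ∈ Finset.range (n + 1),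
    (-1 : ℤ) ^ l • (ψ (tL 𝕜 k n (ONH.X 𝕜 k i ^ l)) * ψ (tR 𝕜 k n (A.c 𝕜 n (n - l)))) := by
  rw [aPoly, map_sum ψ]
  refine Finset.sum_congr rfl fun l _ => ?_
  rw [neg_one_pow_mul_eq_zsmul, map_zsmul ψ, ← map_mul ψ, tL_mul_tR, ONH.X_val]

theorem map_aPoly_mul_x (i : Fin k) : ψ (aPoly 𝕜 k n i) * ψ (tL 𝕜 k n (ONH.x 𝕜 i))
    = ψ (tL 𝕜 k n (ONH.x 𝕜 i)) * ψ (aPoly 𝕜 k n i)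
      + (ψ (aPoly 𝕜 k n i) * ψ (tR 𝕜 k n (A.c 𝕜 n 1))
        + ψ (aPoly 𝕜 k n i) * ψ (tR 𝕜 k n (A.c 𝕜 n 1))) := by
  rw [← map_mul ψ, ← map_mul ψ, ← map_mul ψ, aPoly_mul_x, two_mul, map_add ψ, map_add ψ]

theorem map_aPoly_mul_x_of_ne {i j : Fin k} (h : i ≠ j) :
    ψ (aPoly 𝕜 k n i) * ψ (tL 𝕜 k n (ONH.x 𝕜 j))
      = (-1 : ℤ) ^ n • (ψ (tL 𝕜 k n (ONH.x 𝕜 j)) * ψ (aPoly 𝕜 k n i)) := by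
  rw [← map_mul ψ, ← map_mul ψ, aPoly_mul_x_of_ne h, neg_one_pow_mul_eq_zsmul, map_zsmul ψ]

end

theorem T.tmul_zsmul (c : ℤ) (f : OPol 𝕜 k) (m : M 𝕜 k n) :
    T.tmul f (c • m) = c • T.tmul f m :=
  map_zsmul (T.tmulₗ 𝕜 k n f) c m

theorem T.tmul_sum {ι : Type*} (s : Finset ι) (f : OPol 𝕜 k) (m : ι → M 𝕜 k n) :
    T.tmul f (∑ i ∈ s, m i) = ∑ i ∈ s, T.tmul f (m i) :=
  map_sum (T.tmulₗ 𝕜 k n f) m s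

/-- Evaluation of endomorphisms. -/
def EndT.eval (t : T 𝕜 k n) : EndT 𝕜 k n →+ T 𝕜 k n where
  toFun E := E t
  map_zero' := rfl
  map_add' _ _ := rfl

theorem EndT.add_apply (E E' : EndT 𝕜 k n) (t : T 𝕜 k n) : (E + E') t = E t + E' t := rfl

theorem EndT.zsmul_apply (c : ℤ) (E : EndT 𝕜 k n) (t : T 𝕜 k n) : (c • E) t = c • E t :=
  map_zsmul (EndT.eval t) c E

theorem EndT.sum_apply {ι : Type*} (s : Finset ι) (E : ι → EndT 𝕜 k n) (t : T 𝕜 k n) :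
    (∑ i ∈ s, E i) t = ∑ i ∈ s, E i t :=
  map_sum (EndT.eval t) E s

theorem actTens_tL (u : ONH 𝕜 k) : actTens 𝕜 k n (tL 𝕜 k n u) = actONH 𝕜 k n u :=
  (congrArg (actONH 𝕜 k n u * ·) (map_one (actA 𝕜 k n))).trans (mul_one _)

theorem actTens_tR (a : A 𝕜 n) : actTens 𝕜 k n (tR 𝕜 k n a) = actA 𝕜 k n a :=
  (congrArg (· * actA 𝕜 k n a) (map_one (actONH 𝕜 k n))).trans (one_mul _)

/-- Expanding the powers of `x_1` and moving `θ(h)` across the tensor sign gives `± ∑_p g_p ⊗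
h'_{n-p} m`. For `p < k` the second factor is a relation of `M_k^n`; for `p ≥ k` the first is zero.
-/
theorem actTens_aPoly_tmul_one {i : Fin k} (hi : (i : ℕ) = 0) (m : M 𝕜 k n) :
    actTens 𝕜 k n (aPoly 𝕜 k n i) (T.tmul 1 m) = 0 := by
  have hk : 0 < k := lt_of_le_of_lt (Nat.zero_le _) i.2
  let β : OPol 𝕜 k →+ ℕ → T 𝕜 k n :=
    { toFun := fun f r => T.tmul f (M.right 𝕜 k n (A.c 𝕜 n r) * m)
      map_zero' := funext fun r => T.zero_tmul _
      map_add' := fun f g => funext fun r => T.add_tmul _ _ _ }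
  have e1 : actTens 𝕜 k n (aPoly 𝕜 k n i) (T.tmul 1 m)
      = ∑ l ∈ Finset.range (n + 1), (-1 : ℤ) ^ l • β (OPol.X 𝕜 k 0 ^ l) (n - l) := by
    rw [map_aPoly (actTens 𝕜 k n) i]
    refine (EndT.sum_apply _ _ _).trans (Finset.sum_congr rfl fun l _ => ?_)
    refine (EndT.zsmul_apply _ _ _).trans ?_
    refine (congrArg₂ (fun a b : EndT 𝕜 k n => (-1 : ℤ) ^ l • (a * b) (T.tmul 1 m))
      (actTens_tL _) (actTens_tR _)).trans ?_
    refine congrArg (fun t : T 𝕜 k n => (-1 : ℤ) ^ l • t) ?_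
    refine (congrArg (actONH 𝕜 k n (ONH.X 𝕜 k i ^ l)) (actA_tmul_one _ m)).trans ?_
    refine (actONH_tmul _ _ _).trans ?_
    rw [OPol.X_pow_smul, mul_one, hi]
    rfl
  rw [e1, sum_pow_pairing hk, Finset.sum_eq_zero, smul_zero]
  intro p hp
  rw [Finset.mem_range] at hp
  have e2 : ∑ r ∈ Finset.range (n - p + 1),
      (-1 : ℤ) ^ r • β (gPol 𝕜 k p * theta 𝕜 k (OPol.h 𝕜 k (n - p - r))) r
      = T.tmul (gPol 𝕜 k p) (M.mk 𝕜 k n (hPrime 𝕜 k n (n - p)) * m) := by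
    rw [mk_hPrime, Finset.sum_mul, T.tmul_sum]
    refine Finset.sum_congr rfl fun r _ => ?_
    rw [smul_mul_assoc, mul_assoc, T.tmul_zsmul]
    exact congrArg (fun t : T 𝕜 k n => (-1 : ℤ) ^ r • t)
      (T.tmul_mul_theta (gPol 𝕜 k p) (OSym.h 𝕜 k (n - p - r)) _)
  rw [e2]
  by_cases h : p < k
  · rw [mk_hPrime_eq_zero h (by omega), zero_mul, T.tmul_zero]
  · rw [gPol_of_le (by omega), T.zero_tmul]

theorem actTens_tL_x (i : Fin k) (f : OPol 𝕜 k) (m : M 𝕜 k n) :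
    actTens 𝕜 k n (tL 𝕜 k n (ONH.x 𝕜 i)) (T.tmul f m) = T.tmul (OPol.x 𝕜 i * f) m := by
  rw [actTens_tL]
  refine (actONH_tmul _ _ _).trans ?_
  rw [← ONH.X_val, OPol.X_smul, OPol.X_val]

theorem actTens_tR_c_one (f : OPol 𝕜 k) (m : M 𝕜 k n) :
    actTens 𝕜 k n (tR 𝕜 k n (A.c 𝕜 n 1)) (T.tmul f m)
      = T.tmul (twist 𝕜 k (1 • ((2, 1) : Bideg)) f) (M.right 𝕜 k n (A.c 𝕜 n 1) * m) := by
  rw [actTens_tR]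
  exact actA_tmul (A.c_mem 1) f m

/-- The coefficient `d` acts through a sign automorphism of the polynomials, so the induction over
variables must carry `f` and its twist together. The twist is an involution, hence the pair of
conditions is stable. -/
theorem EndT.eq_zero_of_twist {E : EndT 𝕜 k n} (p : Bideg)
    (h1 : ∀ m : M 𝕜 k n, E (T.tmul 1 m) = 0)
    (hx : ∀ (j : Fin k) (f : OPol 𝕜 k), (∀ m : M 𝕜 k n, E (T.tmul f m) = 0) →
      (∀ m : M 𝕜 k n, E (T.tmul (twist 𝕜 k p f) m) = 0) →
      ∀ m : M 𝕜 k n, E (T.tmul (OPol.x 𝕜 j * f) m) = 0) : E = 0 := by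
  let N : Submodule 𝕜 (OPol 𝕜 k) :=
    { carrier := {f | (∀ m : M 𝕜 k n, E (T.tmul f m) = 0) ∧
        ∀ m : M 𝕜 k n, E (T.tmul (twist 𝕜 k p f) m) = 0}
      zero_mem' := ⟨fun m => by rw [T.zero_tmul, map_zero],
        fun m => by rw [map_zero, T.zero_tmul, map_zero]⟩
      add_mem' := fun {f g} hf hg =>
        ⟨fun m => by rw [T.add_tmul, map_add, hf.1, hg.1, add_zero],
          fun m => by rw [map_add, T.add_tmul, map_add, hf.2, hg.2, add_zero]⟩
      smul_mem' := fun c f hf =>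
        ⟨fun m => by rw [T.smul_tmul, ← T.tmul_smul, hf.1],
          fun m => by rw [map_smul, T.smul_tmul, ← T.tmul_smul, hf.2]⟩ }
  refine EndT.ext_tmul fun f m => ?_
  suffices h : f ∈ N from h.1 m
  refine OPol.mem_of_mul ?_ ?_ f
  · exact ⟨h1, by rwa [map_one (twist 𝕜 k p)]⟩
  · intro j f hf
    refine ⟨hx j f hf.1 hf.2, fun m => ?_⟩
    have hx' := hx j (twist 𝕜 k p f) hf.2 (by rw [twist_twist]; exact hf.1) m
    have e : twist 𝕜 k p (OPol.x 𝕜 j * f)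
        = (-1 : ℤˣ) ^ (p * (2, 1)) • (OPol.x 𝕜 j * twist 𝕜 k p f) := by
      rw [map_mul (twist 𝕜 k p), twist_x, smul_mul_assoc]
    rw [e]
    exact (congrArg E (T.units_smul_tmul _ _ m)).trans ((map_intUnits_smul E _ _).trans
      ((congrArg (fun t : T 𝕜 k n => (-1 : ℤˣ) ^ (p * (2, 1)) • t) hx').trans (smul_zero _)))

/-- The commutation rules express `E` at `x_j f` by `E` at `f` and, when `j = i`, also by `E` at the
twist of `f`. Vanishing on `1 ⊗ M_k^n` therefore spreads to the whole module. -/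
theorem EndT.eq_zero_of_relations {i : Fin k} {E : EndT 𝕜 k n}
    (h1 : ∀ m : M 𝕜 k n, E (T.tmul 1 m) = 0)
    (h2 : E * actTens 𝕜 k n (tL 𝕜 k n (ONH.x 𝕜 i))
      = actTens 𝕜 k n (tL 𝕜 k n (ONH.x 𝕜 i)) * E + (E * actTens 𝕜 k n (tR 𝕜 k n (A.c 𝕜 n 1))
        + E * actTens 𝕜 k n (tR 𝕜 k n (A.c 𝕜 n 1))))
    (h3 : ∀ j, i ≠ j → E * actTens 𝕜 k n (tL 𝕜 k n (ONH.x 𝕜 j))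
      = (-1 : ℤ) ^ n • (actTens 𝕜 k n (tL 𝕜 k n (ONH.x 𝕜 j)) * E)) : E = 0 := by
  refine EndT.eq_zero_of_twist (1 • ((2, 1) : Bideg)) h1 fun j f hf1 hf2 m => ?_
  refine (congrArg E (actTens_tL_x j f m)).symm.trans ?_
  change (E * actTens 𝕜 k n (tL 𝕜 k n (ONH.x 𝕜 j))) (T.tmul f m) = 0
  have e4 : (actTens 𝕜 k n (tL 𝕜 k n (ONH.x 𝕜 j)) * E) (T.tmul f m) = 0 :=
    (congrArg (actTens 𝕜 k n (tL 𝕜 k n (ONH.x 𝕜 j))) (hf1 m)).trans (map_zero _)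
  by_cases h : i = j
  · subst h
    have e3 : (E * actTens 𝕜 k n (tR 𝕜 k n (A.c 𝕜 n 1))) (T.tmul f m) = 0 :=
      (congrArg E (actTens_tR_c_one f m)).trans (hf2 _)
    rw [h2]
    exact (congrArg₂ (· + ·) e4 (congrArg₂ (· + ·) e3 e3)).trans (by rw [add_zero, add_zero])
  · rw [h3 j h]
    exact (EndT.zsmul_apply _ _ _).trans
      ((congrArg (fun t : T 𝕜 k n => (-1 : ℤ) ^ n • t) e4).trans (smul_zero _))

/-- The representation satisfies the cyclotomic relation. -/
theorem actTens_aPoly_eq_zero {i : Fin k} (hi : (i : ℕ) = 0) :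
    actTens 𝕜 k n (aPoly 𝕜 k n i) = 0 :=
  EndT.eq_zero_of_relations (fun m => actTens_aPoly_tmul_one hi m)
    (map_aPoly_mul_x (actTens 𝕜 k n) i) fun _ h => map_aPoly_mul_x_of_ne (actTens 𝕜 k n) h

/-- The action of the deformed cyclotomic quotient on `OPol_k ⊗ M_k^n`. -/
def cycRep (𝕜 : Type*) [CommRing 𝕜] (k n : ℕ) : CycONH 𝕜 k n →ₐ[𝕜] EndT 𝕜 k n :=
  QuotBy.lift (CycRel 𝕜 k n) (actTens 𝕜 k n) (by
    rintro _ ⟨i, hi⟩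
    exact actTens_aPoly_eq_zero hi)

theorem cycRep_mk (z : ONHComp 𝕜 k ᵍ⊗[𝕜] AComp 𝕜 n) :
    cycRep 𝕜 k n (CycONH.mk 𝕜 k n z) = actTens 𝕜 k n z :=
  QuotBy.lift_mk _ _ _ z

theorem cycRep_tmul {p q : Bideg} (u : ONH 𝕜 k) {a : A 𝕜 n} (ha : a ∈ AComp 𝕜 n p)
    {f : OPol 𝕜 k} (hf : f ∈ OPolComp 𝕜 k q) (m : M 𝕜 k n) :
    cycRep 𝕜 k n (CycONH.mk 𝕜 k n (u ᵍ⊗ₜ[𝕜] a)) (T.tmul f m)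
      = (-1 : ℤˣ) ^ (p * q) • T.tmul (polyRep 𝕜 k u f) (M.mk 𝕜 k n (1 ᵍ⊗ₜ[𝕜] a) * m) := by
  rw [cycRep_mk, actTens_tmul]
  refine (congrArg (actONH 𝕜 k n u) (actA_tmul_of_mem ha hf m)).trans ?_
  rw [map_intUnits_smul]
  exact congrArg (fun t : T 𝕜 k n => (-1 : ℤˣ) ^ (p * q) • t) (actONH_tmul u f _)

end Representation


/-! ### The Grassmannian algebra acting on vectors killed by all `τ_l` -/

theorem gradedTens_induction {R B C : Type*} [CommRing R] [Ring B] [Ring C] [Algebra R B]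
    [Algebra R C] (ℬ : Bideg → Submodule R B) (𝒞 : Bideg → Submodule R C) [GradedAlgebra ℬ]
    [GradedAlgebra 𝒞] {p : ℬ ᵍ⊗[R] 𝒞 → Prop} (h : ∀ b c, p (b ᵍ⊗ₜ[R] c))
    (hadd : ∀ x y, p x → p y → p (x + y)) (z : ℬ ᵍ⊗[R] 𝒞) : p z := by
  have h0 : p 0 := (congrArg p (TensorProduct.zero_tmul B (0 : C))).mp (h 0 0)
  exact TensorProduct.induction_on (motive := p) z h0 h hadd

section Vacuum

variable {𝕜 : Type*} [CommRing 𝕜] {k n : ℕ} {B : Type*} [Ring B] [Algebra 𝕜 B]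
  (ψ : (ONHComp 𝕜 k ᵍ⊗[𝕜] AComp 𝕜 n) →ₐ[𝕜] B)

theorem map_tR_mul_tL {p q : Bideg} {a : A 𝕜 n} (ha : a ∈ AComp 𝕜 n p) {u : ONH 𝕜 k}
    (hu : u ∈ ONHComp 𝕜 k q) : ψ (tR 𝕜 k n a) * ψ (tL 𝕜 k n u)
      = (-1 : ℤˣ) ^ (p * q) • (ψ (tL 𝕜 k n u) * ψ (tR 𝕜 k n a)) := by
  rw [← map_mul ψ, ← map_mul ψ, ← map_intUnits_smul ψ]
  exact congrArg ψ (tens_right_mul_left _ _ ha hu)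

theorem map_tL_mul_tR {p q : Bideg} {a : A 𝕜 n} (ha : a ∈ AComp 𝕜 n p) {u : ONH 𝕜 k}
    (hu : u ∈ ONHComp 𝕜 k q) : ψ (tL 𝕜 k n u) * ψ (tR 𝕜 k n a)
      = (-1 : ℤˣ) ^ (p * q) • (ψ (tR 𝕜 k n a) * ψ (tL 𝕜 k n u)) := by
  rw [map_tR_mul_tL ψ ha hu, smul_smul, Int.units_mul_self, one_smul]

/-- The algebra map `g ⊗ a ↦ θ(g) ⊗ a`. -/
def symTens : (OSymComp 𝕜 k ᵍ⊗[𝕜] AComp 𝕜 n) →ₐ[𝕜] B :=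
  GradedTensorProduct.lift _ _
    (ψ.comp ((tL 𝕜 k n).comp ((OPol.toONH 𝕜 k).comp ((theta 𝕜 k).comp (OSym 𝕜 k).val))))
    (ψ.comp (tR 𝕜 k n)) fun _ _ g a => map_tL_mul_tR ψ a.2 (OPol.toONH_mem (theta_mem g.2))

theorem symTens_tmul (g : OSym 𝕜 k) (a : A 𝕜 n) : symTens ψ (g ᵍ⊗ₜ[𝕜] a)
    = ψ (tL 𝕜 k n (OPol.toONH 𝕜 k (theta 𝕜 k g))) * ψ (tR 𝕜 k n a) := rfl

variable [Module (ONH 𝕜 k) B]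

/-- The `𝕜`-submodule of the elements killed by all `τ_l`. -/
def vacuum (hψ : ∀ (u : ONH 𝕜 k) (b : B), u • b = ψ (tL 𝕜 k n u) * b) : Submodule 𝕜 B where
  carrier := {v | IsVac 𝕜 k 0 v}
  zero_mem' := isVac_zero
  add_mem' := IsVac.add
  smul_mem' c v hv l hl := by
    rw [hψ, mul_smul_comm, ← hψ, hv l hl, smul_zero]

variable {ψ}

theorem IsVac.tR_mul (hψ : ∀ (u : ONH 𝕜 k) (b : B), u • b = ψ (tL 𝕜 k n u) * b)
    {v : B} (hv : IsVac 𝕜 k 0 v) (a : A 𝕜 n) :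
    IsVac 𝕜 k 0 (ψ (tR 𝕜 k n a) * v) := by
  classical
  induction a using DirectSum.Decomposition.inductionOn (AComp 𝕜 n) with
  | zero => rw [map_zero (tR 𝕜 k n), map_zero ψ, zero_mul]; exact isVac_zero
  | homogeneous a =>
    intro l hl
    rw [hψ, ← mul_assoc, map_tL_mul_tR ψ a.2 (ONH.t_mem l), smul_mul_assoc, mul_assoc, ← hψ,
      hv l hl, mul_zero, smul_zero]
  | add a b ha hb =>
    rw [map_add (tR 𝕜 k n), map_add ψ, add_mul]
    exact ha.add hb

theorem IsVac.symTens_mul (hψ : ∀ (u : ONH 𝕜 k) (b : B), u • b = ψ (tL 𝕜 k n u) * b)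
    {v : B} (hv : IsVac 𝕜 k 0 v) (z : OSymComp 𝕜 k ᵍ⊗[𝕜] AComp 𝕜 n) :
    IsVac 𝕜 k 0 (symTens ψ z * v) := by
  induction z using gradedTens_induction with
  | h g a =>
    rw [symTens_tmul, mul_assoc, ← hψ]
    exact (IsVac.tR_mul hψ hv a).toONH_smul (theta_OSym_isVac g)
  | hadd x y hx hy =>
    rw [map_add (symTens ψ), add_mul]
    exact hx.add hy

/-- The relation gives `0 = a^n(x_1) v = ± ∑_p g_p (h'_{n-p} v)`. Each `h'_{n-p} v` is again killed
by all `τ_l`, so independence of the `g_p` makes each of them zero. This is the converse of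
`actTens_aPoly_tmul_one`. -/
theorem IsVac.symTens_hPrime_mul
    (hψ : ∀ (u : ONH 𝕜 k) (b : B), u • b = ψ (tL 𝕜 k n u) * b) {v : B} (hv : IsVac 𝕜 k 0 v)
    (h0 : ∀ i : Fin k, (i : ℕ) = 0 → ψ (aPoly 𝕜 k n i) = 0) {p : ℕ} (hp : p < k) (hn : p ≤ n) :
    symTens ψ (hPrime 𝕜 k n (n - p)) * v = 0 := by
  have hk : 0 < k := by omega
  let β : OPol 𝕜 k →+ ℕ → B :=
    { toFun := fun f r => ψ (tL 𝕜 k n (OPol.toONH 𝕜 k f)) * (ψ (tR 𝕜 k n (A.c 𝕜 n r)) * v)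
      map_zero' := funext fun r => by
        rw [map_zero (OPol.toONH 𝕜 k), map_zero (tL 𝕜 k n), map_zero ψ, zero_mul]; rfl
      map_add' := fun f g => funext fun r => by
        rw [map_add (OPol.toONH 𝕜 k), map_add (tL 𝕜 k n), map_add ψ, add_mul]; rfl }
  have hβ : ∀ f r, β f r = ψ (tL 𝕜 k n (OPol.toONH 𝕜 k f)) * (ψ (tR 𝕜 k n (A.c 𝕜 n r)) * v) :=
    fun _ _ => rfl
  have e1 : ∑ l ∈ Finset.range (n + 1), (-1 : ℤ) ^ l • β (OPol.X 𝕜 k 0 ^ l) (n - l) = 0 := by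
    have := congrArg (· * v) ((map_aPoly ψ (⟨0, hk⟩ : Fin k)).symm.trans (h0 _ rfl))
    simp only [Finset.sum_mul, zero_mul] at this
    rw [← this]
    refine Finset.sum_congr rfl fun l _ => ?_
    rw [hβ, map_pow (OPol.toONH 𝕜 k), OPol.toONH_X, smul_mul_assoc, mul_assoc]
  rw [sum_pow_pairing hk] at e1
  -- The value zero for `p > n` is needed because the relation sums over `p ≤ n` and the
  -- independence statement over `p < k`, and either bound may be the larger.
  let w : ℕ → B := fun p => if p ≤ n then symTens ψ (hPrime 𝕜 k n (n - p)) * v else 0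
  have hw : ∀ p, IsVac 𝕜 k 0 (w p) := by
    intro p
    change IsVac 𝕜 k 0 (ite _ _ _)
    split_ifs
    · exact IsVac.symTens_mul hψ hv _
    · exact isVac_zero
  have e2 : ∀ p ∈ Finset.range (n + 1), ∑ r ∈ Finset.range (n - p + 1),
      (-1 : ℤ) ^ r • β (gPol 𝕜 k p * theta 𝕜 k (OPol.h 𝕜 k (n - p - r))) r
      = OPol.toONH 𝕜 k (gPol 𝕜 k p) • w p := by
    intro p hp
    have hwp : w p = symTens ψ (hPrime 𝕜 k n (n - p)) * v :=
      if_pos (Finset.mem_range_succ_iff.mp hp)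
    rw [hwp, hψ, hPrime, map_sum (symTens ψ), Finset.sum_mul, Finset.mul_sum]
    refine Finset.sum_congr rfl fun r _ => ?_
    rw [neg_one_pow_mul_eq_zsmul, map_zsmul (symTens ψ), symTens_tmul, smul_mul_assoc,
      mul_smul_comm, hβ, map_mul (OPol.toONH 𝕜 k), map_mul (tL 𝕜 k n), map_mul ψ, mul_assoc,
      mul_assoc]
    rfl
  rw [Finset.sum_congr rfl e2] at e1
  have e3 : ∑ p ∈ Finset.range (n + 1), OPol.toONH 𝕜 k (gPol 𝕜 k p) • w p = 0 := by
    rcases Nat.even_or_odd n with h | h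
    · rwa [h.neg_one_pow, one_smul] at e1
    · rwa [h.neg_one_pow, neg_smul, one_smul, neg_eq_zero] at e1
  have e4 : ∑ p ∈ Finset.range k, OPol.toONH 𝕜 k (gPol 𝕜 k p) • w p = 0 := by
    -- Both sums are extended to the range up to `max k (n + 1)`: the added terms have `w p = 0` on
    -- one side and `g_p = 0` on the other.
    rw [← e3, Finset.sum_subset (Finset.range_mono (le_max_left k (n + 1))),
      Finset.sum_subset (Finset.range_mono (le_max_right k (n + 1)))]
    · intro q _ hq
      have hwq : w q = 0 := if_neg (by rw [Finset.mem_range] at hq; omega)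
      rw [hwq, smul_zero]
    · intro q _ hq
      rw [gPol_of_le (by rw [Finset.mem_range] at hq; omega), map_zero (OPol.toONH 𝕜 k), zero_smul]
  have e5 := eq_zero_of_sum_gPol hw e4 p hp
  rwa [show w p = _ from if_pos hn] at e5

/-- The action of `OΛ_k ⊗ A_n` on the elements killed by all `τ_l`. -/
def vacuumRepTens (hψ : ∀ (u : ONH 𝕜 k) (b : B), u • b = ψ (tL 𝕜 k n u) * b) :
    (OSymComp 𝕜 k ᵍ⊗[𝕜] AComp 𝕜 n) →ₐ[𝕜] Module.End 𝕜 (vacuum ψ hψ) where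
  toFun z :=
    { toFun := fun v => ⟨symTens ψ z * v, IsVac.symTens_mul hψ v.2 z⟩
      map_add' := fun _ _ => Subtype.ext (mul_add _ _ _)
      map_smul' := fun _ _ => Subtype.ext (mul_smul_comm _ _ _) }
  map_one' := LinearMap.ext fun v => Subtype.ext
    ((congrArg (· * (v : B)) (map_one (symTens ψ))).trans (one_mul _))
  map_mul' x y := LinearMap.ext fun v => Subtype.ext
    ((congrArg (· * (v : B)) (map_mul (symTens ψ) x y)).trans (mul_assoc _ _ _))
  map_zero' := LinearMap.ext fun v => Subtype.ext
    ((congrArg (· * (v : B)) (map_zero (symTens ψ))).trans (zero_mul _))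
  map_add' x y := LinearMap.ext fun v => Subtype.ext
    ((congrArg (· * (v : B)) (map_add (symTens ψ) x y)).trans (add_mul _ _ _))
  commutes' r := LinearMap.ext fun v => Subtype.ext
    ((congrArg (· * (v : B)) (AlgHom.commutes (symTens ψ) r)).trans (Algebra.smul_def _ _).symm)

theorem vacuumRepTens_apply (hψ : ∀ (u : ONH 𝕜 k) (b : B), u • b = ψ (tL 𝕜 k n u) * b)
    (z : OSymComp 𝕜 k ᵍ⊗[𝕜] AComp 𝕜 n) (v : vacuum ψ hψ) :
    (vacuumRepTens hψ z v : B) = symTens ψ z * v := rfl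

/-- The action of `M_k^n` on the elements killed by all `τ_l`. -/
def vacuumRep (hψ : ∀ (u : ONH 𝕜 k) (b : B), u • b = ψ (tL 𝕜 k n u) * b)
    (h0 : ∀ i : Fin k, (i : ℕ) = 0 → ψ (aPoly 𝕜 k n i) = 0) :
    M 𝕜 k n →ₐ[𝕜] Module.End 𝕜 (vacuum ψ hψ) :=
  QuotBy.lift (GrRel 𝕜 k n) (vacuumRepTens hψ) (by
    rintro _ ⟨m, h1, h2⟩
    refine LinearMap.ext fun v => Subtype.ext ?_
    obtain ⟨p, rfl⟩ := Nat.exists_eq_add_of_le h2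
    have := IsVac.symTens_hPrime_mul hψ v.2 h0 (p := p) (by omega) (by omega)
    rw [Nat.add_sub_cancel] at this
    exact this)

theorem vacuumRep_mk (hψ : ∀ (u : ONH 𝕜 k) (b : B), u • b = ψ (tL 𝕜 k n u) * b)
    (h0 : ∀ i : Fin k, (i : ℕ) = 0 → ψ (aPoly 𝕜 k n i) = 0)
    (z : OSymComp 𝕜 k ᵍ⊗[𝕜] AComp 𝕜 n) (v : vacuum ψ hψ) :
    (vacuumRep hψ h0 (M.mk 𝕜 k n z) v : B) = symTens ψ z * v :=
  (congrArg (fun E : Module.End 𝕜 (vacuum ψ hψ) => (E v : B))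
    (QuotBy.lift_mk (GrRel 𝕜 k n) (vacuumRepTens hψ) _ z)).trans (vacuumRepTens_apply hψ z v)

end Vacuum


/-! ### Additive maps determined on pure tensors -/

section AddHomExt

theorem decomposition_addHom_ext {R B N : Type*} [CommRing R] [Ring B] [Algebra R B]
    [AddCommGroup N] (ℬ : Bideg → Submodule R B) [GradedAlgebra ℬ] {F G : B →+ N}
    (h : ∀ p, ∀ b ∈ ℬ p, F b = G b) (b : B) : F b = G b := by
  classical
  induction b using DirectSum.Decomposition.inductionOn ℬ with
  | zero => rw [map_zero, map_zero]
  | homogeneous b => exact h _ b b.2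
  | add a b ha hb => rw [map_add, map_add, ha, hb]

theorem gradedTens_addHom_ext {R B C N : Type*} [CommRing R] [Ring B] [Ring C] [Algebra R B]
    [Algebra R C] [AddCommGroup N] (ℬ : Bideg → Submodule R B) (𝒞 : Bideg → Submodule R C)
    [GradedAlgebra ℬ] [GradedAlgebra 𝒞] {F G : ℬ ᵍ⊗[R] 𝒞 →+ N}
    (h : ∀ b c, F (b ᵍ⊗ₜ[R] c) = G (b ᵍ⊗ₜ[R] c)) (z : ℬ ᵍ⊗[R] 𝒞) : F z = G z := by
  induction z using gradedTens_induction with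
  | h b c => exact h b c
  | hadd x y hx hy => rw [map_add, map_add, hx, hy]

variable {𝕜 : Type*} [CommRing 𝕜] {k n : ℕ} {N : Type*} [AddCommGroup N]

theorem T.addHom_ext {F G : T 𝕜 k n →+ N} (h : ∀ f m, F (T.tmul f m) = G (T.tmul f m))
    (t : T 𝕜 k n) : F t = G t := by
  induction t using T.induction with
  | h f m => exact h f m
  | hadd x y hx hy => rw [map_add, map_add, hx, hy]

theorem T.addHom_ext_homogeneous {F G : T 𝕜 k n →+ N}
    (h : ∀ q, ∀ f ∈ OPolComp 𝕜 k q, ∀ m, F (T.tmul f m) = G (T.tmul f m)) (t : T 𝕜 k n) :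
    F t = G t :=
  T.addHom_ext (fun f m => decomposition_addHom_ext (OPolComp 𝕜 k)
    (F := F.comp ((T.tmulₗ 𝕜 k n).flip m).toAddMonoidHom)
    (G := G.comp ((T.tmulₗ 𝕜 k n).flip m).toAddMonoidHom) (fun q f hf => h q f hf m) f) t

end AddHomExt

/-! ### The equivariant map `f ⊗ m ↦ f m y` -/

section VacuumMap

variable {𝕜 : Type*} [CommRing 𝕜] {k n : ℕ} {B : Type*} [Ring B] [Algebra 𝕜 B]
  {ψ : (ONHComp 𝕜 k ᵍ⊗[𝕜] AComp 𝕜 n) →ₐ[𝕜] B} [Module (ONH 𝕜 k) B]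
  (hψ : ∀ (u : ONH 𝕜 k) (b : B), u • b = ψ (tL 𝕜 k n u) * b)
  (h0 : ∀ i : Fin k, (i : ℕ) = 0 → ψ (aPoly 𝕜 k n i) = 0)

theorem vacuumRep_left (g : OSym 𝕜 k) (v : vacuum ψ hψ) :
    (vacuumRep hψ h0 (M.left 𝕜 k n g) v : B)
      = ψ (tL 𝕜 k n (OPol.toONH 𝕜 k (theta 𝕜 k g))) * v := by
  refine (vacuumRep_mk hψ h0 (g ᵍ⊗ₜ[𝕜] 1) v).trans ?_
  rw [symTens_tmul, map_one (tR 𝕜 k n), map_one ψ, mul_one]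

theorem vacuumRep_right (a : A 𝕜 n) (v : vacuum ψ hψ) :
    (vacuumRep hψ h0 (M.right 𝕜 k n a) v : B) = ψ (tR 𝕜 k n a) * v := by
  refine (vacuumRep_mk hψ h0 (1 ᵍ⊗ₜ[𝕜] a) v).trans ?_
  rw [symTens_tmul, OneMemClass.coe_one, map_one (theta 𝕜 k), map_one (OPol.toONH 𝕜 k),
    map_one (tL 𝕜 k n), map_one ψ, one_mul]

theorem vacuumRep_mul (x y : M 𝕜 k n) (v : vacuum ψ hψ) :
    vacuumRep hψ h0 (x * y) v = vacuumRep hψ h0 x (vacuumRep hψ h0 y v) :=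
  congrArg (fun E : Module.End 𝕜 (vacuum ψ hψ) => E v) (map_mul (vacuumRep hψ h0) x y)

theorem vacuumRep_one (v : vacuum ψ hψ) : vacuumRep hψ h0 1 v = v :=
  congrArg (fun E : Module.End 𝕜 (vacuum ψ hψ) => E v) (map_one (vacuumRep hψ h0))

/-- The bilinear function `(m, f) ↦ f m y`, for `y` killed by all `τ_l`. -/
def vacuumMapTens (y : vacuum ψ hψ) : M 𝕜 k n ⊗[𝕜] OPol 𝕜 k →ₗ[𝕜] B :=
  TensorProduct.lift (((LinearMap.mul 𝕜 B).compl₁₂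
    (ψ.comp ((tL 𝕜 k n).comp (OPol.toONH 𝕜 k))).toLinearMap
    ((vacuum ψ hψ).subtype.comp ((vacuumRep hψ h0).toLinearMap.flip y))).flip)

theorem vacuumMapTens_tmul (y : vacuum ψ hψ) (m : M 𝕜 k n) (f : OPol 𝕜 k) :
    vacuumMapTens hψ h0 y (m ⊗ₜ[𝕜] f)
      = ψ (tL 𝕜 k n (OPol.toONH 𝕜 k f)) * (vacuumRep hψ h0 m y : B) := rfl

/-- The linear map `f ⊗ m ↦ f m y`, for `y` killed by all `τ_l`. -/
def vacuumMap (y : vacuum ψ hψ) : T 𝕜 k n →ₗ[𝕜] B :=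
  T.lift (vacuumMapTens hψ h0 y) fun f g m => by
    rw [vacuumMapTens_tmul, vacuumMapTens_tmul, vacuumRep_mul, vacuumRep_left,
      map_mul (OPol.toONH 𝕜 k), map_mul (tL 𝕜 k n), map_mul ψ, mul_assoc]

theorem vacuumMap_tmul (y : vacuum ψ hψ) (f : OPol 𝕜 k) (m : M 𝕜 k n) :
    vacuumMap hψ h0 y (T.tmul f m)
      = ψ (tL 𝕜 k n (OPol.toONH 𝕜 k f)) * (vacuumRep hψ h0 m y : B) := rfl

/-- The element `m y` is again killed by all `τ_l`, so `u` acts on `f (m y)` through its action on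
`f`. -/
theorem vacuumMap_actONH (y : vacuum ψ hψ) (u : ONH 𝕜 k) (t : T 𝕜 k n) :
    vacuumMap hψ h0 y (actONH 𝕜 k n u t) = ψ (tL 𝕜 k n u) * vacuumMap hψ h0 y t :=
  T.addHom_ext
    (F := (vacuumMap hψ h0 y).toAddMonoidHom.comp (actONH 𝕜 k n u).toAddMonoidHom)
    (G := (AddMonoidHom.mulLeft (ψ (tL 𝕜 k n u))).comp (vacuumMap hψ h0 y).toAddMonoidHom)
    (fun f m => (congrArg (vacuumMap hψ h0 y) (actONH_tmul u f m)).trans (by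
      change _ = ψ (tL 𝕜 k n u) * vacuumMap hψ h0 y (T.tmul f m)
      rw [vacuumMap_tmul, vacuumMap_tmul, ← hψ, ← hψ, ← hψ]
      exact (IsVac.smul_toONH_smul (vacuumRep hψ h0 m y).2 u f).symm)) t

/-- The Koszul sign in the action of `a` on `f ⊗ m` is the one produced by moving `a` past `f` in
the target algebra. -/
theorem vacuumMap_actA_of_mem (y : vacuum ψ hψ) {p : Bideg} {a : A 𝕜 n} (ha : a ∈ AComp 𝕜 n p)
    (t : T 𝕜 k n) :
    vacuumMap hψ h0 y (actA 𝕜 k n a t) = ψ (tR 𝕜 k n a) * vacuumMap hψ h0 y t :=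
  T.addHom_ext_homogeneous
    (F := (vacuumMap hψ h0 y).toAddMonoidHom.comp (actA 𝕜 k n a).toAddMonoidHom)
    (G := (AddMonoidHom.mulLeft (ψ (tR 𝕜 k n a))).comp (vacuumMap hψ h0 y).toAddMonoidHom)
    (fun q f hf m => (congrArg (vacuumMap hψ h0 y) (actA_tmul_of_mem ha hf m)).trans (by
      change _ = ψ (tR 𝕜 k n a) * vacuumMap hψ h0 y (T.tmul f m)
      rw [map_intUnits_smul (vacuumMap hψ h0 y), vacuumMap_tmul, vacuumMap_tmul, vacuumRep_mul,
        vacuumRep_right, ← mul_assoc, map_tL_mul_tR ψ ha (OPol.toONH_mem hf), smul_mul_assoc,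
        smul_smul, Int.units_mul_self, one_smul, mul_assoc])) t

theorem vacuumMap_actA (y : vacuum ψ hψ) (a : A 𝕜 n) (t : T 𝕜 k n) :
    vacuumMap hψ h0 y (actA 𝕜 k n a t) = ψ (tR 𝕜 k n a) * vacuumMap hψ h0 y t :=
  decomposition_addHom_ext (AComp 𝕜 n)
    (F := (vacuumMap hψ h0 y).toAddMonoidHom.comp
      ((EndT.eval t).comp (actA 𝕜 k n).toLinearMap.toAddMonoidHom))
    (G := (AddMonoidHom.mulRight (vacuumMap hψ h0 y t)).comp
      (ψ.toLinearMap.toAddMonoidHom.comp (tR 𝕜 k n).toLinearMap.toAddMonoidHom))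
    (fun _ _ ha => vacuumMap_actA_of_mem hψ h0 y ha t) a

/-- The maps `f ⊗ m ↦ f m y` are equivariant. -/
theorem vacuumMap_actTens (y : vacuum ψ hψ) (z : ONHComp 𝕜 k ᵍ⊗[𝕜] AComp 𝕜 n) (t : T 𝕜 k n) :
    vacuumMap hψ h0 y (actTens 𝕜 k n z t) = ψ z * vacuumMap hψ h0 y t :=
  gradedTens_addHom_ext (ONHComp 𝕜 k) (AComp 𝕜 n)
    (F := (vacuumMap hψ h0 y).toAddMonoidHom.comp
      ((EndT.eval t).comp (actTens 𝕜 k n).toLinearMap.toAddMonoidHom))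
    (G := (AddMonoidHom.mulRight (vacuumMap hψ h0 y t)).comp ψ.toLinearMap.toAddMonoidHom)
    (fun u a => (vacuumMap_actONH hψ h0 y u (actA 𝕜 k n a t)).trans
      ((congrArg (ψ (tL 𝕜 k n u) * ·) (vacuumMap_actA hψ h0 y a t)).trans
        ((mul_assoc _ _ _).symm.trans (congrArg (· * vacuumMap hψ h0 y t)
          ((map_mul ψ _ _).symm.trans (congrArg ψ (tL_mul_tR u a))))))) z

end VacuumMap


/-! ### Coordinates with respect to the staircase monomials -/

section Coordinates

variable {𝕜 : Type*} [CommRing 𝕜] {k n : ℕ}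

/-- The coordinates of a skew polynomial, twisted by `θ`. -/
def stairSym (𝕜 : Type*) [CommRing 𝕜] (k : ℕ) (i : Fin (k !)) : OPol 𝕜 k →ₗ[𝕜] OSym 𝕜 k where
  -- Since `g` acts on the right of `OPol_k` as multiplication by `θ(g)`, the symmetric coefficient
  -- must be passed through the involution `θ` to be right linear in this sense.
  toFun f := ⟨theta 𝕜 k (stairCoeff 𝕜 k i • f), mem_OSym_iff.mpr (theta_isVac fun l hl => by
    rw [← mul_smul]
    exact (congrArg (· • f) (stairCoeff_isVac i l hl)).trans (zero_smul _ f))⟩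
  map_add' f g := Subtype.ext
    ((congrArg (theta 𝕜 k) (smul_add (stairCoeff 𝕜 k i) f g)).trans (map_add (theta 𝕜 k) _ _))
  map_smul' c f := Subtype.ext
    ((congrArg (theta 𝕜 k) (map_smul (polyRep 𝕜 k (stairCoeff 𝕜 k i)) c f)).trans
      (map_smul (theta 𝕜 k) c _))

theorem theta_stairSym (i : Fin (k !)) (f : OPol 𝕜 k) :
    theta 𝕜 k (stairSym 𝕜 k i f : OPol 𝕜 k) = stairCoeff 𝕜 k i • f :=
  theta_theta _

theorem stairSym_mul_theta (i : Fin (k !)) (f : OPol 𝕜 k) (g : OSym 𝕜 k) :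
    stairSym 𝕜 k i (f * theta 𝕜 k g) = stairSym 𝕜 k i f * g := Subtype.ext (by
  change theta 𝕜 k (_ • _) = theta 𝕜 k (_ • _) * (g : OPol 𝕜 k)
  rw [(theta_OSym_isVac g).smul_mul, map_mul (theta 𝕜 k), theta_theta])

theorem stairSym_stairMonomial (i j : Fin (k !)) :
    stairSym 𝕜 k i (stairMonomial 𝕜 k j) = if i = j then 1 else 0 := Subtype.ext (by
  change theta 𝕜 k (_ • _) = _
  rw [stairCoeff_smul]
  split_ifs
  · exact map_one (theta 𝕜 k)
  · exact map_zero (theta 𝕜 k))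

/-- This is the identity `∑ b_j y_j = 1` of `ONH_k` applied to `f`. -/
theorem sum_stairSym (f : OPol 𝕜 k) :
    ∑ i, stairMonomial 𝕜 k i * theta 𝕜 k (stairSym 𝕜 k i f : OPol 𝕜 k) = f := by
  have h := congrArg (· • f) (sum_stairCoeff (𝕜 := 𝕜) (k := k))
  simp only [Finset.sum_smul, mul_smul, OPol.toONH_smul, one_smul] at h
  exact (Finset.sum_congr rfl fun i _ => by rw [theta_stairSym]).trans h

/-- The bilinear function underlying the coordinates. -/
def stairCoordTens (𝕜 : Type*) [CommRing 𝕜] (k n : ℕ) (i : Fin (k !)) :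
    M 𝕜 k n ⊗[𝕜] OPol 𝕜 k →ₗ[𝕜] M 𝕜 k n :=
  TensorProduct.lift (((LinearMap.mul 𝕜 (M 𝕜 k n)).comp
    ((M.left 𝕜 k n).toLinearMap.comp (stairSym 𝕜 k i))).flip)

theorem stairCoordTens_tmul (i : Fin (k !)) (m : M 𝕜 k n) (f : OPol 𝕜 k) :
    stairCoordTens 𝕜 k n i (m ⊗ₜ[𝕜] f) = M.left 𝕜 k n (stairSym 𝕜 k i f) * m := rfl

/-- The coordinates with respect to the basis of staircase monomials. -/
def stairCoord (𝕜 : Type*) [CommRing 𝕜] (k n : ℕ) (i : Fin (k !)) : T 𝕜 k n →ₗ[𝕜] M 𝕜 k n :=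
  T.lift (stairCoordTens 𝕜 k n i) fun f g m => by
    rw [stairCoordTens_tmul, stairCoordTens_tmul, stairSym_mul_theta, map_mul (M.left 𝕜 k n),
      mul_assoc]

theorem stairCoord_tmul (i : Fin (k !)) (f : OPol 𝕜 k) (m : M 𝕜 k n) :
    stairCoord 𝕜 k n i (T.tmul f m) = M.left 𝕜 k n (stairSym 𝕜 k i f) * m := rfl

theorem stairCoord_op_smul (i : Fin (k !)) (m : M 𝕜 k n) (t : T 𝕜 k n) :
    stairCoord 𝕜 k n i (MulOpposite.op m • t) = stairCoord 𝕜 k n i t * m :=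
  T.addHom_ext
    (F := (stairCoord 𝕜 k n i).toAddMonoidHom.comp
      (DistribSMul.toAddMonoidHom (T 𝕜 k n) (MulOpposite.op m)))
    (G := (AddMonoidHom.mulRight m).comp (stairCoord 𝕜 k n i).toAddMonoidHom)
    (fun _ _ => (mul_assoc _ _ _).symm) t

theorem stairCoord_stairMonomial (i j : Fin (k !)) (m : M 𝕜 k n) :
    stairCoord 𝕜 k n i (T.tmul (stairMonomial 𝕜 k j) m) = if i = j then m else 0 := by
  rw [stairCoord_tmul, stairSym_stairMonomial]
  split_ifs
  · rw [map_one (M.left 𝕜 k n), one_mul]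
  · rw [map_zero (M.left 𝕜 k n), zero_mul]

theorem sum_tmul_stairCoord (t : T 𝕜 k n) :
    ∑ i, T.tmul (stairMonomial 𝕜 k i) (stairCoord 𝕜 k n i t) = t := by
  have h := T.addHom_ext
    (F := ∑ i, (T.tmulₗ 𝕜 k n (stairMonomial 𝕜 k i)).toAddMonoidHom.comp
      (stairCoord 𝕜 k n i).toAddMonoidHom)
    (G := AddMonoidHom.id _) (fun f m => by
      rw [AddMonoidHom.finsetSum_apply]
      refine Eq.trans ?_ (congrArg (fun f : OPol 𝕜 k => T.tmul f m) (sum_stairSym f))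
      refine Eq.trans ?_ (map_sum ((T.tmulₗ 𝕜 k n).flip m) _ _).symm
      exact Finset.sum_congr rfl fun i _ =>
        (T.tmul_mul_theta (stairMonomial 𝕜 k i) (stairSym 𝕜 k i f) m).symm) t
  rw [AddMonoidHom.finsetSum_apply] at h
  exact h

theorem EndT.ext_stairMonomial {E E' : EndT 𝕜 k n}
    (h : ∀ i, E (T.tmul (stairMonomial 𝕜 k i) 1) = E' (T.tmul (stairMonomial 𝕜 k i) 1)) :
    E = E' := by
  refine LinearMap.ext fun t => ?_
  rw [← sum_tmul_stairCoord t]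
  refine (map_sum E _ _).trans (Eq.trans (Finset.sum_congr rfl fun i _ => ?_) (map_sum E' _ _).symm)
  have e : T.tmul (stairMonomial 𝕜 k i) (stairCoord 𝕜 k n i t)
      = MulOpposite.op (stairCoord 𝕜 k n i t) • T.tmul (stairMonomial 𝕜 k i) 1 := by
    rw [T.op_smul_tmul, one_mul]
  rw [e]
  exact (map_smul E _ _).trans ((congrArg (fun s : T 𝕜 k n => MulOpposite.op _ • s) (h i)).trans
    (map_smul E' _ _).symm)

end Coordinates


/-! ### The isomorphisms -/

section Isomorphism

variable {𝕜 : Type*} [CommRing 𝕜] {k n : ℕ}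

/-- Left multiplication makes the quotient a module to which the results on vacuum vectors apply,
with the quotient map as `ψ`. -/
instance CycONH.instModuleONH : Module (ONH 𝕜 k) (CycONH 𝕜 k n) :=
  Module.compHom (CycONH 𝕜 k n) ((CycONH.mk 𝕜 k n).comp (tL 𝕜 k n)).toRingHom

theorem CycONH.smul_def (u : ONH 𝕜 k) (b : CycONH 𝕜 k n) :
    u • b = CycONH.mk 𝕜 k n (tL 𝕜 k n u) * b := rfl

theorem CycONH.mk_aPoly (i : Fin k) (hi : (i : ℕ) = 0) :
    CycONH.mk 𝕜 k n (aPoly 𝕜 k n i) = 0 :=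
  QuotBy.mk_eq_zero _ (CycRel.mk i hi)

/-- The image of `stairCoeff` in the deformed cyclotomic quotient. -/
def stairVac (𝕜 : Type*) [CommRing 𝕜] (k n : ℕ) (j : Fin (k !)) :
    vacuum (CycONH.mk 𝕜 k n) CycONH.smul_def :=
  ⟨CycONH.mk 𝕜 k n (tL 𝕜 k n (stairCoeff 𝕜 k j)), fun l hl => by
    rw [CycONH.smul_def, ← map_mul (CycONH.mk 𝕜 k n), ← map_mul (tL 𝕜 k n)]
    exact (congrArg (fun u => CycONH.mk 𝕜 k n (tL 𝕜 k n u)) (stairCoeff_isVac j l hl)).trans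
      (by rw [map_zero (tL 𝕜 k n), map_zero (CycONH.mk 𝕜 k n)])⟩

theorem stairVac_coe (j : Fin (k !)) : (stairVac 𝕜 k n j : CycONH 𝕜 k n)
    = CycONH.mk 𝕜 k n (tL 𝕜 k n (stairCoeff 𝕜 k j)) := rfl

/-- The map `f ⊗ m ↦ f m y_j` to the deformed cyclotomic quotient, with `y_j` the image of
`stairCoeff`. -/
def stairMap (𝕜 : Type*) [CommRing 𝕜] (k n : ℕ) (j : Fin (k !)) :
    T 𝕜 k n →ₗ[𝕜] CycONH 𝕜 k n :=
  vacuumMap CycONH.smul_def CycONH.mk_aPoly (stairVac 𝕜 k n j)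

theorem stairMap_tmul_mk (j : Fin (k !)) (f : OPol 𝕜 k) (g : OSym 𝕜 k) (a : A 𝕜 n) :
    stairMap 𝕜 k n j (T.tmul f (M.mk 𝕜 k n (g ᵍ⊗ₜ[𝕜] a)))
      = CycONH.mk 𝕜 k n (tL 𝕜 k n (OPol.toONH 𝕜 k f)
        * (tL 𝕜 k n (OPol.toONH 𝕜 k (theta 𝕜 k g)) * tR 𝕜 k n a
          * tL 𝕜 k n (stairCoeff 𝕜 k j))) := by
  refine (vacuumMap_tmul CycONH.smul_def CycONH.mk_aPoly _ _ _).trans ?_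
  rw [vacuumRep_mk, symTens_tmul, stairVac_coe, map_mul (CycONH.mk 𝕜 k n),
    map_mul (CycONH.mk 𝕜 k n), map_mul (CycONH.mk 𝕜 k n)]

theorem stairMap_tmul_one (j : Fin (k !)) (f : OPol 𝕜 k) :
    stairMap 𝕜 k n j (T.tmul f 1)
      = CycONH.mk 𝕜 k n (tL 𝕜 k n (OPol.toONH 𝕜 k f * stairCoeff 𝕜 k j)) := by
  refine (vacuumMap_tmul CycONH.smul_def CycONH.mk_aPoly _ _ _).trans ?_
  rw [vacuumRep_one, map_mul (tL 𝕜 k n), map_mul (CycONH.mk 𝕜 k n)]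
  rfl

theorem stairMap_cycRep (j : Fin (k !)) (z : CycONH 𝕜 k n) (t : T 𝕜 k n) :
    stairMap 𝕜 k n j (cycRep 𝕜 k n z t) = z * stairMap 𝕜 k n j t := by
  obtain ⟨z, rfl⟩ := QuotBy.mk_surj (𝕜 := 𝕜) (CycRel 𝕜 k n) z
  exact (congrArg (fun E : EndT 𝕜 k n => stairMap 𝕜 k n j (E t)) (cycRep_mk z)).trans
    (vacuumMap_actTens CycONH.smul_def CycONH.mk_aPoly _ z t)

/-- Multiply `∑ b_j y_j = 1` by `z` and use equivariance: the image of `z (b_j ⊗ 1)` under the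
`j`-th map is `z b_j y_j`. An element is thus recovered explicitly from its values on the basis,
which gives injectivity and, later, control of its bidegree. -/
theorem sum_stairMap_cycRep (z : CycONH 𝕜 k n) :
    ∑ j, stairMap 𝕜 k n j (cycRep 𝕜 k n z (T.tmul (stairMonomial 𝕜 k j) 1)) = z := by
  have e : ∑ j, stairMap 𝕜 k n j (T.tmul (stairMonomial 𝕜 k j) 1) = 1 := by
    refine (Finset.sum_congr rfl fun j _ => stairMap_tmul_one j _).trans ?_
    rw [← map_sum (CycONH.mk 𝕜 k n), ← map_sum (tL 𝕜 k n), sum_stairCoeff, map_one (tL 𝕜 k n),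
      map_one (CycONH.mk 𝕜 k n)]
  refine (Finset.sum_congr rfl fun j _ => stairMap_cycRep j z _).trans ?_
  rw [← Finset.mul_sum, e, mul_one]

theorem actONH_toONH_tmul_one (f : OPol 𝕜 k) (m : M 𝕜 k n) :
    actONH 𝕜 k n (OPol.toONH 𝕜 k f) (T.tmul 1 m) = T.tmul f m :=
  (actONH_tmul _ _ _).trans (by rw [OPol.toONH_smul, mul_one])

theorem map_tL_mul_tL_mul_tR_mul_tL {C : Type*} [Ring C] [Algebra 𝕜 C]
    (ψ : (ONHComp 𝕜 k ᵍ⊗[𝕜] AComp 𝕜 n) →ₐ[𝕜] C) (u v w : ONH 𝕜 k) (a : A 𝕜 n) :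
    ψ (tL 𝕜 k n u * (tL 𝕜 k n v * tR 𝕜 k n a * tL 𝕜 k n w))
      = ψ (tL 𝕜 k n u) * (ψ (tL 𝕜 k n v) * ψ (tR 𝕜 k n a) * ψ (tL 𝕜 k n w)) := by
  rw [map_mul ψ, map_mul ψ, map_mul ψ]

/-- The element in question is `f θ(g) a y_j`. Its last factor sends `b_l ⊗ 1` to `δ_jl (1 ⊗ 1)`,
and the others rebuild `f ⊗ g a` from `1 ⊗ 1`. These elements play the role of matrix units. -/
theorem cycRep_stairMap_tmul (j l : Fin (k !)) (f : OPol 𝕜 k) (g : OSym 𝕜 k) (a : A 𝕜 n) :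
    cycRep 𝕜 k n (stairMap 𝕜 k n j (T.tmul f (M.left 𝕜 k n g * M.right 𝕜 k n a)))
      (T.tmul (stairMonomial 𝕜 k l) 1)
      = if j = l then T.tmul f (M.left 𝕜 k n g * M.right 𝕜 k n a) else 0 := by
  have e : cycRep 𝕜 k n (stairMap 𝕜 k n j (T.tmul f (M.left 𝕜 k n g * M.right 𝕜 k n a)))
      = actONH 𝕜 k n (OPol.toONH 𝕜 k f) * (actONH 𝕜 k n (OPol.toONH 𝕜 k (theta 𝕜 k g))
        * actA 𝕜 k n a * actONH 𝕜 k n (stairCoeff 𝕜 k j)) := by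
    refine (congrArg (cycRep 𝕜 k n) ((congrArg (fun m => stairMap 𝕜 k n j (T.tmul f m))
      (M.left_mul_right g a)).trans (stairMap_tmul_mk j f g a))).trans ((cycRep_mk _).trans ?_)
    refine (map_tL_mul_tL_mul_tR_mul_tL (actTens 𝕜 k n) _ _ _ _).trans ?_
    exact congrArg₂ (· * ·) (actTens_tL _) (congrArg₂ (· * ·) (congrArg₂ (· * ·) (actTens_tL _)
      (actTens_tR a)) (actTens_tL _))
  rw [e]
  change actONH 𝕜 k n (OPol.toONH 𝕜 k f) (actONH 𝕜 k n (OPol.toONH 𝕜 k (theta 𝕜 k g))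
    (actA 𝕜 k n a (actONH 𝕜 k n (stairCoeff 𝕜 k j) (T.tmul (stairMonomial 𝕜 k l) 1)))) = _
  have e1 : actONH 𝕜 k n (stairCoeff 𝕜 k j) (T.tmul (stairMonomial 𝕜 k l) 1)
      = if j = l then T.tmul (1 : OPol 𝕜 k) (1 : M 𝕜 k n) else (0 : T 𝕜 k n) := by
    refine (actONH_tmul _ _ _).trans ?_
    rw [stairCoeff_smul]
    split_ifs
    · rfl
    · exact T.zero_tmul 1
  let E : T 𝕜 k n →+ T 𝕜 k n := (actONH 𝕜 k n (OPol.toONH 𝕜 k f)).toAddMonoidHom.comp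
    ((actONH 𝕜 k n (OPol.toONH 𝕜 k (theta 𝕜 k g))).toAddMonoidHom.comp
      (actA 𝕜 k n a).toAddMonoidHom)
  refine (congrArg E e1).trans ?_
  by_cases h : j = l
  · have e2 : actA 𝕜 k n a (T.tmul (1 : OPol 𝕜 k) (1 : M 𝕜 k n)) = T.tmul 1 (M.right 𝕜 k n a) :=
      (actA_tmul_one a 1).trans (by rw [mul_one])
    have e3 : T.tmul (theta 𝕜 k g) (M.right 𝕜 k n a)
        = T.tmul 1 (M.left 𝕜 k n g * M.right 𝕜 k n a) := by
      rw [← T.tmul_mul_theta, one_mul]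
    exact (congrArg E (if_pos h)).trans (((congrArg (actONH 𝕜 k n (OPol.toONH 𝕜 k f))
      ((congrArg (actONH 𝕜 k n (OPol.toONH 𝕜 k (theta 𝕜 k g))) e2).trans
        ((actONH_toONH_tmul_one (theta 𝕜 k g) _).trans e3))).trans
          (actONH_toONH_tmul_one f _)).trans (if_pos h).symm)
  · exact (congrArg E (if_neg h)).trans ((map_zero E).trans (if_neg h).symm)

theorem cycRep_stairMap (j l : Fin (k !)) (t : T 𝕜 k n) :
    cycRep 𝕜 k n (stairMap 𝕜 k n j t) (T.tmul (stairMonomial 𝕜 k l) 1)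
      = if j = l then t else 0 := by
  let F : T 𝕜 k n →+ T 𝕜 k n := (EndT.eval (T.tmul (stairMonomial 𝕜 k l) 1)).comp
    ((cycRep 𝕜 k n).toLinearMap.toAddMonoidHom.comp (stairMap 𝕜 k n j).toAddMonoidHom)
  have h : ∀ s, F s = if j = l then s else 0 := by
    intro s
    induction s using T.induction with
    | h f m =>
      induction m using M.induction with
      | h g a => exact cycRep_stairMap_tmul j l f g a
      | hadd x y hx hy =>
        rw [T.tmul_add, map_add F, hx, hy]
        split_ifs
        · rfl
        · exact add_zero 0
    | hadd x y hx hy =>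
      rw [map_add F, hx, hy]
      split_ifs
      · rfl
      · exact add_zero 0
  exact h t

theorem cycRep_sum_stairMap (s : Fin (k !) → T 𝕜 k n) (l : Fin (k !)) :
    cycRep 𝕜 k n (∑ j, stairMap 𝕜 k n j (s j)) (T.tmul (stairMonomial 𝕜 k l) 1) = s l := by
  rw [map_sum (cycRep 𝕜 k n)]
  refine (EndT.sum_apply _ _ _).trans ((Finset.sum_congr rfl fun j _ =>
    cycRep_stairMap j l (s j)).trans ?_)
  rw [Finset.sum_ite_eq', if_pos (Finset.mem_univ l)]

theorem cycRep_injective : Function.Injective (cycRep 𝕜 k n) := fun z w h => by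
  rw [← sum_stairMap_cycRep z, ← sum_stairMap_cycRep w, h]

/-- An endomorphism is determined by its values on the `b_j ⊗ 1`, and the `j`-th map realises one
such value without disturbing the others. -/
theorem cycRep_surjective : Function.Surjective (cycRep 𝕜 k n) := fun E =>
  ⟨∑ j, stairMap 𝕜 k n j (E (T.tmul (stairMonomial 𝕜 k j) 1)),
    EndT.ext_stairMonomial fun l => cycRep_sum_stairMap _ l⟩

/-- The isomorphism of the deformed cyclotomic quotient with an endomorphism algebra. -/
def cycEquivEnd (𝕜 : Type*) [CommRing 𝕜] (k n : ℕ) : CycONH 𝕜 k n ≃ₐ[𝕜] EndT 𝕜 k n :=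
  AlgEquiv.ofBijective (cycRep 𝕜 k n) ⟨cycRep_injective, cycRep_surjective⟩

/-- The matrix of the action of an element of the deformed cyclotomic quotient. -/
def cycMat (z : CycONH 𝕜 k n) : Matrix (Fin (k !)) (Fin (k !)) (M 𝕜 k n) :=
  Matrix.of fun i j => stairCoord 𝕜 k n i (cycRep 𝕜 k n z (T.tmul (stairMonomial 𝕜 k j) 1))

theorem cycMat_apply (z : CycONH 𝕜 k n) (i j : Fin (k !)) : cycMat z i j
    = stairCoord 𝕜 k n i (cycRep 𝕜 k n z (T.tmul (stairMonomial 𝕜 k j) 1)) := rfl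

theorem sum_tmul_cycMat (z : CycONH 𝕜 k n) (j : Fin (k !)) :
    cycRep 𝕜 k n z (T.tmul (stairMonomial 𝕜 k j) 1)
      = ∑ i, T.tmul (stairMonomial 𝕜 k i) (cycMat z i j) :=
  (sum_tmul_stairCoord _).symm

theorem stairCoord_cycRep (z : CycONH 𝕜 k n) (i : Fin (k !)) (t : T 𝕜 k n) :
    stairCoord 𝕜 k n i (cycRep 𝕜 k n z t) = ∑ l, cycMat z i l * stairCoord 𝕜 k n l t := by
  have e : cycRep 𝕜 k n z t = ∑ l, MulOpposite.op (stairCoord 𝕜 k n l t) •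
      cycRep 𝕜 k n z (T.tmul (stairMonomial 𝕜 k l) 1) := by
    refine (congrArg (cycRep 𝕜 k n z) (sum_tmul_stairCoord t).symm).trans ?_
    refine (map_sum (cycRep 𝕜 k n z) _ _).trans (Finset.sum_congr rfl fun l _ => ?_)
    have e1 : T.tmul (stairMonomial 𝕜 k l) (stairCoord 𝕜 k n l t)
        = MulOpposite.op (stairCoord 𝕜 k n l t) • T.tmul (stairMonomial 𝕜 k l) 1 := by
      rw [T.op_smul_tmul, one_mul]
    exact (congrArg (cycRep 𝕜 k n z) e1).trans (map_smul (cycRep 𝕜 k n z) _ _)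
  rw [e]
  exact (map_sum (stairCoord 𝕜 k n i) _ _).trans
    (Finset.sum_congr rfl fun l _ => stairCoord_op_smul i _ _)

theorem cycMat_mul (z w : CycONH 𝕜 k n) : cycMat (z * w) = cycMat z * cycMat w := by
  ext i j
  rw [Matrix.mul_apply, cycMat_apply, map_mul (cycRep 𝕜 k n)]
  exact stairCoord_cycRep z i _

theorem cycMat_one : cycMat (1 : CycONH 𝕜 k n) = 1 := by
  ext i j
  rw [Matrix.one_apply, cycMat_apply, map_one (cycRep 𝕜 k n)]
  exact stairCoord_stairMonomial i j 1

theorem cycMat_add (z w : CycONH 𝕜 k n) : cycMat (z + w) = cycMat z + cycMat w := by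
  ext i j
  rw [Matrix.add_apply, cycMat_apply, map_add (cycRep 𝕜 k n)]
  exact map_add (stairCoord 𝕜 k n i) _ _

theorem cycMat_smul (c : 𝕜) (z : CycONH 𝕜 k n) : cycMat (c • z) = c • cycMat z := by
  ext i j
  rw [Matrix.smul_apply, cycMat_apply, map_smul (cycRep 𝕜 k n)]
  exact map_smul (stairCoord 𝕜 k n i) c _

/-- The matrix of the action, as an algebra map. -/
def cycMatHom (𝕜 : Type*) [CommRing 𝕜] (k n : ℕ) :
    CycONH 𝕜 k n →ₐ[𝕜] Matrix (Fin (k !)) (Fin (k !)) (M 𝕜 k n) :=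
  AlgHom.ofLinearMap (IsLinearMap.mk' cycMat ⟨cycMat_add, cycMat_smul⟩) cycMat_one cycMat_mul

theorem cycMat_injective : Function.Injective (cycMat (𝕜 := 𝕜) (k := k) (n := n)) := fun z w h =>
  cycRep_injective (EndT.ext_stairMonomial fun j => by rw [sum_tmul_cycMat, sum_tmul_cycMat, h])

theorem cycMat_surjective : Function.Surjective (cycMat (𝕜 := 𝕜) (k := k) (n := n)) := fun P => by
  refine ⟨∑ j, stairMap 𝕜 k n j (∑ i, T.tmul (stairMonomial 𝕜 k i) (P i j)), ?_⟩
  ext i j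
  rw [cycMat_apply, cycRep_sum_stairMap, map_sum (stairCoord 𝕜 k n i)]
  refine (Finset.sum_congr rfl fun l _ => stairCoord_stairMonomial i l (P l j)).trans ?_
  rw [Finset.sum_ite_eq, if_pos (Finset.mem_univ i)]

/-- The isomorphism of the deformed cyclotomic quotient with a matrix algebra. -/
def cycEquivMat (𝕜 : Type*) [CommRing 𝕜] (k n : ℕ) :
    CycONH 𝕜 k n ≃ₐ[𝕜] Matrix (Fin (k !)) (Fin (k !)) (M 𝕜 k n) :=
  AlgEquiv.ofBijective (cycMatHom 𝕜 k n) ⟨cycMat_injective, cycMat_surjective⟩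

end Isomorphism


/-! ### Gradings -/

section Grading

variable {𝕜 : Type*} [CommRing 𝕜] {k n : ℕ}

theorem M.left_mul_right_mem {p q r : Bideg} (h : p + q = r) {g : OSym 𝕜 k}
    (hg : g ∈ OSymComp 𝕜 k p) {a : A 𝕜 n} (ha : a ∈ AComp 𝕜 n q) :
    M.left 𝕜 k n g * M.right 𝕜 k n a ∈ MComp 𝕜 k n r := by
  rw [M.left_mul_right]
  exact ⟨g ᵍ⊗ₜ[𝕜] a, Submodule.subset_span ⟨p, q, h, g, hg, a, ha, rfl⟩, rfl⟩

theorem MComp_le {r : Bideg} {N : Submodule 𝕜 (M 𝕜 k n)}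
    (h : ∀ p q, p + q = r → ∀ g ∈ OSymComp 𝕜 k p, ∀ a ∈ AComp 𝕜 n q,
      M.left 𝕜 k n g * M.right 𝕜 k n a ∈ N) : MComp 𝕜 k n r ≤ N := by
  rw [MComp, Submodule.map_le_iff_le_comap, tensComp, Submodule.span_le]
  rintro _ ⟨p, q, hpq, g, hg, a, ha, rfl⟩
  have := h p q hpq g hg a ha
  rwa [M.left_mul_right] at this

theorem M.left_mul_mem {p r : Bideg} {g : OSym 𝕜 k} (hg : g ∈ OSymComp 𝕜 k p) {m : M 𝕜 k n}
    (hm : m ∈ MComp 𝕜 k n r) : M.left 𝕜 k n g * m ∈ MComp 𝕜 k n (p + r) := by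
  refine MComp_le (k := k) (n := n) (N := (MComp 𝕜 k n (p + r)).comap
    (LinearMap.mulLeft 𝕜 (M.left 𝕜 k n g))) ?_ hm
  rintro q s rfl g' hg' a ha
  rw [Submodule.mem_comap, LinearMap.mulLeft_apply, ← mul_assoc, ← map_mul (M.left 𝕜 k n)]
  exact M.left_mul_right_mem (add_assoc p q s) (SetLike.GradedMul.mul_mem hg hg') ha

theorem M.right_mul_mem {p r : Bideg} {a : A 𝕜 n} (ha : a ∈ AComp 𝕜 n p) {m : M 𝕜 k n}
    (hm : m ∈ MComp 𝕜 k n r) : M.right 𝕜 k n a * m ∈ MComp 𝕜 k n (p + r) := by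
  refine MComp_le (k := k) (n := n) (N := (MComp 𝕜 k n (p + r)).comap
    (LinearMap.mulLeft 𝕜 (M.right 𝕜 k n a))) ?_ hm
  rintro q s rfl g hg a' ha'
  rw [Submodule.mem_comap, LinearMap.mulLeft_apply, ← mul_assoc, M.right_mul_left ha hg,
    smul_mul_assoc, mul_assoc, ← map_mul (M.right 𝕜 k n)]
  exact units_smul_mem _ _ (M.left_mul_right_mem (add_left_comm q p s) hg
    (SetLike.GradedMul.mul_mem ha ha'))

theorem M.one_mem : (1 : M 𝕜 k n) ∈ MComp 𝕜 k n 0 := by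
  have := M.left_mul_right_mem (n := n) (add_zero (0 : Bideg))
    (SetLike.GradedOne.one_mem (A := OSymComp 𝕜 k)) (SetLike.GradedOne.one_mem (A := AComp 𝕜 n))
  rwa [map_one (M.left 𝕜 k n), map_one (M.right 𝕜 k n), one_mul] at this

theorem T.tmul_mem {p q r : Bideg} (h : p + q = r) {f : OPol 𝕜 k} (hf : f ∈ OPolComp 𝕜 k p)
    {m : M 𝕜 k n} (hm : m ∈ MComp 𝕜 k n q) : T.tmul f m ∈ TComp 𝕜 k n r :=
  Submodule.subset_span ⟨p, q, h, f, hf, m, hm, rfl⟩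

theorem TComp_le {r : Bideg} {N : Submodule 𝕜 (T 𝕜 k n)}
    (h : ∀ p q, p + q = r → ∀ f ∈ OPolComp 𝕜 k p, ∀ m ∈ MComp 𝕜 k n q, T.tmul f m ∈ N) :
    TComp 𝕜 k n r ≤ N := by
  rw [TComp, Submodule.span_le]
  rintro _ ⟨p, q, hpq, f, hf, m, hm, rfl⟩
  exact h p q hpq f hf m hm

theorem CycONHComp_le {r : Bideg} {N : Submodule 𝕜 (CycONH 𝕜 k n)}
    (h : ∀ p q, p + q = r → ∀ u ∈ ONHComp 𝕜 k p, ∀ a ∈ AComp 𝕜 n q,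
      CycONH.mk 𝕜 k n (u ᵍ⊗ₜ[𝕜] a) ∈ N) : CycONHComp 𝕜 k n r ≤ N := by
  rw [CycONHComp, Submodule.map_le_iff_le_comap, tensComp, Submodule.span_le]
  rintro _ ⟨p, q, hpq, u, hu, a, ha, rfl⟩
  exact h p q hpq u hu a ha

theorem CycONH.mk_mem {p q r : Bideg} (h : p + q = r) {u : ONH 𝕜 k} (hu : u ∈ ONHComp 𝕜 k p)
    {a : A 𝕜 n} (ha : a ∈ AComp 𝕜 n q) :
    CycONH.mk 𝕜 k n (u ᵍ⊗ₜ[𝕜] a) ∈ CycONHComp 𝕜 k n r :=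
  ⟨u ᵍ⊗ₜ[𝕜] a, Submodule.subset_span ⟨p, q, h, u, hu, a, ha, rfl⟩, rfl⟩

/-- Evaluation of the action at a vector, as a linear map. -/
def cycRepEval (t : T 𝕜 k n) : CycONH 𝕜 k n →ₗ[𝕜] T 𝕜 k n where
  toFun z := cycRep 𝕜 k n z t
  map_add' z w := congrArg (fun E : EndT 𝕜 k n => E t) (map_add (cycRep 𝕜 k n) z w)
  map_smul' c z := congrArg (fun E : EndT 𝕜 k n => E t) (map_smul (cycRep 𝕜 k n) c z)

theorem cycRep_mem {g p : Bideg} {z : CycONH 𝕜 k n} (hz : z ∈ CycONHComp 𝕜 k n g)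
    {t : T 𝕜 k n} (ht : t ∈ TComp 𝕜 k n p) : cycRep 𝕜 k n z t ∈ TComp 𝕜 k n (g + p) := by
  refine CycONHComp_le (N := (TComp 𝕜 k n (g + p)).comap (cycRepEval t)) ?_ hz
  rintro r s rfl u hu a ha
  refine TComp_le (N := (TComp 𝕜 k n (r + s + p)).comap
    ((cycRep 𝕜 k n (CycONH.mk 𝕜 k n (u ᵍ⊗ₜ[𝕜] a))).restrictScalars 𝕜)) ?_ ht
  rintro v w rfl f hf m hm
  refine (congrArg (· ∈ TComp 𝕜 k n (r + s + (v + w))) (cycRep_tmul u ha hf m)).mpr ?_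
  exact units_smul_mem _ _ (T.tmul_mem (add_add_add_comm r v s w) (OPol.smul_mem hu hf)
    (M.right_mul_mem ha hm))

theorem stairSym_mem (i : Fin (k !)) {p : Bideg} {f : OPol 𝕜 k} (hf : f ∈ OPolComp 𝕜 k p) :
    stairSym 𝕜 k i f ∈ OSymComp 𝕜 k (p - stairDeg k i) := by
  rw [sub_eq_neg_add]
  exact theta_mem (OPol.smul_mem (stairCoeff_mem i) hf)

theorem stairCoord_mem (i : Fin (k !)) {p : Bideg} {t : T 𝕜 k n} (ht : t ∈ TComp 𝕜 k n p) :
    stairCoord 𝕜 k n i t ∈ MComp 𝕜 k n (p - stairDeg k i) := by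
  refine TComp_le (N := (MComp 𝕜 k n (p - stairDeg k i)).comap (stairCoord 𝕜 k n i)) ?_ ht
  rintro r s rfl f hf m hm
  rw [Submodule.mem_comap, stairCoord_tmul, add_sub_right_comm]
  exact M.left_mul_mem (stairSym_mem i hf) hm

theorem stairMap_mem (j : Fin (k !)) {p : Bideg} {t : T 𝕜 k n} (ht : t ∈ TComp 𝕜 k n p) :
    stairMap 𝕜 k n j t ∈ CycONHComp 𝕜 k n (p - stairDeg k j) := by
  refine TComp_le (N := (CycONHComp 𝕜 k n (p - stairDeg k j)).comap (stairMap 𝕜 k n j)) ?_ ht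
  rintro r s rfl f hf m hm
  refine MComp_le (N := (CycONHComp 𝕜 k n (r + s - stairDeg k j)).comap
    ((stairMap 𝕜 k n j).comp (T.tmulₗ 𝕜 k n f))) ?_ hm
  rintro v w rfl g hg a ha
  -- The coefficient `a` has to be moved to the right of `y_j` to reach the form `u ⊗ a`; the sign
  -- pairs the bidegree of `a` with `-deg b_j`.
  have e : stairMap 𝕜 k n j (T.tmul f (M.left 𝕜 k n g * M.right 𝕜 k n a))
      = (-1 : ℤˣ) ^ (w * -stairDeg k j) • CycONH.mk 𝕜 k n
        ((OPol.toONH 𝕜 k f * (OPol.toONH 𝕜 k (theta 𝕜 k g) * stairCoeff 𝕜 k j)) ᵍ⊗ₜ[𝕜] a) := by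
    refine (congrArg (fun m => stairMap 𝕜 k n j (T.tmul f m)) (M.left_mul_right g a)).trans ?_
    refine (stairMap_tmul_mk j f g a).trans ?_
    rw [← tL_mul_tR, map_tL_mul_tL_mul_tR_mul_tL, mul_assoc (CycONH.mk 𝕜 k n (tL 𝕜 k n _)),
      map_tR_mul_tL _ ha (stairCoeff_mem j), mul_smul_comm, mul_smul_comm,
      map_mul (tL 𝕜 k n), map_mul (tL 𝕜 k n), map_mul (CycONH.mk 𝕜 k n),
      map_mul (CycONH.mk 𝕜 k n), map_mul (CycONH.mk 𝕜 k n)]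
    simp only [mul_assoc]
  refine (congrArg (· ∈ CycONHComp 𝕜 k n (r + (v + w) - stairDeg k j)) e).mpr ?_
  refine units_smul_mem _ _ (CycONH.mk_mem ?_ (SetLike.GradedMul.mul_mem (OPol.toONH_mem hf)
    (SetLike.GradedMul.mul_mem (OPol.toONH_mem (theta_mem hg)) (stairCoeff_mem j))) ha)
  abel

/-- In the reconstruction formula `sum_stairMap_cycRep` the `j`-th map lowers the bidegree by `deg
b_j`, so every summand has bidegree `g`. This gives the converse direction for both gradings without
decomposing the quotient. -/
theorem mem_of_cycRep_mem {g : Bideg} {z : CycONH 𝕜 k n}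
    (h : ∀ j, cycRep 𝕜 k n z (T.tmul (stairMonomial 𝕜 k j) 1) ∈ TComp 𝕜 k n (g + stairDeg k j)) :
    z ∈ CycONHComp 𝕜 k n g := by
  rw [← sum_stairMap_cycRep z]
  refine Submodule.sum_mem _ fun j _ => ?_
  have := stairMap_mem j (h j)
  rwa [add_sub_cancel_right] at this

theorem stairMonomial_tmul_one_mem (j : Fin (k !)) :
    T.tmul (stairMonomial 𝕜 k j) (1 : M 𝕜 k n) ∈ TComp 𝕜 k n (stairDeg k j) :=
  T.tmul_mem (add_zero _) (stairMonomial_mem j) M.one_mem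

theorem mem_CycONHComp_iff_End {g : Bideg} {z : CycONH 𝕜 k n} :
    z ∈ CycONHComp 𝕜 k n g ↔ cycRep 𝕜 k n z ∈ EndTComp 𝕜 k n g :=
  ⟨fun hz _ _ ht => cycRep_mem hz ht,
    fun h => mem_of_cycRep_mem fun j => h _ _ (stairMonomial_tmul_one_mem j)⟩

theorem mem_CycONHComp_iff_Mat {g : Bideg} {z : CycONH 𝕜 k n} :
    z ∈ CycONHComp 𝕜 k n g ↔ cycMat z ∈ MatComp 𝕜 k n g := by
  constructor
  · intro hz i j
    exact stairCoord_mem i (cycRep_mem hz (stairMonomial_tmul_one_mem j))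
  · intro h
    refine mem_of_cycRep_mem fun j => ?_
    rw [sum_tmul_cycMat]
    exact Submodule.sum_mem _ fun i _ => T.tmul_mem (add_sub_cancel _ _) (stairMonomial_mem i)
      (h i j)

end Grading

end OddGrassmannian


theorem theorem3 {𝕜 : Type*} [CommRing 𝕜] (k n : ℕ) :
    ∃ (Φ : OddGrassmannian.CycONH 𝕜 k n ≃ₐ[𝕜] OddGrassmannian.EndT 𝕜 k n)
      (Ψ : OddGrassmannian.CycONH 𝕜 k n ≃ₐ[𝕜]
        Matrix (Fin (k !)) (Fin (k !)) (OddGrassmannian.M 𝕜 k n)),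
      (∀ g z, z ∈ OddGrassmannian.CycONHComp 𝕜 k n g ↔ Φ z ∈ OddGrassmannian.EndTComp 𝕜 k n g) ∧
      (∀ g z, z ∈ OddGrassmannian.CycONHComp 𝕜 k n g ↔ Ψ z ∈ OddGrassmannian.MatComp 𝕜 k n g) ∧
      (∀ (p q : OddGrassmannian.Bideg) (u : OddGrassmannian.ONH 𝕜 k),
        ∀ a ∈ OddGrassmannian.AComp 𝕜 n p, ∀ f ∈ OddGrassmannian.OPolComp 𝕜 k q,
        ∀ m : OddGrassmannian.M 𝕜 k n,
          Φ (OddGrassmannian.CycONH.mk 𝕜 k n (u ᵍ⊗ₜ[𝕜] a)) (OddGrassmannian.T.tmul f m)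
            = (-1 : ℤˣ) ^ (p * q) • OddGrassmannian.T.tmul (OddGrassmannian.polyRep 𝕜 k u f)
                (OddGrassmannian.M.mk 𝕜 k n (1 ᵍ⊗ₜ[𝕜] a) * m)) ∧
      (∀ (z : OddGrassmannian.CycONH 𝕜 k n) (j : Fin (k !)),
        Φ z (OddGrassmannian.T.tmul (OddGrassmannian.stairMonomial 𝕜 k j) 1)
          = ∑ i, OddGrassmannian.T.tmul (OddGrassmannian.stairMonomial 𝕜 k i) (Ψ z i j)) :=
  ⟨OddGrassmannian.cycEquivEnd 𝕜 k n, OddGrassmannian.cycEquivMat 𝕜 k n,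
    fun _ _ => OddGrassmannian.mem_CycONHComp_iff_End,
    fun _ _ => OddGrassmannian.mem_CycONHComp_iff_Mat,
    fun _ _ u _ ha _ hf m => OddGrassmannian.cycRep_tmul u ha hf m,
    OddGrassmannian.sum_tmul_cycMat⟩
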